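/- Let $k$ be a field of characteristic $0$, $K=k((h))$, $\lambda\in k^{\times}$, and let $\Phi\in k\langle\langle x,y\rangle\rangle$ be an even Drinfeld associator with parameter $\lambda$: $\Phi$ is group-like, $\Phi(y,x)=\Phi(x,y)^{-1}$, $\Phi(-x,-y)=\Phi(x,y)$, and $\Phi$ satisfies the hexagon equation $e^{\lambda x/2}\Phi(z,x)e^{\lambda z/2}\Phi(y,z)e^{\lambda y/2}\Phi(x,y)=1$ ($z=-x-y$) and the pentagon equation. Assume that $k$ contains, for every $d\ge 2$, a square root $\sqrt{d^2-1}$ (fixed once and for all). Put $q=e^{\lambda h}$ and $[n]_q=(q^n-q^{-n})/(q-q^{-1})$; $H_n(q)$ is the quotient of $KB_n$ by $(\sigma_1-q)(\sigma_1+q^{-1})=0$. *Tableaux.* A partition of $n$ is drawn as a diagram whose column lengths are its parts. Given $2\times2$ matrices $(M_d)_{d\ge2}$ over a field and a nonzero scalar $q$, let $\sigma_r$ ($1\le r<n$) act on the space with basis the standard tableaux of shape $\alpha\vdash n$ by: $\sigma_rT=qT$ (resp. $-q^{-1}T$) if $r,r+1$ lie in the same column (resp. line) of $T$; otherwise, if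 $T'$ is obtained from $T$ by exchanging $r$ and $r+1$, and if the column $c$ of $r$ in $T$ precedes the column $c'$ of $r+1$, then $\sigma_r$ acts on the plane with basis $(T,T')$ by the matrix $M_d$, where $d=l-l'+c'-c$ and $l,l'$ are the lines of $r,r+1$ in $T$. The family $(M_d)$ is a matrix model of $H_n(q)$ (of the symmetric groups if $q=1$) if for all $n$ and all $\alpha\vdash n$ this defines a representation of $H_n(q)$ in the class attached to $\alpha$ (with $[n]$ attached to $\sigma_r\mapsto q$). *Infinitesimal representations.* Let $\mathfrak B_n(k)=k\mathfrak S_n\ltimes U\mathcal T_n(k)$ be the algebra of infinitesimal braids, with generators $s\in\mathfrak S_n$ and $t_{ij}$, and $Y_r=\sum_{i<r}t_{ir}$. For a matrix representation $\rho$ of $\mathfrak B_n(k)$, $\widehat\Phi(\rho)$ is the representation of $B_n$ over $K$ given by $$\widehat\Phi(\rho)(\sigma_r)=\bar\rho\big(\Phi(t_{r,r+1},Y_r)\,s_r\,e^{\lambda t_{r,r+1}/2}\,\Phi(Y_r,t_{r,r+1})\big),\qquad \bar\rho(s)=\rho(s),\ \bar\rho(t_{ij})=h\rho(t_{ij}).$$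 Then: 1. Young's orthonormal model $M_d^1=\frac1d\begin{pmatrix}-1&\sqrt{d^2-1}\\ \sqrt{d^2-1}&1\end{pmatrix}$ is a matrix model of the symmetric groups; for $\alpha\vdash n$ let $\rho_{0,\alpha}$ be the representation of $\mathfrak S_n$ on standard tableaux of shape $\alpha$ that it defines. It extends to a representation $\rho_\alpha$ of $\mathfrak B_n(k)$ (the infinitesimal Iwahori–Hecke representation) with $\rho_\alpha(t_{ij})=2\rho_{0,\alpha}((i\,j))$ for $i\ne j$. 2. For every $d\ge2$ there is a unique square root $\sqrt{[d+1]_q[d-1]_q}\in k[[h]]$ with constant term $\sqrt{d^2-1}$. 3. For every $n\geq 1$ and $\alpha\vdash n$, $\widehat\Phi(\rho_\alpha)$ is a representation of $B_n$, in which the generators $\sigma_r$ act on the basis of standard tableaux as prescribed above by the scalar $q$ and the matrices $$M_d^q=\frac1{[d]_q}\begin{pmatrix}-q^{-d}&\sqrt{[d+1]_q[d-1]_q}\\ \sqrt{[d+1]_q[d-1]_q}&q^d\end{pmatrix},\qquad d\ge2,$$ and $(M_d^q)_{d\ge2}$ is a matrix model of $H_n(q)$. 4. This model is unitary (in particular when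 $k\subset\mathbb R$): let $\varepsilon$ be the involution $f(h)\mapsto f(-h)$ of $K$ and $U_N^\varepsilon(K)=\{x\in GL_N(K)\mid x^{-1}={}^t\varepsilon(x)\}$; then $M_d^q\in U_2^\varepsilon(K)$ for every $d\ge2$, and every $\widehat\Phi(\rho_\alpha)(g)$, $g\in B_n$, lies in $U_N^\varepsilon(K)$, $N$ being the number of standard tableaux of shape $\alpha$. -/

import Mathlib

open scoped PowerSeries TensorProduct

noncomputable section

namespace EvenAssoc

/-! ### Formal series in two noncommuting variables -/

/-- A formal series in two noncommuting variables `x` (letter `0`) and `y` (letter `1`), i.e. an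
element of `k⟪x, y⟫`, given by the coefficient of each word. -/
abbrev NCSeries (k : Type*) := List (Fin 2) → k

/-- The series `Φ(-x, -y)`. -/
def NCSeries.bar {k : Type*} [Field k] (Φ : NCSeries k) : NCSeries k :=
  fun w => (-1) ^ w.length * Φ w

/-- The substitution `Φ(h u, h v) ∈ R⟦h⟧`, for `u, v` in a (not necessarily commutative)
`k`-algebra `R`: the coefficient of `h ^ n` is the value at `(u, v)` of the part of degree `n`
of `Φ`.

If `R = ⨁ Rₙ` is graded and `u, v` have degree one, then the completion `∏ Rₙ` of `R` is identified
with the algebra of the series `∑ aₙ hⁿ` with `aₙ ∈ Rₙ`, and this is the usual substitution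
`Φ(u, v)` in the completion of `R`. All equations between elements of completed graded algebras
are written in this way below. -/
def NCSeries.subst {k : Type*} [Field k] (Φ : NCSeries k) {R : Type*} [Ring R] [Algebra k R]
    (u v : R) : R⟦X⟧ :=
  PowerSeries.mk fun n => ∑ w : Fin n → Fin 2,
    Φ (List.ofFn w) • (List.ofFn fun i => ![u, v] (w i)).prod

/-- The exponential `exp (c h a) = ∑ (c ^ n / n!) a ^ n h ^ n ∈ R⟦h⟧`. -/
def expH {k : Type*} [Field k] (c : k) {R : Type*} [Ring R] [Algebra k R] (a : R) : R⟦X⟧ :=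
  PowerSeries.mk fun n => (c ^ n / (n.factorial : k)) • a ^ n

/-! ### Infinitesimal braids -/

/-- The defining relations of the enveloping algebra of the holonomy Lie algebra `𝒯ₙ(k)`
(the indices `1, …, n` are shifted to `0, …, n - 1`). -/
inductive HolonomyRel (k : Type*) [Field k] (n : ℕ) :
    FreeAlgebra k (Fin n × Fin n) → FreeAlgebra k (Fin n × Fin n) → Prop
  | diag (i : Fin n) : HolonomyRel k n (FreeAlgebra.ι k (i, i)) 0
  | symm (i j : Fin n) : HolonomyRel k n (FreeAlgebra.ι k (i, j)) (FreeAlgebra.ι k (j, i))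
  | far (i j p l : Fin n) (hcard : ({i, j, p, l} : Finset (Fin n)).card = 4) :
      HolonomyRel k n
        (FreeAlgebra.ι k (i, j) * FreeAlgebra.ι k (p, l))
        (FreeAlgebra.ι k (p, l) * FreeAlgebra.ι k (i, j))
  | triple (i j p : Fin n) :
      HolonomyRel k n
        (FreeAlgebra.ι k (i, j) * (FreeAlgebra.ι k (i, p) + FreeAlgebra.ι k (p, j)))
        ((FreeAlgebra.ι k (i, p) + FreeAlgebra.ι k (p, j)) * FreeAlgebra.ι k (i, j))

/-- The enveloping algebra `U𝒯ₙ(k)` of the holonomy Lie algebra, presented by the generators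
and relations of `𝒯ₙ(k)`. -/
abbrev UHolonomy (k : Type*) [Field k] (n : ℕ) := RingQuot (HolonomyRel k n)

/-- The generator `t_{ij}` of `U𝒯ₙ(k)`. -/
def UHolonomy.t (k : Type*) [Field k] {n : ℕ} (i j : Fin n) : UHolonomy k n :=
  RingQuot.mkAlgHom k (HolonomyRel k n) (FreeAlgebra.ι k (i, j))

/-- The defining relations of `𝔅ₙ(k)`, the semidirect product of the group algebra `k 𝔖ₙ` by
`U𝒯ₙ(k)`, on the generators `s ∈ 𝔖ₙ` and `t_{ij}`: those of `k 𝔖ₙ`, those of `U𝒯ₙ(k)` and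
`s t_{ij} s⁻¹ = t_{s(i) s(j)}`. -/
inductive InfBraidRel (k : Type*) [Field k] (n : ℕ) :
    FreeAlgebra k (Equiv.Perm (Fin n) ⊕ Fin n × Fin n) →
      FreeAlgebra k (Equiv.Perm (Fin n) ⊕ Fin n × Fin n) → Prop
  | one : InfBraidRel k n (FreeAlgebra.ι k (Sum.inl 1)) 1
  | mul (g g' : Equiv.Perm (Fin n)) : InfBraidRel k n
      (FreeAlgebra.ι k (Sum.inl (g * g')))
      (FreeAlgebra.ι k (Sum.inl g) * FreeAlgebra.ι k (Sum.inl g'))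
  | hol (a b : FreeAlgebra k (Fin n × Fin n)) (hab : HolonomyRel k n a b) : InfBraidRel k n
      (FreeAlgebra.lift k (fun p => FreeAlgebra.ι k (Sum.inr p)) a)
      (FreeAlgebra.lift k (fun p => FreeAlgebra.ι k (Sum.inr p)) b)
  | act (g : Equiv.Perm (Fin n)) (i j : Fin n) : InfBraidRel k n
      (FreeAlgebra.ι k (Sum.inl g) * FreeAlgebra.ι k (Sum.inr (i, j)))
      (FreeAlgebra.ι k (Sum.inr (g i, g j)) * FreeAlgebra.ι k (Sum.inl g))

/-- The algebra `𝔅ₙ(k)` of infinitesimal braids. -/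
abbrev InfBraid (k : Type*) [Field k] (n : ℕ) := RingQuot (InfBraidRel k n)

/-- The element of `𝔅ₙ(k)` given by a permutation. -/
def InfBraid.s (k : Type*) [Field k] {n : ℕ} (g : Equiv.Perm (Fin n)) : InfBraid k n :=
  RingQuot.mkAlgHom k (InfBraidRel k n) (FreeAlgebra.ι k (Sum.inl g))

/-- The generator `t_{ij}` of `𝔅ₙ(k)`. -/
def InfBraid.t (k : Type*) [Field k] {n : ℕ} (i j : Fin n) : InfBraid k n :=
  RingQuot.mkAlgHom k (InfBraidRel k n) (FreeAlgebra.ι k (Sum.inr (i, j)))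

/-- `Y_j = ∑_{i < j} t_{ij}`. -/
def InfBraid.Y (k : Type*) [Field k] {n : ℕ} (j : Fin n) : InfBraid k n :=
  ∑ i ∈ Finset.univ.filter (fun i => i < j), InfBraid.t k i j

/-! ### Drinfeld associators -/

/-- `Φ ∈ Ass_λ(k)`. The equations are equations in the completions of `k⟨x,y⟩ ⊗ k⟨x,y⟩`, of
`k⟨x,y⟩`, and of `U𝒯₄(k)`. -/
structure IsAssociator {k : Type*} [Field k] (lam : k) (Φ : NCSeries k) : Prop where
  /-- `Δ(Φ) = Φ ⊗ Φ`, where `Δ` is the coproduct for which `x` and `y` are primitive. -/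
  grouplike :
    let x : FreeAlgebra k (Fin 2) := FreeAlgebra.ι k 0
    let y : FreeAlgebra k (Fin 2) := FreeAlgebra.ι k 1
    Φ.subst (x ⊗ₜ[k] (1 : FreeAlgebra k (Fin 2)) + (1 : FreeAlgebra k (Fin 2)) ⊗ₜ[k] x)
        (y ⊗ₜ[k] (1 : FreeAlgebra k (Fin 2)) + (1 : FreeAlgebra k (Fin 2)) ⊗ₜ[k] y) =
      Φ.subst (x ⊗ₜ[k] (1 : FreeAlgebra k (Fin 2))) (y ⊗ₜ[k] (1 : FreeAlgebra k (Fin 2))) *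
        Φ.subst ((1 : FreeAlgebra k (Fin 2)) ⊗ₜ[k] x) ((1 : FreeAlgebra k (Fin 2)) ⊗ₜ[k] y)
  /-- `Φ(y, x) = Φ(x, y)⁻¹`. -/
  inverse :
    let x : FreeAlgebra k (Fin 2) := FreeAlgebra.ι k 0
    let y : FreeAlgebra k (Fin 2) := FreeAlgebra.ι k 1
    Φ.subst y x * Φ.subst x y = 1 ∧ Φ.subst x y * Φ.subst y x = 1
  /-- The hexagon equation. -/
  hexagon :
    let x : FreeAlgebra k (Fin 2) := FreeAlgebra.ι k 0
    let y : FreeAlgebra k (Fin 2) := FreeAlgebra.ι k 1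
    let z := -x - y
    expH (lam / 2) x * Φ.subst z x * expH (lam / 2) z * Φ.subst y z * expH (lam / 2) y *
      Φ.subst x y = 1
  /-- The pentagon equation. -/
  pentagon :
    let t : Fin 4 → Fin 4 → UHolonomy k 4 := UHolonomy.t k
    Φ.subst (t 0 1) (t 1 2 + t 1 3) * Φ.subst (t 0 2 + t 1 2) (t 2 3) =
      Φ.subst (t 1 2) (t 2 3) * Φ.subst (t 0 1 + t 0 2) (t 1 3 + t 2 3) *
        Φ.subst (t 0 1) (t 1 2)

/-! ### Braid groups and the functor attached to an associator

The braid group on `n = m + 1` strands has `m` generators; the generator with index `r : Fin m`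
braids the strands `r.castSucc` and `r.succ`. -/

/-- The Artin relations. -/
def braidRels (m : ℕ) : Set (FreeGroup (Fin m)) :=
  {g | (∃ i j : Fin m, (i : ℕ) + 1 < j ∧
      g = (FreeGroup.of i * FreeGroup.of j) * (FreeGroup.of j * FreeGroup.of i)⁻¹) ∨
    (∃ i j : Fin m, (i : ℕ) + 1 = j ∧
      g = (FreeGroup.of i * FreeGroup.of j * FreeGroup.of i) *
        (FreeGroup.of j * FreeGroup.of i * FreeGroup.of j)⁻¹)}

/-- The braid group `B_{m+1}` on `m + 1` strands. -/
abbrev BraidGroup (m : ℕ) := PresentedGroup (braidRels m)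

/-- The Artin generators. -/
def BraidGroup.σ {m : ℕ} (r : Fin m) : BraidGroup m := PresentedGroup.of r

/-- The adjacent transposition `s_r`. -/
def adjSwap {m : ℕ} (r : Fin m) : Equiv.Perm (Fin (m + 1)) := Equiv.swap r.castSucc r.succ

/-- `Φ̃(σ_r) = Φ(t_{r,r+1}, Y_r) s_r exp(λ t_{r,r+1} / 2) Φ(Y_r, t_{r,r+1})` in the completion of
`𝔅_{m+1}(k)`. -/
def phiTilde {k : Type*} [Field k] (lam : k) (Φ : NCSeries k) {m : ℕ} (r : Fin m) :
    (InfBraid k (m + 1))⟦X⟧ :=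
  let t := InfBraid.t k r.castSucc r.succ
  let Y := InfBraid.Y k r.castSucc
  Φ.subst t Y * PowerSeries.C (InfBraid.s k (adjSwap r)) * expH (lam / 2) t * Φ.subst Y t

/-- For a matrix representation `ρ` of `𝔅_{m+1}(k)`, the matrix over `K = k((h))` of
`Φ̂(ρ)(σ_r) = ρ̄ (Φ̃(σ_r))`, where `ρ̄(s) = ρ(s)` and `ρ̄(t_{ij}) = h ρ(t_{ij})`. -/
def phiHat {k : Type*} [Field k] (lam : k) (Φ : NCSeries k) {m : ℕ}
    {N : Type*} [Fintype N] [DecidableEq N]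
    (ρ : InfBraid k (m + 1) →ₐ[k] Matrix N N k) (r : Fin m) : Matrix N N (LaurentSeries k) :=
  Matrix.of fun i j =>
    ((PowerSeries.mk fun n => ρ (PowerSeries.coeff n (phiTilde lam Φ r)) i j : k⟦X⟧) :
      LaurentSeries k)

/-! ### Standard tableaux and matrix models

A cell `(i, j)` of a Young diagram lies in line `j` and column `i`, so that a partition is the
list of the lengths of the columns of its diagram (these are the rows in the English convention
of `YoungDiagram`). -/

/-- Standard tableaux of shape `α`, filled with `0, …, n - 1` (instead of `1, …, n`), given by the
position of each entry; the entries increase in each line and each column. -/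
def StdTableau (α : YoungDiagram) (n : ℕ) : Type :=
  {T : Fin n ≃ α.cells // ∀ a b : Fin n,
    ((T a).1.1 = (T b).1.1 ∧ (T a).1.2 < (T b).1.2 → a < b) ∧
    ((T a).1.2 = (T b).1.2 ∧ (T a).1.1 < (T b).1.1 → a < b)}

instance (α : YoungDiagram) (n : ℕ) : Fintype (StdTableau α n) :=
  inferInstanceAs (Fintype {T : Fin n ≃ α.cells // ∀ a b : Fin n,
    ((T a).1.1 = (T b).1.1 ∧ (T a).1.2 < (T b).1.2 → a < b) ∧
    ((T a).1.2 = (T b).1.2 ∧ (T a).1.1 < (T b).1.1 → a < b)})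

instance (α : YoungDiagram) (n : ℕ) : DecidableEq (StdTableau α n) :=
  inferInstanceAs (DecidableEq {T : Fin n ≃ α.cells // ∀ a b : Fin n,
    ((T a).1.1 = (T b).1.1 ∧ (T a).1.2 < (T b).1.2 → a < b) ∧
    ((T a).1.2 = (T b).1.2 ∧ (T a).1.1 < (T b).1.1 → a < b)})

/-- The column of the entry `a`. -/
def StdTableau.col {α : YoungDiagram} {n : ℕ} (T : StdTableau α n) (a : Fin n) : ℕ :=
  (T.1 a).1.1

/-- The line of the entry `a`. -/
def StdTableau.line {α : YoungDiagram} {n : ℕ} (T : StdTableau α n) (a : Fin n) : ℕ :=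
  (T.1 a).1.2

/-- The axial distance `l - l' + c' - c`, where `a` lies in line `l` and column `c`, and `b` in
line `l'` and column `c'`; it is only used when it is nonnegative. -/
def StdTableau.axialDist {α : YoungDiagram} {n : ℕ} (T : StdTableau α n) (a b : Fin n) : ℕ :=
  ((T.line a : ℤ) - T.line b + T.col b - T.col a).toNat

/-- The matrix of the operator attached to `σ_r` on the space with basis the standard tableaux of
shape `α`. The entry `(S, T)` is the coefficient of `S` in `σ_r T`.
If the entries `r, r + 1` lie in the same column (resp. line) of `T`, then `σ_r T = q T` (resp.
`-q⁻¹ T`). Otherwise let `T'` be obtained from `T` by exchanging them; if in `T` the column of `r`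
precedes that of `r + 1`, then `σ_r` acts on the plane with basis `(T, T')` by the matrix `M d`,
where `d` is the axial distance between `r` and `r + 1` in `T`. -/
def tableauMatrix {F : Type*} [Field F] (q : F) (M : ℕ → Matrix (Fin 2) (Fin 2) F)
    (α : YoungDiagram) {m : ℕ} (r : Fin m) :
    Matrix (StdTableau α (m + 1)) (StdTableau α (m + 1)) F :=
  Matrix.of fun S T =>
    let a := r.castSucc
    let b := r.succ
    if T.col a = T.col b then (if S = T then q else 0)
    else if T.line a = T.line b then (if S = T then -q⁻¹ else 0)
    else if T.col a < T.col b then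
      (if S = T then M (T.axialDist a b) 0 0
        else if S.1 = (adjSwap r).trans T.1 then M (T.axialDist a b) 1 0 else 0)
    else
      (if S = T then M (T.axialDist b a) 1 1
        else if S.1 = (adjSwap r).trans T.1 then M (T.axialDist b a) 0 1 else 0)

/-- The representation `R` of `B_{m+1}` is a representation of the Iwahori-Hecke algebra
`H_{m+1}(q)` in the isomorphism class attached to the partition `α = (α₁ ≥ α₂ ≥ ⋯)` of `m + 1`:
it is the irreducible representation of `H_{m+1}(q)` which contains both the representation
`σ ↦ q` of the parabolic subalgebra of type `(α₁, α₂, …)` and the representation `σ ↦ -q⁻¹` of the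
parabolic subalgebra of type `(α'₁, α'₂, …)`, with `α'` the conjugate partition. This is the usual
labelling, with `[m + 1]` attached to `σ ↦ q`. -/
structure IsHeckeClass {F : Type*} [Field F] (q : F) (α : YoungDiagram) {m : ℕ}
    {N : Type*} [Fintype N] [DecidableEq N] (R : BraidGroup m →* GL N F) : Prop where
  quadratic : ∀ r : Fin m,
    ((R (BraidGroup.σ r) : Matrix N N F) - q • (1 : Matrix N N F)) *
      ((R (BraidGroup.σ r) : Matrix N N F) + q⁻¹ • (1 : Matrix N N F)) = 0
  nonempty : Nonempty N
  irreducible : ∀ W : Submodule F (N → F),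
    (∀ (g : BraidGroup m), ∀ v ∈ W, (R g : Matrix N N F).mulVec v ∈ W) → W = ⊥ ∨ W = ⊤
  trivial_vector : ∃ v : N → F, v ≠ 0 ∧ ∀ r : Fin m,
    (∀ j : ℕ, ∑ i ∈ Finset.range j, α.rowLen i ≠ (r : ℕ) + 1) →
      (R (BraidGroup.σ r) : Matrix N N F).mulVec v = q • v
  sign_vector : ∃ v : N → F, v ≠ 0 ∧ ∀ r : Fin m,
    (∀ j : ℕ, ∑ i ∈ Finset.range j, α.colLen i ≠ (r : ℕ) + 1) →
      (R (BraidGroup.σ r) : Matrix N N F).mulVec v = -q⁻¹ • v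

/-- `(M d)_{d ≥ 2}` is a matrix model of the algebras `H_n(q)`: for each `n = m + 1` and each
partition `α` of `n`, the matrices on standard tableaux of shape `α` define a representation of
`H_n(q)` in the class attached to `α`. For `q = 1` it is a matrix model of the symmetric groups. -/
def IsMatrixModel {F : Type*} [Field F] (q : F) (M : ℕ → Matrix (Fin 2) (Fin 2) F) : Prop :=
  ∀ (m : ℕ) (α : YoungDiagram), α.card = m + 1 →
    ∃ R : BraidGroup m →* GL (StdTableau α (m + 1)) F,
      (∀ r : Fin m, (R (BraidGroup.σ r) : Matrix _ _ F) = tableauMatrix q M α r) ∧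
      IsHeckeClass q α R

/-- Young's orthonormal model of the symmetric groups; `s d` is a square root of `d ^ 2 - 1`. -/
def youngOrthonormal {k : Type*} [Field k] (s : ℕ → k) (d : ℕ) : Matrix (Fin 2) (Fin 2) k :=
  (d : k)⁻¹ • !![-1, s d; s d, 1]

/-- `ρ` is the extension to `𝔅_{m+1}(k)` of the representation `ρ₀` of the symmetric group
given by `ρ(t_{ij}) = 2 ρ₀((i j))` for `i ≠ j`. -/
def IsInfinitesimalHecke {k : Type*} [Field k] {m : ℕ} {N : Type*} [Fintype N] [DecidableEq N]
    (ρ₀ : Equiv.Perm (Fin (m + 1)) →* GL N k)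
    (ρ : InfBraid k (m + 1) →ₐ[k] Matrix N N k) : Prop :=
  (∀ g, ρ (InfBraid.s k g) = (ρ₀ g : Matrix N N k)) ∧
  (∀ i j, i ≠ j → ρ (InfBraid.t k i j) = (2 : k) • (ρ₀ (Equiv.swap i j) : Matrix N N k))

/-! ### The Hecke model -/

/-- `q = e^{λ h} ∈ K = k((h))`. -/
def qExp {k : Type*} [Field k] (lam : k) : LaurentSeries k :=
  ((PowerSeries.mk fun n => lam ^ n / (n.factorial : k) : k⟦X⟧) : LaurentSeries k)

/-- `[n]_q = (q ^ n - q ^ (-n)) / (q - q⁻¹)`. -/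
def qInt {F : Type*} [Field F] (q : F) (n : ℕ) : F :=
  (q ^ n - (q ^ n)⁻¹) / (q - q⁻¹)

/-- `b ∈ k⟦h⟧` is the square root of `[d+1]_q [d-1]_q`, `q = e^{λ h}`, with constant term `c`. -/
def IsQRoot {k : Type*} [Field k] (lam : k) (c : k) (d : ℕ) (b : k⟦X⟧) : Prop :=
  PowerSeries.constantCoeff b = c ∧
    (b : LaurentSeries k) ^ 2 = qInt (qExp lam) (d + 1) * qInt (qExp lam) (d - 1)

/-- The matrix `(1 / [d]_q) [[-q^{-d}, b], [b, q^d]]`. -/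
def heckeModel {F : Type*} [Field F] (q : F) (b : ℕ → F) (d : ℕ) : Matrix (Fin 2) (Fin 2) F :=
  (qInt q d)⁻¹ • !![-(q ^ d)⁻¹, b d; b d, q ^ d]

/-! ### Unitarity -/

/-- The involution `ε : f(h) ↦ f(-h)` of `K = k((h))`. -/
def epsilon {k : Type*} [Field k] (f : LaurentSeries k) : LaurentSeries k where
  coeff n := (-1 : k) ^ n * f.coeff n
  isPWO_support' := f.isPWO_support'.mono fun n hn => by
    simp only [Function.mem_support] at hn ⊢
    exact right_ne_zero_of_mul hn

/-- The unitary group `U_N^ε(K) = {x ∈ GL_N(K) | x⁻¹ = ᵗε(x)}`. -/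
def IsEpsUnitary {k : Type*} [Field k] {N : Type*} [Fintype N] [DecidableEq N]
    (x : Matrix N N (LaurentSeries k)) : Prop :=
  IsUnit x ∧ x⁻¹ = (x.map epsilon).transpose

end EvenAssoc

end

/-! The proof compares two constructions of the same matrices through their Jucys-Murphy elements.

The first is Young's seminormal form. Give a function `φ` of the content, diagonal coefficients `A`
and even off-diagonal coefficients `B` of the axial distance. A few scalar identities
(`IsSeminormal`) then suffice for the quadratic, commutation and braid relations, and for `σ_r L_r
σ_r + σ_r = L_{r+1}` with `L_r` diagonal of eigenvalues `φ` (content of `r`). Contents separate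
standard tableaux, so an invariant subspace contains a basis vector, and admissible exchanges
produce all the others: the representation is irreducible. The two reading tableaux supply the
vectors that identify its class. Young's orthonormal model (`isSeminormal_young`) and the Hecke
model (`isSeminormal_hecke`) are both instances.

The second is the associator. In the infinitesimal representation `t_{r,r+1}` is `2 s_r` and `Y_r`
is twice the diagonal matrix of contents. Let `P` be the matrix of the braid generator `r` under the
associator. Three properties determine it. (a) The hexagon used twice gives `P e^{λhY_r} P =
e^{λhY_{r+1}}` (`IsAssociator.braidSeries_mul`). The element `t_{r,r+1} + Y_r + s_r Y_r s_r`
commutes with everything in sight, and an even group-like series does not see such a summand. (b)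
Since `t_{r,r+1} = 2 s_r` with `s_r² = 1`, one has `P - P⁻¹ = q - q⁻¹`
(`IsAssociator.braidSeries_quadratic`). (c) `P` is symmetric: for an even group-like series the
antipode is word reversal, so transposition sends `Φ(u, v)` to `Φ(v, u)`
(`IsAssociator.transpose_braidSeries`). From (a) and (b) follow the diagonal entries. By (b), (c)
and the block structure the off-diagonal ones are known up to sign, and reduction at `h = 0` fixes
the sign. So `P` is the Hecke seminormal matrix (`toLaurentMatrix_braidSeries_eq`), whose braid
relations are already known.

Unitarity: `ε` fixes the off-diagonal coefficients and subtracts `q - q⁻¹` from the diagonal ones,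
hence sends the symmetric matrix `P` to `P - (q - q⁻¹) = P⁻¹`. -/

noncomputable section

namespace EvenAssoc

/-! ### The Coxeter presentation of the symmetric group -/

/-- The product `τ (j - 1) * τ (j - 2) * ⋯ * τ (j - l)`. -/
def descProd {X : Type*} [Group X] (τ : ℕ → X) (j : ℕ) : ℕ → X
  | 0 => 1
  | l + 1 => descProd τ j l * τ (j - 1 - l)

/-- The Coxeter relations of type `A` for the elements `τ 0, …, τ (m - 1)`. -/
structure CoxeterRel {X : Type*} [Group X] (m : ℕ) (τ : ℕ → X) : Prop where
  sq : ∀ i < m, τ i * τ i = 1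
  far : ∀ i j, i + 1 < j → j < m → τ i * τ j = τ j * τ i
  braid : ∀ i, i + 1 < m → τ i * τ (i + 1) * τ i = τ (i + 1) * τ i * τ (i + 1)

/-- The subgroup generated by `τ 0, …, τ (j - 1)`. -/
def initialSubgroup {X : Type*} [Group X] (τ : ℕ → X) (j : ℕ) : Subgroup X :=
  Subgroup.closure {x | ∃ i < j, x = τ i}

section
variable {X : Type*} [Group X] {m : ℕ} {τ : ℕ → X}

theorem CoxeterRel.descProd_comm (h : CoxeterRel m τ) {j : ℕ} (hj : j ≤ m) (l a : ℕ)
    (ha : a + l + 1 < j) : descProd τ j l * τ a = τ a * descProd τ j l := by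
  induction l with
  | zero => simp [descProd]
  | succ l ih =>
    rw [descProd, mul_assoc, ← h.far a (j - 1 - l) (by omega) (by omega), ← mul_assoc,
      ih (by omega), mul_assoc]

/-- Moving left, `τ a` commutes past the small indices, meets `τ a * τ (a - 1)`, and the braid
relation turns it into `τ (a - 1)`, which commutes with the remaining large indices. -/
theorem CoxeterRel.descProd_shift (h : CoxeterRel m τ) {j : ℕ} (hj : j ≤ m) (l a : ℕ)
    (hl : l ≤ j) (ha : j < a + l) (haj : a < j) :
    descProd τ j l * τ a = τ (a - 1) * descProd τ j l := by
  induction l with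
  | zero => omega
  | succ l ih =>
    rcases Nat.lt_or_ge j (a + l) with hlt | hge
    · rw [descProd, mul_assoc, h.far (j - 1 - l) a (by omega) (by omega), ← mul_assoc,
        ih (by omega) hlt, mul_assoc]
    · obtain ⟨l, rfl⟩ : ∃ l', l = l' + 1 := ⟨l - 1, by omega⟩
      obtain ⟨b, rfl⟩ : ∃ b, a = b + 1 := ⟨a - 1, by omega⟩
      have e1 : j - 1 - (l + 1) = b := by omega
      have e2 : j - 1 - l = b + 1 := by omega
      have hc := h.descProd_comm hj l b (by omega)
      have hb := h.braid b (by omega)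
      simp only [descProd, e1, e2, Nat.add_sub_cancel]
      calc descProd τ j l * τ (b + 1) * τ b * τ (b + 1)
          = descProd τ j l * (τ (b + 1) * τ b * τ (b + 1)) := by group
        _ = (descProd τ j l * τ b) * τ (b + 1) * τ b := by rw [← hb]; group
        _ = _ := by rw [hc]; group

/-- At most `j + 2` right cosets of the smaller subgroup occur, with descending products as
representatives, because their union is stable under right multiplication by generators. -/
theorem CoxeterRel.mem_initialSubgroup_succ (h : CoxeterRel m τ) {j : ℕ} (hj : j + 1 ≤ m) {x : X}
    (hx : x ∈ initialSubgroup τ (j + 1)) :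
    ∃ y ∈ initialSubgroup τ j, ∃ l ≤ j + 1, x = y * descProd τ (j + 1) l := by
  have key : ∀ y ∈ initialSubgroup τ j, ∀ l ≤ j + 1, ∀ a < j + 1,
      ∃ y' ∈ initialSubgroup τ j, ∃ l' ≤ j + 1,
        y * descProd τ (j + 1) l * τ a = y' * descProd τ (j + 1) l' := by
    intro y hy l hl a ha
    have mem : ∀ i < j, τ i ∈ initialSubgroup τ j := fun i hi => Subgroup.subset_closure ⟨i, hi, rfl⟩
    rcases lt_trichotomy (a + l) j with h1 | h1 | h1
    · exact ⟨y * τ a, mul_mem hy (mem _ (by omega)), l, hl, by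
        rw [mul_assoc, h.descProd_comm hj l a (by omega), mul_assoc]⟩
    · refine ⟨y, hy, l + 1, by omega, ?_⟩
      have e : j + 1 - 1 - l = a := by omega
      rw [descProd, e, mul_assoc]
    · rcases Nat.lt_or_ge (j + 1) (a + l) with h2 | h2
      · exact ⟨y * τ (a - 1), mul_mem hy (mem _ (by omega)), l, hl, by
          rw [mul_assoc, h.descProd_shift hj l a hl h2 ha, mul_assoc]⟩
      · obtain ⟨l, rfl⟩ : ∃ l', l = l' + 1 := ⟨l - 1, by omega⟩
        refine ⟨y, hy, l, by omega, ?_⟩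
        have e : j + 1 - 1 - l = a := by omega
        rw [descProd, e, mul_assoc, mul_assoc, h.sq a (by omega), mul_one]
  induction hx using Subgroup.closure_induction_right with
  | one => exact ⟨1, one_mem _, 0, by omega, by simp [descProd]⟩
  | mul_right x z _ hz ih =>
    obtain ⟨a, ha, rfl⟩ := hz
    obtain ⟨y, hy, l, hl, rfl⟩ := ih
    exact key y hy l hl a ha
  | mul_inv_cancel x z _ hz ih =>
    obtain ⟨a, ha, rfl⟩ := hz
    obtain ⟨y, hy, l, hl, rfl⟩ := ih
    rw [inv_eq_of_mul_eq_one_left (h.sq a (by omega))]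
    exact key y hy l hl a ha
end

/-- Elements satisfying the Coxeter relations define a homomorphism from the symmetric group. -/
theorem exists_permHom {G : Type*} [Group G] {m : ℕ} (g : Fin m → G)
    (hsq : ∀ i, g i * g i = 1)
    (hfar : ∀ i j : Fin m, (i : ℕ) + 1 < j → g i * g j = g j * g i)
    (hbraid : ∀ i j : Fin m, (i : ℕ) + 1 = j → g i * g j * g i = g j * g i * g j) :
    ∃ f : Equiv.Perm (Fin (m + 1)) →* G, ∀ r : Fin m, f (adjSwap r) = g r := by
  classical
  have ssq : ∀ i : Fin m, adjSwap i * adjSwap i = 1 := fun i => Equiv.swap_mul_self _ _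
  have sfar : ∀ i j : Fin m, (i : ℕ) + 1 < j → adjSwap i * adjSwap j = adjSwap j * adjSwap i := by
    intro i j hij
    refine (Equiv.Perm.Disjoint.commute ?_).eq
    intro x
    simp only [adjSwap, Equiv.swap_apply_def, Fin.ext_iff, Fin.val_castSucc, Fin.val_succ]
    split_ifs <;> simp_all <;> omega
  have sbraid : ∀ i j : Fin m, (i : ℕ) + 1 = j →
      adjSwap i * adjSwap j * adjSwap i = adjSwap j * adjSwap i * adjSwap j := by
    intro i j hij
    have e : i.succ = j.castSucc := Fin.ext (by simpa using hij)
    have h1 : i.castSucc ≠ j.castSucc := by simp [Fin.ext_iff]; omega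
    have h2 : i.castSucc ≠ j.succ := by simp [Fin.ext_iff]; omega
    have h3 : j.castSucc ≠ j.succ := by simp [Fin.ext_iff]
    unfold adjSwap
    rw [e, Equiv.swap_mul_swap_mul_swap h1 h2, Equiv.swap_comm i.castSucc j.castSucc,
      Equiv.swap_comm j.castSucc j.succ, Equiv.swap_mul_swap_mul_swap h3.symm h2.symm,
      Equiv.swap_comm]
  -- The pairs generate a subgroup of the product. It is the graph of the desired homomorphism once
  -- its projection to the permutations is bijective. Indices beyond `m` get the irrelevant value
  -- `1`.
  let τ : ℕ → Equiv.Perm (Fin (m + 1)) × G := fun i =>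
    if h : i < m then (adjSwap ⟨i, h⟩, g ⟨i, h⟩) else 1
  have hτ : ∀ i (h : i < m), τ i = (adjSwap ⟨i, h⟩, g ⟨i, h⟩) := fun i h => dif_pos h
  have hc : CoxeterRel m τ := by
    refine ⟨fun i hi => ?_, fun i j hij hj => ?_, fun i hi => ?_⟩
    · rw [hτ i hi, Prod.mk_mul_mk, ssq, hsq]; rfl
    · rw [hτ i (by omega), hτ j hj, Prod.mk_mul_mk, Prod.mk_mul_mk, sfar _ _ (by simpa using hij),
        hfar _ _ (by simpa using hij)]
    · rw [hτ i (by omega), hτ (i + 1) hi]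
      simp only [Prod.mk_mul_mk]
      rw [sbraid _ _ rfl, hbraid _ _ rfl]
  have hfix : ∀ j, ∀ x ∈ initialSubgroup τ j, ∀ p : Fin (m + 1), j < (p : ℕ) → x.1 p = p := by
    intro j x hx p hp
    induction hx using Subgroup.closure_induction with
    | mem x hx =>
      obtain ⟨i, hi, rfl⟩ := hx
      rw [hτ i (by omega)]
      exact Equiv.swap_apply_of_ne_of_ne (by simp [Fin.ext_iff]; omega)
        (by simp [Fin.ext_iff]; omega)
    | one => rfl
    | mul x y _ _ hx hy => simp [hx, hy]
    | inv x _ hx => exact (Equiv.Perm.inv_eq_iff_eq).2 hx.symm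
  have hdesc : ∀ j (hj : j ≤ m) l (hl : l ≤ j),
      (descProd τ j l).1 ⟨j - l, by omega⟩ = ⟨j, by omega⟩ := by
    intro j hj l hl
    induction l with
    | zero => simp [descProd]
    | succ l ih =>
      have e : (τ (j - 1 - l)).1 ⟨j - (l + 1), by omega⟩ = ⟨j - l, by omega⟩ := by
        rw [hτ _ (by omega)]
        have e1 : (⟨j - (l + 1), by omega⟩ : Fin (m + 1)) =
            (⟨j - 1 - l, by omega⟩ : Fin m).castSucc := Fin.ext (by simp; omega)
        have e2 : (⟨j - l, by omega⟩ : Fin (m + 1)) =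
            (⟨j - 1 - l, by omega⟩ : Fin m).succ := Fin.ext (by simp; omega)
        rw [e1, e2]
        exact Equiv.swap_apply_left _ _
      rw [descProd, Prod.fst_mul, Equiv.Perm.mul_apply, e, ih (by omega)]
  -- Induction along the coset decomposition: a representative of length `l` sends `j + 1 - l` to `j
  -- + 1`, which the smaller subgroup fixes, so a trivial permutation forces `l = 0`.
  have hinj : ∀ j ≤ m, ∀ x ∈ initialSubgroup τ j, x.1 = 1 → x.2 = 1 := by
    intro j
    induction j with
    | zero =>
      intro _ x hx _
      have : initialSubgroup τ 0 = ⊥ := by simp [initialSubgroup]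
      rw [this, Subgroup.mem_bot] at hx
      rw [hx]; rfl
    | succ j ih =>
      intro hj x hx hx1
      obtain ⟨y, hy, l, hl, rfl⟩ := hc.mem_initialSubgroup_succ hj hx
      have h1 := DFunLike.congr_fun hx1 (⟨j + 1 - l, by omega⟩ : Fin (m + 1))
      rw [Prod.fst_mul, Equiv.Perm.mul_apply, hdesc (j + 1) hj l hl,
        hfix j y hy _ (by simp), Equiv.Perm.one_apply, Fin.mk.injEq] at h1
      obtain rfl : l = 0 := by omega
      simp only [descProd, mul_one] at hx1 ⊢
      exact ih (by omega) y hy hx1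
  have hsurj : ∀ p : Equiv.Perm (Fin (m + 1)), ∃ x ∈ initialSubgroup τ m, x.1 = p := by
    intro p
    have hp : p ∈ Submonoid.closure (Set.range fun i : Fin m => Equiv.swap i.castSucc i.succ) := by
      rw [Equiv.Perm.mclosure_swap_castSucc_succ]; trivial
    induction hp using Submonoid.closure_induction with
    | mem x hx =>
      obtain ⟨i, rfl⟩ := hx
      exact ⟨τ i, Subgroup.subset_closure ⟨i, i.2, rfl⟩, by rw [hτ i i.2]; rfl⟩
    | one => exact ⟨1, one_mem _, rfl⟩
    | mul x y _ _ hx hy =>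
      obtain ⟨a, ha, rfl⟩ := hx
      obtain ⟨b, hb, rfl⟩ := hy
      exact ⟨a * b, mul_mem ha hb, rfl⟩
  choose F hF hF1 using hsurj
  have huniq : ∀ x ∈ initialSubgroup τ m, (F x.1).2 = x.2 := by
    intro x hx
    have := hinj m le_rfl (F x.1 * x⁻¹) (mul_mem (hF _) (inv_mem hx)) (by simp [hF1])
    rw [Prod.snd_mul, Prod.snd_inv, mul_inv_eq_one] at this
    exact this
  refine ⟨MonoidHom.mk' (fun p => (F p).2) fun p p' => ?_, fun r => ?_⟩
  · have := huniq (F p * F p') (mul_mem (hF _) (hF _))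
    rwa [Prod.fst_mul, hF1, hF1] at this
  · have := huniq (τ r) (Subgroup.subset_closure ⟨r, r.2, rfl⟩)
    rwa [hτ r r.2] at this

/-! ### Fillings and standard tableaux -/

/-- The entries increase in each line and each column. -/
def IsStd {α : YoungDiagram} {n : ℕ} (T : Fin n ≃ α.cells) : Prop :=
  ∀ a b : Fin n,
    ((T a).1.1 = (T b).1.1 ∧ (T a).1.2 < (T b).1.2 → a < b) ∧
    ((T a).1.2 = (T b).1.2 ∧ (T a).1.1 < (T b).1.1 → a < b)

/-- The content (line minus column) of the entry `a`. -/
def content {α : YoungDiagram} {n : ℕ} (T : Fin n ≃ α.cells) (a : Fin n) : ℤ :=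
  ((T a).1.2 : ℤ) - (T a).1.1

section
variable {α : YoungDiagram} {n : ℕ} {T : Fin n ≃ α.cells}

theorem exists_entry (T : Fin n ≃ α.cells) {i j : ℕ} (h : (i, j) ∈ α) :
    ∃ a, (T a).1 = (i, j) :=
  ⟨T.symm ⟨(i, j), h⟩, by simp⟩

theorem cell_mem (T : Fin n ≃ α.cells) (a : Fin n) : ((T a).1.1, (T a).1.2) ∈ α :=
  (T a).2

theorem entry_injective {a b : Fin n} (h1 : (T a).1.1 = (T b).1.1)
    (h2 : (T a).1.2 = (T b).1.2) : a = b :=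
  T.injective (Subtype.ext (Prod.ext h1 h2))

/-- Compare both entries with the one in the corner cell (column of `a`, line of `b`), which lies in
the diagram. -/
theorem IsStd.mono (hT : IsStd T) {a b : Fin n} (h1 : (T a).1.1 ≤ (T b).1.1)
    (h2 : (T a).1.2 ≤ (T b).1.2) : a ≤ b := by
  obtain ⟨c, hc⟩ := exists_entry T (α.up_left_mem h1 le_rfl (cell_mem T b))
  have hc1 : (T c).1.1 = (T a).1.1 := by rw [hc]
  have hc2 : (T c).1.2 = (T b).1.2 := by rw [hc]
  have hac : a ≤ c := by
    rcases h2.eq_or_lt with h | h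
    · exact (entry_injective hc1.symm (h.trans hc2.symm)).le
    · exact ((hT a c).1 ⟨hc1.symm, by omega⟩).le
  have hcb : c ≤ b := by
    rcases h1.eq_or_lt with h | h
    · exact (entry_injective (hc1.trans h) hc2).le
    · exact ((hT c b).2 ⟨hc2, by omega⟩).le
  exact hac.trans hcb

/-- At the first entry `a` placed differently, the two cells lie on one diagonal. The upper one, in
the other tableau, holds an entry smaller than `a`, on which both tableaux agree: a contradiction.
-/
theorem IsStd.content_injective {S T : Fin n ≃ α.cells} (hS : IsStd S) (hT : IsStd T)
    (h : ∀ a, content S a = content T a) : S = T := by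
  have key : ∀ {S T : Fin n ≃ α.cells}, IsStd T → ∀ a : Fin n,
      (∀ b < a, S b = T b) → content S a = content T a → (T a).1.1 ≤ (S a).1.1 := by
    intro S T hT a hb hc
    by_contra! hlt
    simp only [content] at hc
    obtain ⟨b, hb'⟩ := exists_entry T (cell_mem S a)
    have h1 : (T b).1.1 = (S a).1.1 := by rw [hb']
    have h2 : (T b).1.2 = (S a).1.2 := by rw [hb']
    have hba : b ≤ a := hT.mono (by omega) (by omega)
    have hne : b ≠ a := by rintro rfl; omega
    have := hb b (lt_of_le_of_ne hba hne)
    rw [← this] at h1 h2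
    exact hne (entry_injective h1 h2)
  refine Equiv.ext fun a => ?_
  induction a using WellFoundedLT.induction with
  | ind a ih =>
    have h1 := key hT a ih (h a)
    have h2 := key hS a (fun b hb => (ih b hb).symm) (h a).symm
    have := h a
    simp only [content] at this
    exact Subtype.ext (Prod.ext (by omega) (by omega))

/-- Two cells of one diagonal span a rectangle whose other two corners carry distinct entries
strictly between `a` and `b`, so `b ≥ a + 3`. This keeps every denominator in the quadratic and
braid relations nonzero. -/
theorem IsStd.content_ne (hT : IsStd T) {a b : Fin n} (hab : a < b) (hb : (b : ℕ) ≤ a + 2) :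
    content T a ≠ content T b := by
  intro h
  simp only [content] at h
  rcases Nat.lt_or_ge (T a).1.1 (T b).1.1 with hlt | hge
  · obtain ⟨c, hc⟩ := exists_entry T (α.up_left_mem hlt.le le_rfl (cell_mem T b))
    obtain ⟨d, hd⟩ := exists_entry T (α.up_left_mem le_rfl (by omega : (T a).1.2 ≤ (T b).1.2)
      (cell_mem T b))
    have hc1 : (T c).1.1 = (T a).1.1 := by rw [hc]
    have hc2 : (T c).1.2 = (T b).1.2 := by rw [hc]
    have hd1 : (T d).1.1 = (T b).1.1 := by rw [hd]
    have hd2 : (T d).1.2 = (T a).1.2 := by rw [hd]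
    have h1 := (hT a c).1 ⟨by omega, by omega⟩
    have h2 := (hT c b).2 ⟨by omega, by omega⟩
    have h3 := (hT a d).2 ⟨by omega, by omega⟩
    have h4 := (hT d b).1 ⟨by omega, by omega⟩
    have : c = d := by omega
    subst this
    omega
  · exact absurd (hT.mono hge (by omega)) (not_le.2 hab)

theorem IsStd.content_zero {m : ℕ} {T : Fin (m + 1) ≃ α.cells} (hT : IsStd T) :
    content T 0 = 0 := by
  obtain ⟨c, hc⟩ := exists_entry T
    (α.up_left_mem (Nat.zero_le _) (Nat.zero_le _) (cell_mem T 0))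
  have : c ≤ 0 := hT.mono (by rw [hc]; exact Nat.zero_le _) (by rw [hc]; exact Nat.zero_le _)
  obtain rfl : c = 0 := le_antisymm this (Fin.zero_le _)
  simp [content, hc]

end

/-! ### Positions of two consecutive entries and admissible exchanges. -/

section
variable {α : YoungDiagram} {m : ℕ} {T : Fin (m + 1) ≃ α.cells} {r : Fin m}

theorem IsStd.line_succ (hT : IsStd T) (h : (T r.castSucc).1.1 = (T r.succ).1.1) :
    (T r.succ).1.2 = (T r.castSucc).1.2 + 1 := by
  have hlt : (T r.castSucc).1.2 < (T r.succ).1.2 := by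
    by_contra! hle
    exact absurd (hT.mono h.ge hle) (not_le.2 r.castSucc_lt_succ)
  by_contra hne
  obtain ⟨c, hc⟩ := exists_entry T (α.up_left_mem (le_refl (T r.succ).1.1)
    (by omega : (T r.castSucc).1.2 + 1 ≤ (T r.succ).1.2) (cell_mem T r.succ))
  have h1 := (hT r.castSucc c).1 ⟨by rw [hc, h], by rw [hc]; simp⟩
  have h2 := (hT c r.succ).1 ⟨by rw [hc], by rw [hc]; simp only; omega⟩
  simp only [Fin.lt_def, Fin.val_castSucc, Fin.val_succ] at h1 h2
  omega

theorem IsStd.col_succ (hT : IsStd T) (h : (T r.castSucc).1.2 = (T r.succ).1.2) :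
    (T r.succ).1.1 = (T r.castSucc).1.1 + 1 := by
  have hlt : (T r.castSucc).1.1 < (T r.succ).1.1 := by
    by_contra! hle
    exact absurd (hT.mono hle h.ge) (not_le.2 r.castSucc_lt_succ)
  by_contra hne
  obtain ⟨c, hc⟩ := exists_entry T (α.up_left_mem
    (by omega : (T r.castSucc).1.1 + 1 ≤ (T r.succ).1.1) (le_refl (T r.succ).1.2)
    (cell_mem T r.succ))
  have h1 := (hT r.castSucc c).2 ⟨by rw [hc, h], by rw [hc]; simp⟩
  have h2 := (hT c r.succ).2 ⟨by rw [hc], by rw [hc]; simp only; omega⟩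
  simp only [Fin.lt_def, Fin.val_castSucc, Fin.val_succ] at h1 h2
  omega

theorem IsStd.line_lt (hT : IsStd T) (h : (T r.castSucc).1.1 < (T r.succ).1.1)
    (h' : (T r.castSucc).1.2 ≠ (T r.succ).1.2) : (T r.succ).1.2 < (T r.castSucc).1.2 := by
  by_contra! hle
  obtain ⟨c, hc⟩ := exists_entry T (α.up_left_mem h.le le_rfl (cell_mem T r.succ))
  have h1 := (hT r.castSucc c).1 ⟨by rw [hc], by rw [hc]; simp only; omega⟩
  have h2 := (hT c r.succ).2 ⟨by rw [hc], by rw [hc]; simp only; omega⟩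
  simp only [Fin.lt_def, Fin.val_castSucc, Fin.val_succ] at h1 h2
  omega

theorem IsStd.lt_line (hT : IsStd T) (h : (T r.succ).1.1 < (T r.castSucc).1.1) :
    (T r.castSucc).1.2 < (T r.succ).1.2 := by
  by_contra! hle
  exact absurd (hT.mono h.le hle) (not_le.2 r.castSucc_lt_succ)

theorem IsStd.swap (hT : IsStd T) (h1 : (T r.castSucc).1.1 ≠ (T r.succ).1.1)
    (h2 : (T r.castSucc).1.2 ≠ (T r.succ).1.2) : IsStd ((adjSwap r).trans T) := by
  -- An adjacent transposition reverses the order of a single pair.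
  have key : ∀ x y : Fin (m + 1), ¬ (x = r.castSucc ∧ y = r.succ) → x < y →
      adjSwap r x < adjSwap r y := by
    intro x y hne hxy
    simp only [adjSwap, Equiv.swap_apply_def, Fin.ext_iff, Fin.lt_def, Fin.val_castSucc,
      Fin.val_succ] at *
    split_ifs <;> (try simp only [Fin.val_castSucc, Fin.val_succ]) <;> omega
  have inv : ∀ x, adjSwap r (adjSwap r x) = x := fun x => Equiv.swap_apply_self _ _ _
  have key' : ∀ a b : Fin (m + 1),
      ((T (adjSwap r a)).1.1 = (T (adjSwap r b)).1.1 ∨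
        (T (adjSwap r a)).1.2 = (T (adjSwap r b)).1.2) →
      adjSwap r a < adjSwap r b → a < b := by
    intro a b h hlt
    rw [← inv a, ← inv b]
    refine key _ _ ?_ hlt
    rintro ⟨ha, hb⟩
    rw [ha, hb] at h
    tauto
  intro a b
  exact ⟨fun h => key' a b (Or.inl h.1) ((hT _ _).1 h), fun h => key' a b (Or.inr h.1) ((hT _ _).2 h)⟩

theorem adjSwap_castSucc (r : Fin m) : adjSwap r r.castSucc = r.succ := Equiv.swap_apply_left _ _

theorem adjSwap_succ (r : Fin m) : adjSwap r r.succ = r.castSucc := Equiv.swap_apply_right _ _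

theorem IsStd.ne_of_swap (hT : IsStd T) (hT' : IsStd ((adjSwap r).trans T)) :
    (T r.castSucc).1.1 ≠ (T r.succ).1.1 ∧ (T r.castSucc).1.2 ≠ (T r.succ).1.2 := by
  constructor
  · intro h
    have h1 := hT.line_succ h
    have := (hT' r.succ r.castSucc).1 (by
      simp only [Equiv.trans_apply, adjSwap_castSucc, adjSwap_succ]; omega)
    exact absurd this (not_lt.2 r.castSucc_lt_succ.le)
  · intro h
    have h1 := hT.col_succ h
    have := (hT' r.succ r.castSucc).2 (by
      simp only [Equiv.trans_apply, adjSwap_castSucc, adjSwap_succ]; omega)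
    exact absurd this (not_lt.2 r.castSucc_lt_succ.le)

/-- Sort the permutation `T₀⁻¹ ∘ T` by removing descents. A descent at `r` is an admissible
exchange, since two consecutive entries in a common line or column occupy adjacent cells, which `T₀`
would fill in increasing order. The weighted sum `μ` increases strictly at each exchange and is
bounded. -/
theorem IsStd.exists_swap_chain {P : (Fin (m + 1) ≃ α.cells) → Prop}
    (hP : ∀ (T : Fin (m + 1) ≃ α.cells) (r : Fin m), IsStd T → IsStd ((adjSwap r).trans T) →
      P T → P ((adjSwap r).trans T))
    {T₀ : Fin (m + 1) ≃ α.cells} (hT₀ : IsStd T₀) (hT : IsStd T) (h : P T) : P T₀ := by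
  let w : (Fin (m + 1) ≃ α.cells) → Fin (m + 1) → ℤ := fun T a => ((T₀.symm (T a) : ℕ) : ℤ)
  let μ : (Fin (m + 1) ≃ α.cells) → ℤ := fun T => ∑ a : Fin (m + 1), (a : ℤ) * w T a
  have hbound : ∀ T, μ T ≤ ∑ a : Fin (m + 1), (a : ℤ) * m := fun T =>
    Finset.sum_le_sum fun a _ => mul_le_mul_of_nonneg_left (by simp only [w]; omega) (by positivity)
  set N : ℤ := ∑ a : Fin (m + 1), (a : ℤ) * m
  induction hn : (N - μ T).toNat using Nat.strong_induction_on generalizing T with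
  | _ n ih =>
    subst hn
    by_cases hd : ∃ r : Fin m, T₀.symm (T r.succ) < T₀.symm (T r.castSucc)
    · obtain ⟨r, hr⟩ := hd
      have hs : IsStd ((adjSwap r).trans T) := by
        refine hT.swap (fun h1 => ?_) (fun h1 => ?_)
        · have h2 := hT.line_succ h1
          refine absurd ((hT₀ (T₀.symm (T r.castSucc)) (T₀.symm (T r.succ))).1 ?_) (not_lt.2 hr.le)
          simp only [Equiv.apply_symm_apply]; omega
        · have h2 := hT.col_succ h1
          refine absurd ((hT₀ (T₀.symm (T r.castSucc)) (T₀.symm (T r.succ))).2 ?_) (not_lt.2 hr.le)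
          simp only [Equiv.apply_symm_apply]; omega
      have hμ : μ T < μ ((adjSwap r).trans T) := by
        have e : μ ((adjSwap r).trans T) =
            ∑ a : Fin (m + 1), ((adjSwap r a : Fin (m + 1)) : ℤ) * w T a := by
          rw [← Equiv.sum_comp (adjSwap r)
            (fun a => ((adjSwap r a : Fin (m + 1)) : ℤ) * w T a)]
          refine Finset.sum_congr rfl fun a _ => ?_
          have : adjSwap r (adjSwap r a) = a := Equiv.swap_apply_self _ _ _
          rw [this]; rfl
        -- Only the weights of `r` and `r + 1` change, by one each, so the gain is `w T r - w T (r +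
        -- 1)`, positive at a descent.
        have e2 : μ ((adjSwap r).trans T) - μ T =
            ∑ a : Fin (m + 1), ((if a = r.castSucc then w T a else 0) -
              (if a = r.succ then w T a else 0)) := by
          rw [e, ← Finset.sum_sub_distrib]
          refine Finset.sum_congr rfl fun a _ => ?_
          rcases eq_or_ne a r.castSucc with rfl | h1
          · have h2 : r.castSucc ≠ r.succ := r.castSucc_lt_succ.ne
            rw [adjSwap_castSucc, if_pos rfl, if_neg h2]
            simp only [Fin.val_castSucc, Fin.val_succ]; push_cast; ring
          · rcases eq_or_ne a r.succ with rfl | h2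
            · rw [adjSwap_succ, if_neg h1, if_pos rfl]
              simp only [Fin.val_castSucc, Fin.val_succ]; push_cast; ring
            · rw [show adjSwap r a = a from Equiv.swap_apply_of_ne_of_ne h1 h2, if_neg h1,
                if_neg h2]
              ring
        rw [Finset.sum_sub_distrib, Finset.sum_ite_eq', Finset.sum_ite_eq'] at e2
        simp only [Finset.mem_univ, if_true, w, Fin.lt_def] at e2 hr
        omega
      refine ih _ ?_ hs (hP T r hT hs h) rfl
      have := hbound ((adjSwap r).trans T)
      omega
    · push Not at hd
      -- Without descents the permutation is increasing, hence the identity.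
      have hmono : StrictMono (T.trans T₀.symm) := by
        refine Fin.strictMono_iff_lt_succ.2 fun r => lt_of_le_of_ne (hd r) fun he => ?_
        exact r.castSucc_lt_succ.ne ((T.trans T₀.symm).injective he)
      have h1 : (T.trans T₀.symm : Fin (m + 1) → Fin (m + 1)) = id :=
        congrArg (fun e : Fin (m + 1) ≃o Fin (m + 1) => (e : Fin (m + 1) → Fin (m + 1)))
          (Subsingleton.elim (hmono.orderIsoOfSurjective _ (T.trans T₀.symm).surjective)
            (OrderIso.refl _))
      have : T = T₀ := Equiv.ext fun a => by
        have := congrFun h1 a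
        simpa [Equiv.symm_apply_eq] using this
      exact this ▸ h

end

/-! ### Reading tableaux -/

theorem exists_rowReading (α : YoungDiagram) {n : ℕ} (hn : α.card = n) :
    ∃ T : Fin n ≃ α.cells, ∀ a b, a < b → (T a).1.1 < (T b).1.1 ∨
      ((T a).1.1 = (T b).1.1 ∧ (T a).1.2 < (T b).1.2) := by
  let s : Finset (ℕ ×ₗ ℕ) := α.cells.map toLex.toEmbedding
  have hs : s.card = n := by rw [Finset.card_map]; exact hn
  let e : α.cells ≃ s :=
    { toFun := fun c => ⟨toLex c.1, Finset.mem_map_of_mem _ c.2⟩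
      invFun := fun c => ⟨ofLex c.1, by
        obtain ⟨d, hd, h⟩ := Finset.mem_map.1 c.2
        rw [← h]; exact hd⟩
      left_inv := fun c => rfl
      right_inv := fun c => rfl }
  refine ⟨(s.orderIsoOfFin hs).toEquiv.trans e.symm, fun a b hab => ?_⟩
  have := (s.orderIsoOfFin hs).strictMono hab
  exact Prod.Lex.toLex_lt_toLex.1 this

theorem isStd_of_rowReading {α : YoungDiagram} {n : ℕ} {T : Fin n ≃ α.cells}
    (h : ∀ a b, a < b → (T a).1.1 < (T b).1.1 ∨
      ((T a).1.1 = (T b).1.1 ∧ (T a).1.2 < (T b).1.2)) : IsStd T := by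
  intro a b
  constructor <;>
  · rintro ⟨h1, h2⟩
    rcases lt_trichotomy a b with hab | rfl | hab
    · exact hab
    · omega
    · rcases h b a hab with h3 | h3 <;> omega

/-- If the first coordinate jumps after `r`, the cells with smaller first coordinate are exactly
those of the entries up to `r`. Counting them exhibits `r + 1` as a partial sum of row lengths. -/
theorem rowReading_same_row {α : YoungDiagram} {m : ℕ} {T : Fin (m + 1) ≃ α.cells}
    (h : ∀ a b, a < b → (T a).1.1 < (T b).1.1 ∨
      ((T a).1.1 = (T b).1.1 ∧ (T a).1.2 < (T b).1.2)) (r : Fin m)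
    (hr : ∀ j : ℕ, ∑ i ∈ Finset.range j, α.rowLen i ≠ (r : ℕ) + 1) :
    (T r.castSucc).1.1 = (T r.succ).1.1 := by
  by_contra hne
  apply hr (T r.succ).1.1
  have hlt : (T r.castSucc).1.1 < (T r.succ).1.1 := by
    rcases h _ _ r.castSucc_lt_succ with h1 | h1
    · exact h1
    · exact absurd h1.1 hne
  have hmono : ∀ a b, a ≤ b → (T a).1.1 ≤ (T b).1.1 := by
    intro a b hab
    rcases hab.eq_or_lt with rfl | hab
    · rfl
    · rcases h _ _ hab with h1 | h1 <;> omega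
  set i₀ := (T r.succ).1.1
  have h1 : ∑ i ∈ Finset.range i₀, α.rowLen i = (α.cells.filter fun c => c.1 < i₀).card := by
    rw [Finset.card_eq_sum_card_fiberwise (f := fun c : ℕ × ℕ => c.1) (t := Finset.range i₀)]
    · refine Finset.sum_congr rfl fun i hi => ?_
      rw [YoungDiagram.rowLen_eq_card]
      congr 1
      ext c
      simp only [YoungDiagram.mem_row_iff, Finset.mem_filter, YoungDiagram.mem_cells,
        Finset.mem_range] at hi ⊢
      constructor
      · rintro ⟨h1, h2⟩; exact ⟨⟨h1, by omega⟩, h2⟩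
      · rintro ⟨⟨h1, _⟩, h2⟩; exact ⟨h1, h2⟩
    · intro c hc
      simpa using (Finset.mem_filter.1 hc).2
  have h2 : (α.cells.filter fun c => c.1 < i₀) =
      (Finset.Iic r.castSucc).image fun a => (T a).1 := by
    ext c
    simp only [Finset.mem_filter, Finset.mem_image, Finset.mem_Iic]
    constructor
    · rintro ⟨hc, hlt'⟩
      refine ⟨T.symm ⟨c, hc⟩, ?_, by simp⟩
      by_contra! hgt
      have := hmono r.succ (T.symm ⟨c, hc⟩) (Fin.castSucc_lt_iff_succ_le.1 hgt)
      simp only [Equiv.apply_symm_apply] at this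
      omega
    · rintro ⟨a, ha, rfl⟩
      exact ⟨(T a).2, lt_of_le_of_lt (hmono a _ ha) hlt⟩
  rw [h1, h2, Finset.card_image_of_injective _ fun a b hab => T.injective (Subtype.ext hab)]
  simp

/-- The tableau read along the columns (of the convention in which parts are columns). -/
theorem exists_std_rowReading (α : YoungDiagram) {m : ℕ} (hα : α.card = m + 1) :
    ∃ T : Fin (m + 1) ≃ α.cells, IsStd T ∧ ∀ r : Fin m,
      (∀ j : ℕ, ∑ i ∈ Finset.range j, α.rowLen i ≠ (r : ℕ) + 1) →
        (T r.castSucc).1.1 = (T r.succ).1.1 := by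
  obtain ⟨T, hT⟩ := exists_rowReading α hα
  exact ⟨T, isStd_of_rowReading hT, rowReading_same_row hT⟩

theorem exists_std_colReading (α : YoungDiagram) {m : ℕ} (hα : α.card = m + 1) :
    ∃ T : Fin (m + 1) ≃ α.cells, IsStd T ∧ ∀ r : Fin m,
      (∀ j : ℕ, ∑ i ∈ Finset.range j, α.colLen i ≠ (r : ℕ) + 1) →
        (T r.castSucc).1.2 = (T r.succ).1.2 := by
  let e : α.transpose.cells ≃ α.cells :=
    { toFun := fun c => ⟨c.1.swap, YoungDiagram.mem_transpose.1 c.2⟩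
      invFun := fun c => ⟨c.1.swap, YoungDiagram.mem_transpose.2 (by simp)⟩
      left_inv := fun c => rfl
      right_inv := fun c => rfl }
  have hcard : α.transpose.card = m + 1 := by
    rw [← hα]
    simpa only [Fintype.card_coe] using Fintype.card_congr e
  obtain ⟨T, hT, hr⟩ := exists_std_rowReading α.transpose hcard
  refine ⟨T.trans e, fun a b => ⟨(hT a b).2, (hT a b).1⟩, fun r h => hr r ?_⟩
  simpa only [YoungDiagram.rowLen_transpose] using h

/-- The underlying filling of a standard tableau. -/
def StdTableau.filling {α : YoungDiagram} {n : ℕ} (T : StdTableau α n) : Fin n ≃ α.cells := T.1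

/-- The standard tableau given by a filling. -/
def StdTableau.mk {α : YoungDiagram} {n : ℕ} (U : Fin n ≃ α.cells) (h : IsStd U) :
    StdTableau α n := ⟨U, h⟩

section
variable {α : YoungDiagram} {n : ℕ}

theorem StdTableau.isStd (T : StdTableau α n) : IsStd T.filling := T.2

theorem StdTableau.filling_mk (U : Fin n ≃ α.cells) (h : IsStd U) :
    (StdTableau.mk U h).filling = U := rfl

theorem StdTableau.filling_injective {S T : StdTableau α n} (h : S.filling = T.filling) : S = T :=
  Subtype.ext h

end

/-! ### Seminormal forms -/

/-- The functions `A`, `B` of the axial distance are the coefficients of a seminormal form of the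
Hecke algebras, in which the Jucys-Murphy elements act by the scalars `φ c`, `c` the contents. -/
structure IsSeminormal {F : Type*} [Field F] (q : F) (φ A B : ℤ → F) : Prop where
  q_ne : q ≠ 0
  inj : Function.Injective φ
  zero : φ 0 = 0
  diag : ∀ x y, x ≠ y → A (x - y) * (φ y - φ x) = 1 + (q - q⁻¹) * φ y
  symm : ∀ d, B (-d) = B d
  sq : ∀ d, d ≠ 0 → B d ^ 2 = 1 + A d * A (-d)
  diag_one : A 1 = -q⁻¹
  diag_neg_one : A (-1) = q
  off_one : B 1 = 0
  off_ne : ∀ d, 2 ≤ d → B d ≠ 0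

section
variable {F : Type*} [Field F] {q : F} {φ A B : ℤ → F}

theorem IsSeminormal.phi_ne (h : IsSeminormal q φ A B) {x y : ℤ} (hxy : x ≠ y) :
    φ y - φ x ≠ 0 := sub_ne_zero.2 (h.inj.ne hxy.symm)

theorem IsSeminormal.diag_eq (h : IsSeminormal q φ A B) {x y : ℤ} (hxy : x ≠ y) :
    A (x - y) = (1 + (q - q⁻¹) * φ y) / (φ y - φ x) :=
  eq_div_of_mul_eq (h.phi_ne hxy) (h.diag x y hxy)

/-- This is the trace of a 2×2 block with eigenvalues `q` and `-q⁻¹`. -/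
theorem IsSeminormal.diag_add (h : IsSeminormal q φ A B) {d : ℤ} (hd : d ≠ 0) :
    A d + A (-d) = q - q⁻¹ := by
  have h1 := h.diag d 0 hd
  have h2 := h.diag 0 d hd.symm
  rw [h.zero] at h1 h2
  simp only [sub_zero, zero_sub] at h1 h2
  have h3 : φ d ≠ 0 := by simpa [h.zero] using h.inj.ne hd
  apply mul_right_cancel₀ h3
  linear_combination h2 - h1

/-- With `three_right`, a partial fraction identity for `(1 + κ φ y) / (φ y - φ x)`. These two are
what the braid relation needs beyond `sq` and `symm`. -/
theorem IsSeminormal.three_left (h : IsSeminormal q φ A B) {x y z : ℤ} (hxy : x ≠ y) (hyz : y ≠ z)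
    (hxz : x ≠ z) :
    A (x - y) * A (y - z) + A (x - z) * A (y - x) = A (y - z) * A (x - z) := by
  rw [h.diag_eq hxy, h.diag_eq hyz, h.diag_eq hxz, h.diag_eq hxy.symm]
  have h1 := h.phi_ne hxy
  have h2 := h.phi_ne hyz
  have h3 := h.phi_ne hxz
  have h4 := h.phi_ne hxy.symm
  generalize q - q⁻¹ = κ
  field_simp
  ring

theorem IsSeminormal.three_right (h : IsSeminormal q φ A B) {x y z : ℤ} (hxy : x ≠ y) (hyz : y ≠ z)
    (hxz : x ≠ z) :
    A (x - y) * A (y - z) + A (x - z) * A (z - y) = A (x - y) * A (x - z) := by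
  rw [h.diag_eq hxy, h.diag_eq hyz, h.diag_eq hxz, h.diag_eq hyz.symm]
  have h1 := h.phi_ne hxy
  have h2 := h.phi_ne hyz
  have h3 := h.phi_ne hxz
  have h4 := h.phi_ne hyz.symm
  generalize q - q⁻¹ = κ
  field_simp
  ring

variable (A B) {α : YoungDiagram}

/-- The operator on functions on all fillings attached to the exchange of the entries `a`, `b`. -/
def fillingOp {n : ℕ} (a b : Fin n) (g : (Fin n ≃ α.cells) → F) : (Fin n ≃ α.cells) → F :=
  fun U => A (content U a - content U b) * g U +
    B (content U a - content U b) * g ((Equiv.swap a b).trans U)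

/-- The matrix of a generator in the seminormal form. -/
def seminormalMatrix (α : YoungDiagram) {m : ℕ} (r : Fin m) :
    Matrix (StdTableau α (m + 1)) (StdTableau α (m + 1)) F :=
  Matrix.of fun S T =>
    if S = T then A (content T.filling r.castSucc - content T.filling r.succ)
    else if S.filling = (adjSwap r).trans T.filling then B (content T.filling r.castSucc - content T.filling r.succ)
    else 0

/-- Extension by zero of a function on standard tableaux. -/
def extendZero {n : ℕ} (f : StdTableau α n → F) : (Fin n ≃ α.cells) → F := by
  classical
  exact fun U => if h : IsStd U then f ⟨U, h⟩ else 0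

variable {A B}

theorem extendZero_std {n : ℕ} (f : StdTableau α n → F) (T : StdTableau α n) :
    extendZero f T.filling = f T := dif_pos T.isStd

theorem extendZero_mk {n : ℕ} (f : StdTableau α n → F) {U : Fin n ≃ α.cells} (h : IsStd U) :
    extendZero f U = f (StdTableau.mk U h) := dif_pos h

theorem extendZero_neg {n : ℕ} (f : StdTableau α n → F) {U : Fin n ≃ α.cells} (h : ¬ IsStd U) :
    extendZero f U = 0 := dif_neg h

theorem content_swap {n : ℕ} (e : Equiv.Perm (Fin n)) (U : Fin n ≃ α.cells) (a : Fin n) :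
    content (e.trans U) a = content U (e a) := rfl

variable {m : ℕ} {r : Fin m}

/-- Combined with `off_unit`: whenever an exchange leaves the standard tableaux, its coefficient
vanishes. -/
theorem IsStd.isUnit_of_not_swap {T : Fin (m + 1) ≃ α.cells} (hT : IsStd T)
    (hT' : ¬ IsStd ((adjSwap r).trans T)) :
    content T r.castSucc - content T r.succ = 1 ∨ content T r.castSucc - content T r.succ = -1 := by
  by_cases h1 : (T r.castSucc).1.1 = (T r.succ).1.1
  · have := hT.line_succ h1
    simp only [content]; omega
  · by_cases h2 : (T r.castSucc).1.2 = (T r.succ).1.2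
    · have := hT.col_succ h2
      simp only [content]; omega
    · exact absurd (hT.swap h1 h2) hT'

theorem IsStd.natAbs_of_swap {T : Fin (m + 1) ≃ α.cells} (hT : IsStd T)
    (hT' : IsStd ((adjSwap r).trans T)) :
    2 ≤ content T r.castSucc - content T r.succ ∨
      2 ≤ -(content T r.castSucc - content T r.succ) := by
  obtain ⟨h1, h2⟩ := hT.ne_of_swap hT'
  simp only [content]
  rcases Nat.lt_or_gt_of_ne h1 with h3 | h3
  · have := hT.line_lt h3 h2; omega
  · have := hT.lt_line h3; omega

theorem IsSeminormal.off_unit (h : IsSeminormal q φ A B) {d : ℤ} (hd : d = 1 ∨ d = -1) :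
    B d = 0 := by
  rcases hd with rfl | rfl
  · exact h.off_one
  · rw [h.symm, h.off_one]

/-- On all fillings the exchange is always defined, so relations can be checked by a uniform formula
without cases on standardness. The vanishing of `B` at `±1` makes the functions supported on
standard fillings stable. -/
theorem IsSeminormal.extendZero_mulVec (h : IsSeminormal q φ A B)
    (f : StdTableau α (m + 1) → F) :
    extendZero ((seminormalMatrix A B α r).mulVec f) =
      fillingOp A B r.castSucc r.succ (extendZero f) := by
  classical
  funext U
  have inv : (adjSwap r).trans ((adjSwap r).trans U) = U :=
    Equiv.ext fun a => by
      simp only [Equiv.trans_apply]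
      rw [show adjSwap r (adjSwap r a) = a from Equiv.swap_apply_self _ _ _]
  change _ = A (content U r.castSucc - content U r.succ) * extendZero f U +
    B (content U r.castSucc - content U r.succ) * extendZero f ((adjSwap r).trans U)
  by_cases hU : IsStd U
  · have e1 : ∀ T : StdTableau α (m + 1), seminormalMatrix A B α r (StdTableau.mk U hU) T * f T =
        (if T = (StdTableau.mk U hU) then A (content U r.castSucc - content U r.succ) * f (StdTableau.mk U hU) else 0) +
        (if T.filling = (adjSwap r).trans U then
          B (content U r.castSucc - content U r.succ) * f T else 0) := by
      intro T
      simp only [seminormalMatrix, Matrix.of_apply]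
      by_cases hTU : T = (StdTableau.mk U hU)
      · subst hTU
        rw [StdTableau.filling_mk]
        have hne : U ≠ (adjSwap r).trans U := fun he => by
          have := Equiv.congr_fun he r.castSucc
          rw [Equiv.trans_apply, adjSwap_castSucc] at this
          exact r.castSucc_lt_succ.ne (U.injective this)
        simp [hne]
      · rw [if_neg (Ne.symm hTU), if_neg hTU, zero_add]
        by_cases hs : T.filling = (adjSwap r).trans U
        · rw [if_pos hs, if_pos (by rw [hs, inv, StdTableau.filling_mk]), hs, content_swap, content_swap,
            adjSwap_castSucc, adjSwap_succ, ← h.symm]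
          congr 2; ring
        · rw [if_neg hs, if_neg, zero_mul]
          intro he
          apply hs
          have : U = (adjSwap r).trans T.filling := he
          rw [this]
          exact (Equiv.ext fun a => by
            simp only [Equiv.trans_apply]
            rw [show adjSwap r (adjSwap r a) = a from Equiv.swap_apply_self _ _ _])
    have e2 : extendZero ((seminormalMatrix A B α r).mulVec f) U =
        ∑ T, seminormalMatrix A B α r (StdTableau.mk U hU) T * f T := extendZero_mk _ hU
    rw [e2, Finset.sum_congr rfl fun T _ => e1 T, Finset.sum_add_distrib, Finset.sum_ite_eq',
      if_pos (Finset.mem_univ _), extendZero_mk f hU]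
    congr 1
    by_cases hs : IsStd ((adjSwap r).trans U)
    · have e3 : ∀ T : StdTableau α (m + 1), (T.filling = (adjSwap r).trans U) ↔
          T = (StdTableau.mk ((adjSwap r).trans U) hs) := fun T => ⟨fun he => StdTableau.filling_injective he, fun he => by rw [he]; rfl⟩
      simp only [e3]
      rw [Finset.sum_ite_eq', if_pos (Finset.mem_univ _), extendZero_mk f hs]
    · rw [h.off_unit (hU.isUnit_of_not_swap hs)]
      simp
  · rw [extendZero_neg _ hU, extendZero_neg _ hU, mul_zero, zero_add]
    by_cases hs : IsStd ((adjSwap r).trans U)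
    · have h1 := hs.isUnit_of_not_swap (r := r) (by rwa [inv])
      rw [content_swap, content_swap, adjSwap_castSucc, adjSwap_succ] at h1
      rw [h.off_unit (by omega), zero_mul]
    · rw [extendZero_neg _ hs, mul_zero]

theorem matrix_ext_extendZero {n : ℕ} {X Y : Matrix (StdTableau α n) (StdTableau α n) F}
    (h : ∀ (f : StdTableau α n → F) (U : Fin n ≃ α.cells), IsStd U →
      extendZero (X.mulVec f) U = extendZero (Y.mulVec f) U) : X = Y := by
  refine Matrix.ext_of_mulVec_single fun T => funext fun S => ?_
  have := h (Pi.single T 1) S.filling S.isStd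
  rwa [extendZero_std, extendZero_std] at this

theorem IsSeminormal.quadratic (h : IsSeminormal q φ A B) :
    seminormalMatrix A B α r * seminormalMatrix A B α r =
      1 + (q - q⁻¹) • seminormalMatrix A B α r := by
  refine matrix_ext_extendZero fun f U hU => ?_
  rw [Matrix.add_mulVec, Matrix.one_mulVec, Matrix.smul_mulVec, ← Matrix.mulVec_mulVec]
  have e : extendZero (f + (q - q⁻¹) • (seminormalMatrix A B α r).mulVec f) U =
      extendZero f U + (q - q⁻¹) * extendZero ((seminormalMatrix A B α r).mulVec f) U := by
    rw [extendZero_mk _ hU, extendZero_mk f hU, extendZero_mk _ hU]; rfl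
  have hd := sub_ne_zero.2 (hU.content_ne r.castSucc_lt_succ (by simp))
  rw [e, h.extendZero_mulVec, h.extendZero_mulVec]
  simp only [fillingOp, content_swap, Equiv.swap_apply_left, Equiv.swap_apply_right]
  have e2 : (Equiv.swap r.castSucc r.succ).trans ((Equiv.swap r.castSucc r.succ).trans U) = U :=
    Equiv.ext fun a => by simp
  have hs := h.sq _ hd
  have hB := h.symm (content U r.castSucc - content U r.succ)
  have ha := h.diag_add hd
  rw [neg_sub] at hs hB ha
  rw [e2, hB, ← ha]
  linear_combination extendZero f U * hs

theorem fillingOp_comm {n : ℕ} {a b c d : Fin n} (hac : a ≠ c) (had : a ≠ d) (hbc : b ≠ c)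
    (hbd : b ≠ d) (g : (Fin n ≃ α.cells) → F) :
    fillingOp A B a b (fillingOp A B c d g) = fillingOp A B c d (fillingOp A B a b g) := by
  funext U
  have e : (Equiv.swap c d).trans ((Equiv.swap a b).trans U) =
      (Equiv.swap a b).trans ((Equiv.swap c d).trans U) := Equiv.ext fun x => by
    simp only [Equiv.trans_apply, Equiv.swap_apply_def]
    split_ifs <;> simp_all
  simp only [fillingOp, content_swap, Equiv.swap_apply_of_ne_of_ne hac had,
    Equiv.swap_apply_of_ne_of_ne hbc hbd, Equiv.swap_apply_of_ne_of_ne hac.symm hbc.symm,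
    Equiv.swap_apply_of_ne_of_ne had.symm hbd.symm, e]
  ring

theorem IsSeminormal.far (h : IsSeminormal q φ A B) {i j : Fin m} (hij : (i : ℕ) + 1 < j) :
    seminormalMatrix A B α i * seminormalMatrix A B α j =
      seminormalMatrix A B α j * seminormalMatrix A B α i := by
  refine matrix_ext_extendZero fun f U _ => ?_
  rw [← Matrix.mulVec_mulVec, ← Matrix.mulVec_mulVec, h.extendZero_mulVec, h.extendZero_mulVec,
    h.extendZero_mulVec, h.extendZero_mulVec, fillingOp_comm] <;>
  simp only [ne_eq, Fin.ext_iff, Fin.val_castSucc, Fin.val_succ] <;> omega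

/-- Both sides expand over the six rearrangements of `a`, `b`, `c`. The terms that move all three
contents or reverse them agree by evenness of `B`; the identity term and the two adjacent exchanges
use the three-term identities and `sq`. -/
theorem IsSeminormal.fillingOp_braid (h : IsSeminormal q φ A B) {n : ℕ} {a b c : Fin n}
    (hab : a ≠ b) (hbc : b ≠ c) (hac : a ≠ c) (g : (Fin n ≃ α.cells) → F) {U : Fin n ≃ α.cells}
    (h1 : content U a ≠ content U b) (h2 : content U b ≠ content U c)
    (h3 : content U a ≠ content U c) :
    fillingOp A B a b (fillingOp A B b c (fillingOp A B a b g)) U =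
      fillingOp A B b c (fillingOp A B a b (fillingOp A B b c g)) U := by
  have ea : (Equiv.swap a b).trans ((Equiv.swap a b).trans U) = U := Equiv.ext fun a => by simp
  have eb : (Equiv.swap b c).trans ((Equiv.swap b c).trans U) = U := Equiv.ext fun a => by simp
  have ec : (Equiv.swap b c).trans ((Equiv.swap a b).trans ((Equiv.swap b c).trans U)) =
      (Equiv.swap a b).trans ((Equiv.swap b c).trans ((Equiv.swap a b).trans U)) := by
    refine Equiv.ext fun x => ?_
    simp only [Equiv.trans_apply, Equiv.swap_apply_def]
    split_ifs <;> simp_all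
  simp only [fillingOp, content_swap, Equiv.swap_apply_left, Equiv.swap_apply_right,
    Equiv.swap_apply_of_ne_of_ne hac.symm hbc.symm, Equiv.swap_apply_of_ne_of_ne hab hac, ea, eb,
    ec]
  have s1 := h.sq _ (sub_ne_zero.2 h1)
  have s2 := h.sq _ (sub_ne_zero.2 h2)
  have b1 := h.symm (content U a - content U b)
  have b2 := h.symm (content U b - content U c)
  have b3 := h.symm (content U a - content U c)
  have t1 := h.three_left h1 h2 h3
  have t2 := h.three_right h1 h2 h3
  rw [neg_sub] at s1 s2 b1 b2 b3
  rw [b1, b2]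
  set x := content U a
  set y := content U b
  set z := content U c
  linear_combination
    g U * (A (x - y) * t1 + A (x - z) * s1 - A (y - z) * t2 - A (x - z) * s2) +
    g ((Equiv.swap a b).trans U) * B (x - y) * t1 - g ((Equiv.swap b c).trans U) * B (y - z) * t2

theorem IsSeminormal.braid (h : IsSeminormal q φ A B) {i j : Fin m} (hij : (i : ℕ) + 1 = j) :
    seminormalMatrix A B α i * seminormalMatrix A B α j * seminormalMatrix A B α i =
      seminormalMatrix A B α j * seminormalMatrix A B α i * seminormalMatrix A B α j := by
  refine matrix_ext_extendZero fun f U hU => ?_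
  have e : i.succ = j.castSucc := Fin.ext (by simpa using hij)
  have lt1 : i.castSucc < j.castSucc := e ▸ i.castSucc_lt_succ
  have lt2 := j.castSucc_lt_succ
  simp only [← Matrix.mulVec_mulVec, h.extendZero_mulVec, e]
  exact h.fillingOp_braid lt1.ne lt2.ne (lt1.trans lt2).ne _
    (hU.content_ne lt1 (by simp; omega)) (hU.content_ne lt2 (by simp))
    (hU.content_ne (lt1.trans lt2) (by simp; omega))

/-- The Jucys-Murphy elements act diagonally. -/
theorem IsSeminormal.jucysMurphy (h : IsSeminormal q φ A B) :
    seminormalMatrix A B α r *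
        Matrix.diagonal (fun T : StdTableau α (m + 1) => φ (content T.filling r.castSucc)) *
        seminormalMatrix A B α r + seminormalMatrix A B α r =
      Matrix.diagonal (fun T : StdTableau α (m + 1) => φ (content T.filling r.succ)) := by
  have hD : ∀ (a : Fin (m + 1)) (f : StdTableau α (m + 1) → F),
      extendZero ((Matrix.diagonal fun T : StdTableau α (m + 1) => φ (content T.filling a)).mulVec f) =
        fun U => φ (content U a) * extendZero f U := by
    intro a f
    funext U
    by_cases hU : IsStd U
    · rw [extendZero_mk _ hU, extendZero_mk f hU, Matrix.mulVec_diagonal,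
        StdTableau.filling_mk]
    · rw [extendZero_neg _ hU, extendZero_neg _ hU, mul_zero]
  refine matrix_ext_extendZero fun f U hU => ?_
  rw [Matrix.add_mulVec, ← Matrix.mulVec_mulVec, ← Matrix.mulVec_mulVec]
  have e : ∀ f g : StdTableau α (m + 1) → F, extendZero (f + g) U =
      extendZero f U + extendZero g U := by
    intro f g
    rw [extendZero_mk _ hU, extendZero_mk f hU, extendZero_mk g hU]; rfl
  rw [e, h.extendZero_mulVec, hD, h.extendZero_mulVec, hD]
  have hne := hU.content_ne (r.castSucc_lt_succ) (by simp)
  simp only [fillingOp, content_swap, Equiv.swap_apply_left, Equiv.swap_apply_right]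
  have e2 : (Equiv.swap r.castSucc r.succ).trans ((Equiv.swap r.castSucc r.succ).trans U) = U :=
    Equiv.ext fun a => by simp
  have hs := h.sq _ (sub_ne_zero.2 hne)
  have hB := h.symm (content U r.castSucc - content U r.succ)
  rw [neg_sub] at hs hB
  rw [e2, hB]
  set x := content U r.castSucc
  set y := content U r.succ
  -- This is the off-diagonal entry divided by `B`; its vanishing, with `sq`, also gives the
  -- diagonal entry `φ y`.
  have key : A (x - y) * φ x + A (y - x) * φ y + 1 = 0 := by
    rw [h.diag_eq hne, h.diag_eq hne.symm]
    have h1 := h.phi_ne hne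
    have h2 := h.phi_ne hne.symm
    generalize q - q⁻¹ = κ
    field_simp
    ring
  linear_combination extendZero f U * (A (x - y) * key + φ y * hs) +
    extendZero f ((Equiv.swap r.castSucc r.succ).trans U) * B (x - y) * key

theorem IsSeminormal.quadratic' (h : IsSeminormal q φ A B) :
    (seminormalMatrix A B α r - q • 1) * (seminormalMatrix A B α r + q⁻¹ • 1) = 0 := by
  rw [sub_mul, mul_add, mul_add, h.quadratic]
  simp only [Matrix.mul_smul, Matrix.smul_mul, mul_one, one_mul, smul_smul, sub_smul,
    inv_mul_cancel₀ h.q_ne, one_smul]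
  abel

theorem IsSeminormal.mul_inverse (h : IsSeminormal q φ A B) :
    seminormalMatrix A B α r * (seminormalMatrix A B α r - (q - q⁻¹) • 1) = 1 := by
  rw [mul_sub, h.quadratic, Matrix.mul_smul, mul_one, add_sub_cancel_right]

/-- The representation of the braid group in seminormal form. -/
theorem IsSeminormal.exists_rep (h : IsSeminormal q φ A B) (α : YoungDiagram) (m : ℕ) :
    ∃ R : BraidGroup m →* GL (StdTableau α (m + 1)) F,
      ∀ r : Fin m, (R (BraidGroup.σ r) : Matrix _ _ F) = seminormalMatrix A B α r := by
  let g : Fin m → GL (StdTableau α (m + 1)) F := fun r =>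
    ⟨seminormalMatrix A B α r, seminormalMatrix A B α r - (q - q⁻¹) • 1, h.mul_inverse,
      mul_eq_one_comm.1 h.mul_inverse⟩
  have hrel : ∀ x ∈ braidRels m, FreeGroup.lift g x = 1 := by
    rintro x (⟨i, j, hij, rfl⟩ | ⟨i, j, hij, rfl⟩)
    · rw [map_mul, map_inv, mul_inv_eq_one]
      simp only [map_mul, FreeGroup.lift_apply_of]
      exact Units.ext (h.far hij)
    · rw [map_mul, map_inv, mul_inv_eq_one]
      simp only [map_mul, FreeGroup.lift_apply_of]
      exact Units.ext (h.braid hij)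
  exact ⟨PresentedGroup.toGroup hrel, fun r => by
    rw [BraidGroup.σ, PresentedGroup.toGroup.of]⟩

theorem seminormalMatrix_mulVec_single (T : StdTableau α (m + 1)) :
    (seminormalMatrix A B α r).mulVec (Pi.single T 1) = fun S =>
      if S = T then A (content T.filling r.castSucc - content T.filling r.succ)
      else if S.filling = (adjSwap r).trans T.filling then B (content T.filling r.castSucc - content T.filling r.succ)
      else 0 := by
  rw [Matrix.mulVec_single_one]; rfl

/-- The diagonal Jucys-Murphy matrices are polynomials in the generators, so they preserve `W`.
Their joint eigenvalues separate tableaux, which allows a nonzero vector of `W` to be cut down to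
one coordinate. -/
theorem IsSeminormal.exists_single_mem (h : IsSeminormal q φ A B)
    {W : Submodule F (StdTableau α (m + 1) → F)}
    (hW : ∀ (r : Fin m), ∀ v ∈ W, (seminormalMatrix A B α r).mulVec v ∈ W) (hne : W ≠ ⊥) :
    ∃ T, Pi.single T 1 ∈ W := by
  classical
  have hD : ∀ a : Fin (m + 1), ∀ v ∈ W,
      (Matrix.diagonal fun T : StdTableau α (m + 1) => φ (content T.filling a)).mulVec v ∈ W := by
    intro a
    induction a using Fin.induction with
    | zero =>
      intro v _
      have : (Matrix.diagonal fun T : StdTableau α (m + 1) => φ (content T.filling 0)) = 0 := by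
        rw [Matrix.diagonal_eq_zero]
        funext T
        rw [IsStd.content_zero T.isStd, h.zero]; rfl
      rw [this, Matrix.zero_mulVec]
      exact W.zero_mem
    | succ r ih =>
      intro v hv
      rw [← h.jucysMurphy, Matrix.add_mulVec, ← Matrix.mulVec_mulVec, ← Matrix.mulVec_mulVec]
      exact W.add_mem (hW r _ (ih _ (hW r _ hv))) (hW r _ hv)
  obtain ⟨v, hv, hv0⟩ := W.ne_bot_iff.1 hne
  induction hn : (Finset.univ.filter fun T => v T ≠ 0).card using Nat.strong_induction_on
    generalizing v with
  | _ n ih =>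
    subst hn
    obtain ⟨T, hT⟩ := Function.ne_iff.1 hv0
    by_cases hS : ∃ S, S ≠ T ∧ v S ≠ 0
    · obtain ⟨S, hST, hS⟩ := hS
      obtain ⟨a, ha⟩ : ∃ a, content S.filling a ≠ content T.filling a := by
        by_contra! hc
        exact hST (StdTableau.filling_injective (IsStd.content_injective S.isStd T.isStd hc))
      -- This combination kills the coordinate at `S`, keeps the one at `T` nonzero and creates no
      -- new support.
      let u : StdTableau α (m + 1) → F :=
        (Matrix.diagonal fun T : StdTableau α (m + 1) => φ (content T.filling a)).mulVec v -
          φ (content S.filling a) • v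
      have hu : ∀ X, u X = (φ (content X.filling a) - φ (content S.filling a)) * v X := fun X => by
        simp only [u, Pi.sub_apply, Matrix.mulVec_diagonal, Pi.smul_apply, smul_eq_mul, sub_mul]
      refine ih _ (Finset.card_lt_card ?_) u (W.sub_mem (hD a v hv) (W.smul_mem _ hv)) ?_ rfl
      · refine Finset.ssubset_iff_subset_ne.2 ⟨fun X hX => ?_, fun he => ?_⟩
        · simp only [Finset.mem_filter, Finset.mem_univ, true_and, hu] at hX ⊢
          exact right_ne_zero_of_mul hX
        · have : S ∈ Finset.univ.filter fun T => u T ≠ 0 := by rw [he]; simpa using hS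
          simp [hu] at this
      · intro hu0
        have := congrFun hu0 T
        rw [hu] at this
        exact mul_ne_zero (h.phi_ne ha) hT this
    · push Not at hS
      refine ⟨T, ?_⟩
      have : Pi.single T 1 = (v T)⁻¹ • v := by
        funext S
        by_cases hST : S = T
        · subst hST
          simpa using (inv_mul_cancel₀ hT).symm
        · simp [hST, hS S hST]
      rw [this]
      exact W.smul_mem _ hv

/-- One basis vector yields all: an admissible exchange has axial distance at least 2 in absolute
value, so its coefficient `B` is nonzero, and exchanges connect all standard tableaux. -/
theorem IsSeminormal.invariant_eq_bot_or_top (h : IsSeminormal q φ A B)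
    (W : Submodule F (StdTableau α (m + 1) → F))
    (hW : ∀ (r : Fin m), ∀ v ∈ W, (seminormalMatrix A B α r).mulVec v ∈ W) : W = ⊥ ∨ W = ⊤ := by
  classical
  by_cases hne : W = ⊥
  · exact Or.inl hne
  right
  obtain ⟨T, hT⟩ := h.exists_single_mem hW hne
  let P : (Fin (m + 1) ≃ α.cells) → Prop := fun U =>
    ∀ hU : IsStd U, Pi.single ((StdTableau.mk U hU) : StdTableau α (m + 1)) (1 : F) ∈ W
  have hP : ∀ (T : Fin (m + 1) ≃ α.cells) (r : Fin m), IsStd T → IsStd ((adjSwap r).trans T) →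
      P T → P ((adjSwap r).trans T) := by
    intro U r hU hU' hPU _
    let T : StdTableau α (m + 1) := StdTableau.mk U hU
    let T' : StdTableau α (m + 1) := StdTableau.mk ((adjSwap r).trans U) hU'
    have hTf : T.filling = U := rfl
    have hTT : T' ≠ T := fun he => by
      have he' : (adjSwap r).trans U = U := congrArg StdTableau.filling he
      have := Equiv.congr_fun he' r.castSucc
      rw [Equiv.trans_apply, adjSwap_castSucc] at this
      exact r.castSucc_lt_succ.ne' (U.injective this)
    have hB : B (content U r.castSucc - content U r.succ) ≠ 0 := by
      rcases hU.natAbs_of_swap hU' with hd | hd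
      · exact h.off_ne _ hd
      · rw [← h.symm]; exact h.off_ne _ hd
    have e : Pi.single T' (1 : F) = (B (content U r.castSucc - content U r.succ))⁻¹ •
        ((seminormalMatrix A B α r).mulVec (Pi.single T 1) -
          A (content U r.castSucc - content U r.succ) • Pi.single T 1) := by
      rw [seminormalMatrix_mulVec_single]
      funext S
      simp only [Pi.smul_apply, Pi.sub_apply, smul_eq_mul, Pi.single_apply]
      have e3 : (S.filling = (adjSwap r).trans T.filling) ↔ S = T' :=
        ⟨fun he => StdTableau.filling_injective he, fun he => by rw [he]; rfl⟩
      simp only [e3]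
      by_cases h1 : S = T
      · subst h1
        simp [hTT.symm, hTf]
      · by_cases h2 : S = T'
        · simp [h2, hTT, hB, hTf]
        · simp [h1, h2]
    rw [e]
    exact W.smul_mem _ (W.sub_mem (hW r _ (hPU hU)) (W.smul_mem _ (hPU hU)))
  have hall : ∀ S : StdTableau α (m + 1), Pi.single S (1 : F) ∈ W := fun S =>
    IsStd.exists_swap_chain hP S.isStd T.isStd (fun _ => hT) S.isStd
  refine eq_top_iff.2 fun v _ => ?_
  rw [pi_eq_sum_univ' v]
  refine W.sum_mem fun S _ => ?_
  have : (fun j => if j = S then (1 : F) else 0) = Pi.single S 1 := by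
    funext j; rw [Pi.single_apply]
  exact W.smul_mem _ (by simpa [eq_comm, this] using hall S)

/-- In the reading tableaux, consecutive entries of one parabolic block are adjacent cells, with
content difference `-1` or `1`. The basis vector is then an eigenvector for `q` or `-q⁻¹`. -/
theorem IsSeminormal.isHeckeClass (h : IsSeminormal q φ A B) (hα : α.card = m + 1)
    (R : BraidGroup m →* GL (StdTableau α (m + 1)) F)
    (hR : ∀ r : Fin m, (R (BraidGroup.σ r) : Matrix _ _ F) = seminormalMatrix A B α r) :
    IsHeckeClass q α R := by
  have single : ∀ (T : StdTableau α (m + 1)) (r : Fin m) (c : F),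
      B (content T.filling r.castSucc - content T.filling r.succ) = 0 →
      A (content T.filling r.castSucc - content T.filling r.succ) = c →
      (R (BraidGroup.σ r) : Matrix _ _ F).mulVec (Pi.single T 1) = c • Pi.single T 1 := by
    intro T r c hB hA
    rw [hR, seminormalMatrix_mulVec_single]
    funext S
    simp only [hA, hB, ite_self, Pi.smul_apply, Pi.single_apply, smul_eq_mul, mul_ite, mul_one,
      mul_zero]
  obtain ⟨T₁, h₁, hr₁⟩ := exists_std_rowReading α hα
  obtain ⟨T₂, h₂, hr₂⟩ := exists_std_colReading α hα
  refine ⟨fun r => ?_, ⟨(StdTableau.mk T₁ h₁)⟩, fun W hW => ?_, ⟨Pi.single (StdTableau.mk T₁ h₁) 1, ?_, fun r hr => ?_⟩,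
    ⟨Pi.single (StdTableau.mk T₂ h₂) 1, ?_, fun r hr => ?_⟩⟩
  · rw [hR]; exact h.quadratic'
  · exact h.invariant_eq_bot_or_top W fun r v hv => by rw [← hR]; exact hW _ v hv
  · simp
  · have hd : content T₁ r.castSucc - content T₁ r.succ = -1 := by
      have h3 := hr₁ r hr
      have h4 := h₁.line_succ h3
      simp only [content]; omega
    exact single (StdTableau.mk T₁ h₁) r q (by rw [StdTableau.filling_mk, h.off_unit (Or.inr hd)]) (by rw [StdTableau.filling_mk, hd, h.diag_neg_one])
  · simp
  · have hd : content T₂ r.castSucc - content T₂ r.succ = 1 := by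
      have h3 := hr₂ r hr
      have h4 := h₂.col_succ h3
      simp only [content]; omega
    exact single (StdTableau.mk T₂ h₂) r (-q⁻¹) (by rw [StdTableau.filling_mk, h.off_unit (Or.inl hd)]) (by rw [StdTableau.filling_mk, hd, h.diag_one])

theorem IsSeminormal.tableauMatrix_eq (h : IsSeminormal q φ A B)
    {M : ℕ → Matrix (Fin 2) (Fin 2) F}
    (hM : ∀ d : ℕ, 2 ≤ d → M d = !![A d, B d; B d, A (-d)]) (α : YoungDiagram) {m : ℕ}
    (r : Fin m) : tableauMatrix q M α r = seminormalMatrix A B α r := by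
  ext S T
  have hT : IsStd T.filling := T.isStd
  have hcol : ∀ a, T.col a = (T.filling a).1.1 := fun _ => rfl
  have hline : ∀ a, T.line a = (T.filling a).1.2 := fun _ => rfl
  have hs : ∀ x, (if S.1 = (adjSwap r).trans T.1 then x else (0 : F)) =
    if S.filling = (adjSwap r).trans T.filling then x else 0 := fun _ => rfl
  simp only [tableauMatrix, seminormalMatrix, Matrix.of_apply, hs, hcol, hline]
  set d := content T.filling r.castSucc - content T.filling r.succ with hd
  simp only [content] at hd
  by_cases h1 : (T.filling r.castSucc).1.1 = (T.filling r.succ).1.1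
  · have h3 := hT.line_succ h1
    obtain h2 : d = -1 := by omega
    simp only [h1, if_true, h2, h.diag_neg_one, h.off_unit (Or.inr rfl), ite_self]
  by_cases h2 : (T.filling r.castSucc).1.2 = (T.filling r.succ).1.2
  · have h3 := hT.col_succ h2
    obtain h4 : d = 1 := by omega
    rw [if_neg h1, if_pos h2, h4, h.diag_one, h.off_one, ite_self]
  rw [if_neg h1, if_neg h2]
  by_cases h3 : (T.filling r.castSucc).1.1 < (T.filling r.succ).1.1
  · have h4 := hT.line_lt h3 h2
    have h5 : ((T.axialDist r.castSucc r.succ : ℕ) : ℤ) = d := by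
      simp only [StdTableau.axialDist, hcol, hline]; omega
    have h6 := hM (T.axialDist r.castSucc r.succ) (by omega)
    rw [h5] at h6
    simp only [h3, if_true, h6, Matrix.of_apply, Matrix.cons_val_zero, Matrix.cons_val_one]
  · have h4 := hT.lt_line (r := r) (by omega)
    have h5 : ((T.axialDist r.succ r.castSucc : ℕ) : ℤ) = -d := by
      simp only [StdTableau.axialDist, hcol, hline]; omega
    have h6 := hM (T.axialDist r.succ r.castSucc) (by omega)
    rw [h5, neg_neg, h.symm] at h6
    simp only [h3, if_false, h6, Matrix.of_apply, Matrix.cons_val_zero, Matrix.cons_val_one]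

theorem IsSeminormal.isMatrixModel (h : IsSeminormal q φ A B)
    {M : ℕ → Matrix (Fin 2) (Fin 2) F}
    (hM : ∀ d : ℕ, 2 ≤ d → M d = !![A d, B d; B d, A (-d)]) : IsMatrixModel q M := by
  intro m α hα
  obtain ⟨R, hR⟩ := h.exists_rep α m
  exact ⟨R, fun r => by rw [hR, h.tableauMatrix_eq hM], h.isHeckeClass hα R hR⟩

end

/-! ### Substitutions in noncommutative series -/

section
variable {k : Type*} [Field k] {R S : Type*} [Ring R] [Algebra k R] [Ring S] [Algebra k S]

theorem NCSeries.map_subst (Φ : NCSeries k) (f : R →ₐ[k] S) (u v : R) :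
    PowerSeries.map (f : R →+* S) (Φ.subst u v) = Φ.subst (f u) (f v) := by
  ext n
  simp only [PowerSeries.coeff_map, NCSeries.subst, PowerSeries.coeff_mk, RingHom.coe_coe, map_sum,
    map_smul, map_list_prod, List.map_ofFn]
  refine Finset.sum_congr rfl fun w _ => ?_
  congr 3
  funext i
  simp only [Function.comp_apply]
  generalize w i = a
  fin_cases a <;> rfl

theorem map_expH (c : k) (f : R →ₐ[k] S) (a : R) :
    PowerSeries.map (f : R →+* S) (expH c a) = expH c (f a) := by
  ext n
  simp [expH]

theorem NCSeries.bar_subst (Φ : NCSeries k) (u v : R) :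
    Φ.bar.subst u v = Φ.subst (-u) (-v) := by
  ext n
  simp only [NCSeries.subst, PowerSeries.coeff_mk, NCSeries.bar, List.length_ofFn]
  refine Finset.sum_congr rfl fun w _ => ?_
  have h : (List.ofFn fun i => ![-u, -v] (w i)) = (List.ofFn fun i => ![u, v] (w i)).map Neg.neg := by
    rw [List.map_ofFn]
    congr 1
    funext i
    simp only [Function.comp_apply]
    generalize w i = a
    fin_cases a <;> rfl
  rw [h, List.prod_map_neg, List.length_ofFn, mul_comm, mul_smul]
  congr 1
  rcases Nat.even_or_odd n with hn | hn <;> simp [hn.neg_one_pow]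

theorem NCSeries.subst_zero (Φ : NCSeries k) :
    Φ.subst (0 : R) 0 = PowerSeries.C (Φ [] • (1 : R)) := by
  ext n
  rw [PowerSeries.coeff_C]
  simp only [NCSeries.subst, PowerSeries.coeff_mk]
  rcases n with _ | n
  · simp
  · rw [if_neg (Nat.succ_ne_zero n)]
    refine Finset.sum_eq_zero fun w _ => ?_
    have : ![(0 : R), 0] (w 0) = 0 := by
      generalize w 0 = a
      fin_cases a <;> rfl
    rw [List.ofFn_succ (f := fun i => ![(0 : R), 0] (w i)), List.prod_cons, this, zero_mul, smul_zero]

theorem prod_map_semiconj {ι : Type*} {s : R} {f g : ι → R} (h : ∀ i, s * f i = g i * s)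
    (l : List ι) : s * (l.map f).prod = (l.map g).prod * s := by
  induction l with
  | nil => simp
  | cons i l ih => rw [List.map_cons, List.map_cons, List.prod_cons, List.prod_cons, ← mul_assoc, h,
      mul_assoc, ih, mul_assoc]

theorem NCSeries.C_mul_subst (Φ : NCSeries k) {s u v u' v' : R} (hu : s * u = u' * s)
    (hv : s * v = v' * s) :
    PowerSeries.C s * Φ.subst u v = Φ.subst u' v' * PowerSeries.C s := by
  ext n
  rw [PowerSeries.coeff_C_mul, PowerSeries.coeff_mul_C]
  simp only [NCSeries.subst, PowerSeries.coeff_mk]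
  rw [Finset.mul_sum, Finset.sum_mul]
  refine Finset.sum_congr rfl fun w _ => ?_
  have h : ∀ a, s * ![u, v] a = ![u', v'] a * s := by
    intro a
    fin_cases a
    · exact hu
    · exact hv
  have := prod_map_semiconj h (List.ofFn w)
  rw [List.map_ofFn, List.map_ofFn] at this
  rw [mul_smul_comm, smul_mul_assoc]
  exact congrArg _ this

theorem C_mul_expH (c : k) {s a b : R} (h : s * a = b * s) :
    PowerSeries.C s * expH c a = expH c b * PowerSeries.C s := by
  ext n
  rw [PowerSeries.coeff_C_mul, PowerSeries.coeff_mul_C]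
  simp only [expH, PowerSeries.coeff_mk]
  rw [mul_smul_comm, smul_mul_assoc]
  exact congrArg _ (SemiconjBy.pow_right h n)

theorem expH_commute (c : k) {a : R} {f : R⟦X⟧} (h : Commute (PowerSeries.C a) f) :
    Commute (expH c a) f := by
  change _ = _
  ext n
  rw [PowerSeries.coeff_mul, PowerSeries.coeff_mul, ← Finset.Nat.sum_antidiagonal_swap]
  refine Finset.sum_congr rfl fun i _ => ?_
  have := congrArg (PowerSeries.coeff i.1) (h.pow_left i.2).eq
  rw [← map_pow, PowerSeries.coeff_C_mul, PowerSeries.coeff_mul_C] at this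
  simp only [Prod.fst_swap, Prod.snd_swap, expH, PowerSeries.coeff_mk]
  rw [smul_mul_assoc, mul_smul_comm, this]

theorem expH_mul_subst_comm (Φ : NCSeries k) (c : k) {a u v : R} (hu : Commute a u)
    (hv : Commute a v) : Commute (expH c a) (Φ.subst u v) :=
  expH_commute c (Φ.C_mul_subst hu hv)

theorem expH_zero (c : k) : expH c (0 : R) = 1 := by
  ext n
  rcases n with _ | n
  · simp [expH]
  · simp [expH, PowerSeries.coeff_one]

theorem expH_add [CharZero k] (c : k) {a b : R} (h : Commute a b) :
    expH c (a + b) = expH c a * expH c b := by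
  ext n
  rw [PowerSeries.coeff_mul]
  simp only [expH, PowerSeries.coeff_mk]
  rw [h.add_pow', Finset.smul_sum]
  refine Finset.sum_congr rfl fun i hi => ?_
  obtain ⟨i, j⟩ := i
  obtain rfl : i + j = n := by simpa using hi
  rw [smul_mul_smul_comm, ← Nat.cast_smul_eq_nsmul k, smul_smul]
  congr 1
  have h1 : ((i + j).choose i : k) * i.factorial * j.factorial = (i + j).factorial := by
    have := Nat.add_choose_mul_factorial_mul_factorial j i
    rw [add_comm j i] at this
    rw [mul_right_comm]
    exact_mod_cast this
  have h2 : (i.factorial : k) ≠ 0 := by exact_mod_cast i.factorial_ne_zero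
  have h3 : (j.factorial : k) ≠ 0 := by exact_mod_cast j.factorial_ne_zero
  have h4 : ((i + j).factorial : k) ≠ 0 := by exact_mod_cast (i + j).factorial_ne_zero
  rw [pow_add]
  field_simp
  linear_combination c ^ i * c ^ j * h1

theorem expH_half [CharZero k] (c : k) (a : R) : expH (c / 2) a * expH (c / 2) a = expH c a := by
  rw [← expH_add _ (Commute.refl a)]
  ext n
  simp only [expH, PowerSeries.coeff_mk]
  rw [← two_smul k a, smul_pow, smul_smul]
  congr 1
  rw [div_pow]
  field_simp

theorem expH_mul_neg [CharZero k] (c : k) (a : R) : expH c a * expH c (-a) = 1 := by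
  rw [← expH_add c (Commute.neg_right (Commute.refl a)), add_neg_cancel, expH_zero]

theorem expH_neg_mul [CharZero k] (c : k) (a : R) : expH c (-a) * expH c a = 1 := by
  rw [← expH_add c (Commute.neg_left (Commute.refl a)), neg_add_cancel, expH_zero]

/-- The anti-homomorphic substitution, in which words are read backwards. -/
def NCSeries.substRev (Φ : NCSeries k) (u v : R) : R⟦X⟧ :=
  PowerSeries.mk fun n => ∑ w : Fin n → Fin 2,
    Φ (List.ofFn w) • (List.ofFn fun i => ![u, v] (w i)).reverse.prod

theorem NCSeries.map_substRev (Φ : NCSeries k) (f : R →ₐ[k] S) (u v : R) :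
    PowerSeries.map (f : R →+* S) (Φ.substRev u v) = Φ.substRev (f u) (f v) := by
  ext n
  simp only [PowerSeries.coeff_map, NCSeries.substRev, PowerSeries.coeff_mk, RingHom.coe_coe,
    map_sum, map_smul, map_list_prod, List.map_reverse, List.map_ofFn]
  refine Finset.sum_congr rfl fun w _ => ?_
  congr 4
  funext i
  simp only [Function.comp_apply]
  generalize w i = a
  fin_cases a <;> rfl

end

/-! ### Consequences of the group-like and hexagon equations -/

section
variable {k : Type*} [Field k] {lam : k} {Φ : NCSeries k} {R : Type*} [Ring R] [Algebra k R]

/-- The homomorphism `k⟨x, y⟩ → R` with `x ↦ u`, `y ↦ v`. -/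
def letterHom (k : Type*) [Field k] {R : Type*} [Ring R] [Algebra k R] (u v : R) :
    FreeAlgebra k (Fin 2) →ₐ[k] R :=
  FreeAlgebra.lift k ![u, v]

theorem letterHom_zero (u v : R) : letterHom k u v (FreeAlgebra.ι k 0) = u := by
  simp [letterHom]

theorem letterHom_one (u v : R) : letterHom k u v (FreeAlgebra.ι k 1) = v := by
  simp [letterHom]

theorem IsAssociator.subst_mul_subst (h : IsAssociator lam Φ) (u v : R) :
    Φ.subst u v * Φ.subst v u = 1 := by
  have := congrArg (PowerSeries.map (letterHom k u v : FreeAlgebra k (Fin 2) →+* R)) h.inverse.2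
  simpa only [map_mul, map_one, NCSeries.map_subst, letterHom_zero, letterHom_one] using this

theorem IsAssociator.hexagon_eq (h : IsAssociator lam Φ) (u v : R) :
    expH (lam / 2) u * Φ.subst (-u - v) u * expH (lam / 2) (-u - v) * Φ.subst v (-u - v) *
      expH (lam / 2) v * Φ.subst u v = 1 := by
  have := congrArg (PowerSeries.map (letterHom k u v : FreeAlgebra k (Fin 2) →+* R)) h.hexagon
  simpa only [map_mul, map_one, NCSeries.map_subst, map_expH, map_sub, map_neg, letterHom_zero,
    letterHom_one] using this

/-- Two homomorphisms from the free algebra with commuting images factor through the tensor product;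
apply the resulting map to the group-like equation. -/
theorem IsAssociator.subst_add (h : IsAssociator lam Φ) {u v u' v' : R} (huu : Commute u u')
    (huv : Commute u v') (hvu : Commute v u') (hvv : Commute v v') :
    Φ.subst (u + u') (v + v') = Φ.subst u v * Φ.subst u' v' := by
  have hcomm : ∀ a b, Commute (letterHom k u v a) (letterHom k u' v' b) := by
    have key : ∀ (w : R), Commute w u' → Commute w v' → ∀ b, Commute w (letterHom k u' v' b) := by
      intro w h1 h2 b
      induction b using FreeAlgebra.induction with
      | grade0 r => rw [AlgHom.commutes]; exact Algebra.commute_algebraMap_right r w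
      | grade1 i => fin_cases i
                    · exact (letterHom_zero (k := k) u' v').symm ▸ h1
                    · exact (letterHom_one (k := k) u' v').symm ▸ h2
      | mul a b ha hb => rw [map_mul]; exact ha.mul_right hb
      | add a b ha hb => rw [map_add]; exact ha.add_right hb
    intro a b
    induction a using FreeAlgebra.induction with
    | grade0 r => rw [AlgHom.commutes]; exact Algebra.commute_algebraMap_left r _
    | grade1 i => fin_cases i
                  · exact (letterHom_zero (k := k) u v).symm ▸ key u huu huv b
                  · exact (letterHom_one (k := k) u v).symm ▸ key v hvu hvv b
    | mul a b ha hb => rw [map_mul]; exact ha.mul_left hb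
    | add a b ha hb => rw [map_add]; exact ha.add_left hb
  have := congrArg (PowerSeries.map (Algebra.TensorProduct.lift (letterHom k u v)
    (letterHom k u' v') hcomm : FreeAlgebra k (Fin 2) ⊗[k] FreeAlgebra k (Fin 2) →+* R)) h.grouplike
  simpa only [map_mul, NCSeries.map_subst, map_add, Algebra.TensorProduct.lift_tmul, map_one,
    mul_one, one_mul, letterHom_zero, letterHom_one] using this

theorem IsAssociator.nil (h : IsAssociator lam Φ) : Φ [] = 1 := by
  have h1 := h.subst_mul_subst (0 : k) 0
  have h2 := h.subst_add (Commute.refl (0 : k)) (Commute.refl (0 : k)) (Commute.refl (0 : k))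
    (Commute.refl (0 : k))
  rw [add_zero, h1, NCSeries.subst_zero] at h2
  simpa using congrArg PowerSeries.constantCoeff h2

theorem subst_neg_of_even (heven : Φ.bar = Φ) (u v : R) : Φ.subst (-u) (-v) = Φ.subst u v := by
  rw [← NCSeries.bar_subst, heven]

theorem powerSeries_eq_one_of_sq {D : Type*} [CommRing D] [IsDomain D] [CharZero D] {f : D⟦X⟧}
    (h : f * f = 1) (h0 : PowerSeries.constantCoeff f = 1) : f = 1 := by
  have h1 : (f - 1) * (f + 1) = 0 := by linear_combination h
  rcases mul_eq_zero.1 h1 with h2 | h2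
  · exact sub_eq_zero.1 h2
  · have := congrArg PowerSeries.constantCoeff h2
    rw [map_add, h0, map_one, map_zero] at this
    norm_num at this

theorem NCSeries.constantCoeff_subst (Φ : NCSeries k) (u v : R) :
    PowerSeries.constantCoeff (Φ.subst u v) = Φ [] • 1 := by
  rw [← PowerSeries.coeff_zero_eq_constantCoeff_apply]
  simp [NCSeries.subst]

/-- For commuting arguments, `Φ(u, v)² = Φ(u, v) Φ(-u, -v) = Φ(0, 0) = 1` by evenness, and the
constant term `1` selects the root `1`. The argument runs over `k[X]`, a domain, and is then
specialised. -/
theorem IsAssociator.subst_left_zero [CharZero k] (h : IsAssociator lam Φ) (heven : Φ.bar = Φ)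
    (c : R) : Φ.subst c 0 = 1 ∧ Φ.subst 0 c = 1 := by
  have key : ∀ u v : Polynomial k, Φ.subst u v = 1 := by
    intro u v
    refine powerSeries_eq_one_of_sq ?_ ?_
    · nth_rewrite 2 [← subst_neg_of_even heven]
      rw [← h.subst_add (Commute.all _ _) (Commute.all _ _) (Commute.all _ _) (Commute.all _ _),
        add_neg_cancel, add_neg_cancel, NCSeries.subst_zero, h.nil, one_smul, map_one]
    · rw [NCSeries.constantCoeff_subst, h.nil, one_smul]
  constructor
  · have := congrArg (PowerSeries.map ((Polynomial.aeval c : Polynomial k →ₐ[k] R) : Polynomial k →+* R))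
      (key Polynomial.X 0)
    simpa only [NCSeries.map_subst, map_one, map_zero, Polynomial.aeval_X] using this
  · have := congrArg (PowerSeries.map ((Polynomial.aeval c : Polynomial k →ₐ[k] R) : Polynomial k →+* R))
      (key 0 Polynomial.X)
    simpa only [NCSeries.map_subst, map_one, map_zero, Polynomial.aeval_X] using this

theorem IsAssociator.subst_add_left [CharZero k] (h : IsAssociator lam Φ) (heven : Φ.bar = Φ)
    {u v c : R} (hu : Commute u c) (hv : Commute v c) : Φ.subst (u + c) v = Φ.subst u v := by
  have := h.subst_add hu (Commute.zero_right u) hv (Commute.zero_right v)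
  rwa [add_zero, (h.subst_left_zero heven c).1, mul_one] at this

theorem IsAssociator.subst_add_right [CharZero k] (h : IsAssociator lam Φ) (heven : Φ.bar = Φ)
    {u v c : R} (hu : Commute u c) (hv : Commute v c) : Φ.subst u (v + c) = Φ.subst u v := by
  have := h.subst_add (Commute.zero_right u) hu (Commute.zero_right v) hv
  rwa [add_zero, (h.subst_left_zero heven c).2, mul_one] at this

/-- The image of a braid generator under an associator, in an algebra with elements `s`, `x`, `y`
playing the roles of the transposition, of `t_{r,r+1}` and of `Y_r`. -/
def braidSeries (lam : k) (Φ : NCSeries k) (s x y : R) : R⟦X⟧ :=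
  Φ.subst x y * PowerSeries.C s * expH (lam / 2) x * Φ.subst y x

/-- The relation `σ_r δ_r σ_r = δ_{r+1}`. -/
theorem IsAssociator.braidSeries_mul [CharZero k] (h : IsAssociator lam Φ) (heven : Φ.bar = Φ)
    {s x y z : R} (hs : s * s = 1) (hx : s * x = x * s) (hy : s * y = z * s)
    (hcx : Commute x (x + y + z)) (hcy : Commute y (x + y + z)) :
    braidSeries lam Φ s x y * expH lam y * braidSeries lam Φ s x y = expH lam (x + z) := by
  set c := x + y + z with hc
  set w := -x - y with hw
  have hzw : z = w + c := by rw [hc, hw]; abel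
  have hcw : Commute w c := (hcx.neg_left).sub_left hcy
  have b1 : Φ.subst z x = Φ.subst w x := by rw [hzw, h.subst_add_left heven hcw hcx]
  have b2 : Φ.subst x z = Φ.subst x w := by rw [hzw, h.subst_add_right heven hcx hcw]
  have H1 := h.hexagon_eq x y
  -- The hexagon is used at `(x, y)` and at `(w, y)`; both involve the triple `x, y, w` of sum zero,
  -- in the two cyclic orders.
  have H2 := h.hexagon_eq w y
  have hx' : -w - y = x := by rw [hw]; abel
  rw [hx'] at H2
  rw [← hw] at H1
  have a1 := h.subst_mul_subst x y
  have a2 := h.subst_mul_subst y x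
  have c1 := h.subst_mul_subst y w
  have c2 := h.subst_mul_subst w y
  have S2 : (PowerSeries.C s : R⟦X⟧) * PowerSeries.C s = 1 := by rw [← map_mul, hs, map_one]
  have m1 := Φ.C_mul_subst (s := s) hy hx
  have m2 := Φ.C_mul_subst (s := s) hx hy
  have m3 := C_mul_expH lam hy
  have m4 := C_mul_expH (lam / 2) hx
  have ee1 := expH_mul_neg (lam / 2) y
  have ee2 := expH_neg_mul (lam / 2) y
  have ez : expH lam z = expH (lam / 2) w * expH (lam / 2) w * expH lam c := by
    rw [expH_half, hzw, expH_add lam hcw]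
  have hcc1 : Commute (expH lam c) (Φ.subst x z) := by
    rw [b2]; exact expH_mul_subst_comm _ _ hcx.symm hcw.symm
  have hcc2 : Commute (expH lam c) (expH (lam / 2) x) :=
    expH_commute lam (C_mul_expH (lam / 2) hcx.symm.eq)
  have hcc3 : Commute (expH lam c) (Φ.subst y x) := expH_mul_subst_comm _ _ hcy.symm hcx.symm
  have final : expH lam (x + z) = expH lam (-y) * expH lam c := by
    rw [← expH_add lam hcy.neg_left]
    congr 1; rw [hc]; abel
  have ey : expH (lam / 2) (-y) * expH (lam / 2) (-y) = expH lam (-y) := expH_half _ _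
  have G1 : expH (lam / 2) x * Φ.subst z x * expH (lam / 2) w =
      Φ.subst y x * expH (lam / 2) (-y) * Φ.subst w y := by
    rw [b1]
    have : expH (lam / 2) x * Φ.subst w x * expH (lam / 2) w *
      (Φ.subst y w * expH (lam / 2) y * Φ.subst x y) = 1 := by simpa only [mul_assoc] using H1
    refine left_inv_eq_right_inv this ?_
    calc Φ.subst y w * expH (lam / 2) y * Φ.subst x y *
          (Φ.subst y x * expH (lam / 2) (-y) * Φ.subst w y)
        = Φ.subst y w * (expH (lam / 2) y * (Φ.subst x y * Φ.subst y x) * expH (lam / 2) (-y)) *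
          Φ.subst w y := by simp only [mul_assoc]
      _ = 1 := by rw [a1, mul_one, ee1, mul_one, c1]
  have G2 : expH (lam / 2) w * Φ.subst x z * expH (lam / 2) x =
      Φ.subst y w * expH (lam / 2) (-y) * Φ.subst x y := by
    rw [b2]
    have : expH (lam / 2) w * Φ.subst x w * expH (lam / 2) x *
      (Φ.subst y x * expH (lam / 2) y * Φ.subst w y) = 1 := by simpa only [mul_assoc] using H2
    refine left_inv_eq_right_inv this ?_
    calc Φ.subst y x * expH (lam / 2) y * Φ.subst w y *
          (Φ.subst y w * expH (lam / 2) (-y) * Φ.subst x y)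
        = Φ.subst y x * (expH (lam / 2) y * (Φ.subst w y * Φ.subst y w) * expH (lam / 2) (-y)) *
          Φ.subst x y := by simp only [mul_assoc]
      _ = 1 := by rw [c2, mul_one, ee1, mul_one, a2]
  -- Carrying one `s` through to the other replaces `y` by `z` and fixes `x`. Then `e^{λz}` splits
  -- as `e^{λw/2} e^{λw/2} e^{λc}`, one half for each hexagon.
  have conj : PowerSeries.C s * expH (lam / 2) x * Φ.subst y x * expH lam y * Φ.subst x y *
      PowerSeries.C s = expH (lam / 2) x * Φ.subst z x * expH lam z * Φ.subst x z := by
    calc _ = (PowerSeries.C s * expH (lam / 2) x) * Φ.subst y x * expH lam y * Φ.subst x y *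
            PowerSeries.C s := by simp only [mul_assoc]
      _ = expH (lam / 2) x * (PowerSeries.C s * Φ.subst y x) * expH lam y * Φ.subst x y *
            PowerSeries.C s := by rw [m4]; simp only [mul_assoc]
      _ = expH (lam / 2) x * Φ.subst z x * (PowerSeries.C s * expH lam y) * Φ.subst x y *
            PowerSeries.C s := by rw [m1]; simp only [mul_assoc]
      _ = expH (lam / 2) x * Φ.subst z x * expH lam z * (PowerSeries.C s * Φ.subst x y) *
            PowerSeries.C s := by rw [m3]; simp only [mul_assoc]
      _ = expH (lam / 2) x * Φ.subst z x * expH lam z * Φ.subst x z *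
            (PowerSeries.C s * PowerSeries.C s) := by rw [m2]; simp only [mul_assoc]
      _ = _ := by rw [S2, mul_one]
  calc braidSeries lam Φ s x y * expH lam y * braidSeries lam Φ s x y
      = Φ.subst x y * (PowerSeries.C s * expH (lam / 2) x * Φ.subst y x * expH lam y *
          Φ.subst x y * PowerSeries.C s) * expH (lam / 2) x * Φ.subst y x := by
        simp only [braidSeries, mul_assoc]
    _ = Φ.subst x y * (expH (lam / 2) x * Φ.subst z x * expH (lam / 2) w) *
          (expH (lam / 2) w * (expH lam c * Φ.subst x z) * expH (lam / 2) x * Φ.subst y x) := by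
        rw [conj, ez]; simp only [mul_assoc]
    _ = Φ.subst x y * (expH (lam / 2) x * Φ.subst z x * expH (lam / 2) w) *
          (expH (lam / 2) w * Φ.subst x z * (expH lam c * expH (lam / 2) x) * Φ.subst y x) := by
        rw [hcc1.eq]; simp only [mul_assoc]
    _ = Φ.subst x y * (expH (lam / 2) x * Φ.subst z x * expH (lam / 2) w) *
          (expH (lam / 2) w * Φ.subst x z * expH (lam / 2) x) * (expH lam c * Φ.subst y x) := by
        rw [hcc2.eq]; simp only [mul_assoc]
    _ = Φ.subst x y * Φ.subst y x * expH (lam / 2) (-y) * (Φ.subst w y * Φ.subst y w) *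
          expH (lam / 2) (-y) * (Φ.subst x y * Φ.subst y x) * expH lam c := by
        rw [hcc3.eq, G1, G2]; simp only [mul_assoc]
    _ = expH lam (x + z) := by rw [a1, c2, one_mul, mul_one, mul_one, ey, final]

end

/-! ### The antipode -/

section
variable {k : Type*} [Field k] {R : Type*} [Ring R] [Algebra k R]

theorem NCSeries.coeff_subst (Φ : NCSeries k) (g : Fin 2 → R) (n : ℕ) :
    PowerSeries.coeff n (Φ.subst (g 0) (g 1)) =
      ∑ w : Fin n → Fin 2, Φ (List.ofFn w) • ((List.ofFn w).map g).prod := by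
  simp only [NCSeries.subst, PowerSeries.coeff_mk]
  refine Finset.sum_congr rfl fun w _ => ?_
  rw [List.map_ofFn]
  congr 3
  funext i
  simp only [Function.comp_apply]
  generalize w i = a
  fin_cases a <;> rfl

theorem NCSeries.coeff_substRev (Φ : NCSeries k) (g : Fin 2 → R) (n : ℕ) :
    PowerSeries.coeff n (Φ.substRev (g 0) (g 1)) =
      ∑ w : Fin n → Fin 2, Φ (List.ofFn w) • ((List.ofFn w).map g).reverse.prod := by
  simp only [NCSeries.substRev, PowerSeries.coeff_mk]
  refine Finset.sum_congr rfl fun w _ => ?_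
  rw [List.map_ofFn]
  congr 4
  funext i
  simp only [Function.comp_apply]
  generalize w i = a
  fin_cases a <;> rfl

/-- The antipode of `k⟨x, y⟩`. -/
def antipodeMap (k : Type*) [Field k] : FreeAlgebra k (Fin 2) →ₗ[k] FreeAlgebra k (Fin 2) :=
  (MulOpposite.opLinearEquiv k).symm.toLinearMap ∘ₗ
    (FreeAlgebra.lift k fun i : Fin 2 => MulOpposite.op (-FreeAlgebra.ι k i)).toLinearMap

theorem antipodeMap_mul (a b : FreeAlgebra k (Fin 2)) :
    antipodeMap k (a * b) = antipodeMap k b * antipodeMap k a := by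
  simp [antipodeMap]

theorem antipodeMap_one : antipodeMap k 1 = 1 := by
  simp [antipodeMap]

theorem antipodeMap_ι (i : Fin 2) : antipodeMap k (FreeAlgebra.ι k i) = -FreeAlgebra.ι k i := by
  simp [antipodeMap]

theorem antipodeMap_prod (l : List (Fin 2)) :
    antipodeMap k (l.map (FreeAlgebra.ι k)).prod =
      (-1 : k) ^ l.length • (l.map (FreeAlgebra.ι k)).reverse.prod := by
  induction l with
  | nil => simp [antipodeMap_one]
  | cons i l ih =>
    rw [List.map_cons, List.prod_cons, antipodeMap_mul, ih, antipodeMap_ι, List.reverse_cons,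
      List.prod_append, List.prod_singleton, List.length_cons, pow_succ, mul_smul, smul_mul_assoc,
      mul_neg, neg_one_smul]

/-- The map `a ⊗ b ↦ S(a) b`. -/
def antipodeMul (k : Type*) [Field k] :
    FreeAlgebra k (Fin 2) ⊗[k] FreeAlgebra k (Fin 2) →ₗ[k] FreeAlgebra k (Fin 2) :=
  TensorProduct.lift ((LinearMap.mul k (FreeAlgebra k (Fin 2))).comp (antipodeMap k))

theorem antipodeMul_tmul (a b : FreeAlgebra k (Fin 2)) :
    antipodeMul k (a ⊗ₜ[k] b) = antipodeMap k a * b := by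
  simp [antipodeMul]

/-- The two terms cancel: `S(x a) b = -S(a) x b`. So `a ⊗ b ↦ S(a) b` kills every nonempty word in
the primitive elements, which is the counit identity needed below. -/
theorem antipodeMul_primitive_mul (i : Fin 2)
    (Z : FreeAlgebra k (Fin 2) ⊗[k] FreeAlgebra k (Fin 2)) :
    antipodeMul k ((FreeAlgebra.ι k i ⊗ₜ[k] 1 + 1 ⊗ₜ[k] FreeAlgebra.ι k i) * Z) = 0 := by
  induction Z using TensorProduct.induction_on with
  | zero => simp
  | tmul a b =>
    rw [add_mul, Algebra.TensorProduct.tmul_mul_tmul, Algebra.TensorProduct.tmul_mul_tmul, map_add,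
      antipodeMul_tmul, antipodeMul_tmul, antipodeMap_mul, antipodeMap_ι]
    simp [mul_assoc]
  | add a b ha hb => rw [mul_add, map_add, ha, hb, add_zero]

theorem antipodeMul_primitive_prod (l : List (Fin 2)) :
    antipodeMul k (l.map fun i =>
      FreeAlgebra.ι k i ⊗ₜ[k] 1 + 1 ⊗ₜ[k] FreeAlgebra.ι k i).prod = if l = [] then 1 else 0 := by
  cases l with
  | nil => simp [Algebra.TensorProduct.one_def, antipodeMul_tmul, antipodeMap_one]
  | cons i l =>
    rw [List.map_cons, List.prod_cons, antipodeMul_primitive_mul, if_neg (List.cons_ne_nil _ _)]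

/-- The antipode reverses words and multiplies by `(-1)^n`; evenness absorbs the sign. -/
theorem NCSeries.antipodeMap_coeff_subst {Φ : NCSeries k} (heven : Φ.bar = Φ) (n : ℕ) :
    antipodeMap k (PowerSeries.coeff n (Φ.subst (FreeAlgebra.ι k (0 : Fin 2)) (FreeAlgebra.ι k (1 : Fin 2)))) =
      PowerSeries.coeff n (Φ.substRev (FreeAlgebra.ι k (0 : Fin 2)) (FreeAlgebra.ι k (1 : Fin 2))) := by
  rw [NCSeries.coeff_subst, NCSeries.coeff_substRev, map_sum]
  refine Finset.sum_congr rfl fun w _ => ?_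
  rw [map_smul, antipodeMap_prod, smul_smul]
  congr 1
  nth_rewrite 2 [← heven]
  rw [NCSeries.bar, mul_comm]

theorem antipodeMul_mul (a b : FreeAlgebra k (Fin 2)) :
    antipodeMul k ((a ⊗ₜ[k] 1) * (1 ⊗ₜ[k] b)) = antipodeMap k a * b := by
  rw [Algebra.TensorProduct.tmul_mul_tmul, mul_one, one_mul, antipodeMul_tmul]

variable {lam : k} {Φ : NCSeries k}

/-- Apply `a ⊗ b ↦ S(a) b` to the group-like equation: one side becomes the constant term of `Φ`,
the other `S(Φ) Φ`. -/
theorem IsAssociator.substRev_mul (h : IsAssociator lam Φ) (heven : Φ.bar = Φ) :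
    Φ.substRev (FreeAlgebra.ι k (0 : Fin 2)) (FreeAlgebra.ι k (1 : Fin 2)) *
      Φ.subst (FreeAlgebra.ι k (0 : Fin 2)) (FreeAlgebra.ι k (1 : Fin 2)) = 1 := by
  ext1 n
  have hg := congrArg (fun f => antipodeMul k (PowerSeries.coeff n f)) h.grouplike
  beta_reduce at hg
  rw [NCSeries.coeff_subst Φ (fun i : Fin 2 => FreeAlgebra.ι k i ⊗ₜ[k] (1 : FreeAlgebra k (Fin 2))
    + (1 : FreeAlgebra k (Fin 2)) ⊗ₜ[k] FreeAlgebra.ι k i), map_sum] at hg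
  simp only [map_smul, antipodeMul_primitive_prod] at hg
  have hl : Φ.subst (FreeAlgebra.ι k (0 : Fin 2) ⊗ₜ[k] (1 : FreeAlgebra k (Fin 2)))
      (FreeAlgebra.ι k (1 : Fin 2) ⊗ₜ[k] (1 : FreeAlgebra k (Fin 2))) =
      PowerSeries.map ((Algebra.TensorProduct.includeLeft :
        FreeAlgebra k (Fin 2) →ₐ[k] FreeAlgebra k (Fin 2) ⊗[k] FreeAlgebra k (Fin 2)) :
        FreeAlgebra k (Fin 2) →+* FreeAlgebra k (Fin 2) ⊗[k] FreeAlgebra k (Fin 2))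
        (Φ.subst (FreeAlgebra.ι k (0 : Fin 2)) (FreeAlgebra.ι k (1 : Fin 2))) := by
    rw [NCSeries.map_subst]; rfl
  have hr : Φ.subst ((1 : FreeAlgebra k (Fin 2)) ⊗ₜ[k] FreeAlgebra.ι k (0 : Fin 2))
      ((1 : FreeAlgebra k (Fin 2)) ⊗ₜ[k] FreeAlgebra.ι k (1 : Fin 2)) =
      PowerSeries.map ((Algebra.TensorProduct.includeRight :
        FreeAlgebra k (Fin 2) →ₐ[k] FreeAlgebra k (Fin 2) ⊗[k] FreeAlgebra k (Fin 2)) :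
        FreeAlgebra k (Fin 2) →+* FreeAlgebra k (Fin 2) ⊗[k] FreeAlgebra k (Fin 2))
        (Φ.subst (FreeAlgebra.ι k (0 : Fin 2)) (FreeAlgebra.ι k (1 : Fin 2))) := by
    rw [NCSeries.map_subst]; rfl
  rw [hl, hr, PowerSeries.coeff_mul, map_sum] at hg
  rw [PowerSeries.coeff_mul]
  refine Eq.trans (Finset.sum_congr rfl fun p _ => ?_) (hg.symm.trans ?_)
  · rw [PowerSeries.coeff_map, PowerSeries.coeff_map, ← NCSeries.antipodeMap_coeff_subst heven]
    exact (antipodeMul_mul _ _).symm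
  · rcases n with _ | n
    · simp [h.nil]
    · simp [PowerSeries.coeff_one]

/-- The reversed series and `Φ(y, x)` are both inverse to `Φ(x, y)`. -/
theorem IsAssociator.substRev_eq (h : IsAssociator lam Φ) (heven : Φ.bar = Φ) (u v : R) :
    Φ.substRev u v = Φ.subst v u := by
  have h1 : Φ.substRev (FreeAlgebra.ι k (0 : Fin 2)) (FreeAlgebra.ι k (1 : Fin 2)) =
      Φ.subst (FreeAlgebra.ι k (1 : Fin 2)) (FreeAlgebra.ι k (0 : Fin 2)) :=
    left_inv_eq_right_inv (h.substRev_mul heven) h.inverse.2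
  have := congrArg (PowerSeries.map (letterHom k u v : FreeAlgebra k (Fin 2) →+* R)) h1
  simpa only [NCSeries.map_substRev, NCSeries.map_subst, letterHom_zero, letterHom_one] using this

end

/-! ### Matrices of power series -/

section
variable {k : Type*} [Field k] {N : Type*} [Fintype N] [DecidableEq N]

/-- A power series with matrix coefficients, as a matrix of Laurent series. -/
def toLaurentMatrix (N : Type*) [Fintype N] [DecidableEq N] :
    (Matrix N N k)⟦X⟧ →+* Matrix N N (LaurentSeries k) where
  toFun f := Matrix.of fun i j =>
    ((PowerSeries.mk fun n => PowerSeries.coeff n f i j : k⟦X⟧) : LaurentSeries k)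
  map_one' := by
    ext1 i j
    have h : (PowerSeries.mk fun n => PowerSeries.coeff n (1 : (Matrix N N k)⟦X⟧) i j) =
        if i = j then (1 : k⟦X⟧) else 0 := by
      ext n
      rw [PowerSeries.coeff_mk, PowerSeries.coeff_one, apply_ite (PowerSeries.coeff n),
        PowerSeries.coeff_one, map_zero]
      by_cases hn : n = 0
      · rw [if_pos hn, if_pos hn, Matrix.one_apply]
      · rw [if_neg hn, if_neg hn, Matrix.zero_apply, ite_self]
    rw [Matrix.of_apply, Matrix.one_apply, h]
    split_ifs
    · exact PowerSeries.coe_one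
    · exact PowerSeries.coe_zero
  map_zero' := by
    ext1 i j
    rw [Matrix.of_apply, Matrix.zero_apply, ← PowerSeries.coe_zero]
    congr 1
  map_add' f g := by
    ext1 i j
    rw [Matrix.add_apply, Matrix.of_apply, Matrix.of_apply, Matrix.of_apply, ← PowerSeries.coe_add]
    congr 1
  map_mul' f g := by
    ext1 i j
    rw [Matrix.mul_apply, Matrix.of_apply]
    simp only [Matrix.of_apply, ← PowerSeries.coe_mul]
    rw [← map_sum (HahnSeries.ofPowerSeries ℤ k)]
    congr 1
    ext n
    simp only [PowerSeries.coeff_mk, PowerSeries.coeff_mul, map_sum, Matrix.sum_apply,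
      Matrix.mul_apply]
    rw [Finset.sum_comm]

theorem toLaurentMatrix_apply (f : (Matrix N N k)⟦X⟧) (i j : N) :
    toLaurentMatrix N f i j =
      ((PowerSeries.mk fun n => PowerSeries.coeff n f i j : k⟦X⟧) : LaurentSeries k) := rfl

theorem toLaurentMatrix_transpose {f g : (Matrix N N k)⟦X⟧}
    (h : ∀ n, (PowerSeries.coeff n f).transpose = PowerSeries.coeff n g) :
    (toLaurentMatrix N f).transpose = toLaurentMatrix N g := by
  ext1 i j
  rw [Matrix.transpose_apply, toLaurentMatrix_apply, toLaurentMatrix_apply]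
  congr 2
  funext n
  rw [← h]; rfl

theorem NCSeries.transpose_coeff_subst (Φ : NCSeries k) {u v : Matrix N N k}
    (hu : u.transpose = u) (hv : v.transpose = v) (n : ℕ) :
    (PowerSeries.coeff n (Φ.subst u v)).transpose = PowerSeries.coeff n (Φ.substRev u v) := by
  simp only [NCSeries.subst, NCSeries.substRev, PowerSeries.coeff_mk, Matrix.transpose_sum,
    Matrix.transpose_smul, Matrix.transpose_list_prod, List.map_ofFn]
  refine Finset.sum_congr rfl fun w _ => ?_
  congr 4
  funext i
  simp only [Function.comp_apply]
  generalize w i = a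
  fin_cases a
  · exact hu
  · exact hv

theorem transpose_coeff_expH (c : k) {a : Matrix N N k} (ha : a.transpose = a) (n : ℕ) :
    (PowerSeries.coeff n (expH c a)).transpose = PowerSeries.coeff n (expH c a) := by
  simp only [expH, PowerSeries.coeff_mk, Matrix.transpose_smul, Matrix.transpose_pow, ha]

variable {lam : k} {Φ : NCSeries k}

theorem IsAssociator.transpose_braidSeries (h : IsAssociator lam Φ) (heven : Φ.bar = Φ)
    {s x y : Matrix N N k} (hs : s.transpose = s) (hx : x.transpose = x) (hy : y.transpose = y)
    (hsx : s * x = x * s) :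
    (toLaurentMatrix N (braidSeries lam Φ s x y)).transpose =
      toLaurentMatrix N (braidSeries lam Φ s x y) := by
  have e1 : (toLaurentMatrix N (Φ.subst x y)).transpose = toLaurentMatrix N (Φ.subst y x) :=
    toLaurentMatrix_transpose fun n => by
      rw [Φ.transpose_coeff_subst hx hy, h.substRev_eq heven]
  have e2 : (toLaurentMatrix N (Φ.subst y x)).transpose = toLaurentMatrix N (Φ.subst x y) := by
    rw [← e1, Matrix.transpose_transpose]
  have e3 : (toLaurentMatrix N (expH (lam / 2) x)).transpose =
      toLaurentMatrix N (expH (lam / 2) x) :=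
    toLaurentMatrix_transpose fun n => transpose_coeff_expH _ hx n
  have e4 : (toLaurentMatrix N (PowerSeries.C s)).transpose =
      toLaurentMatrix N (PowerSeries.C s) :=
    toLaurentMatrix_transpose fun n => by
      rw [PowerSeries.coeff_C]
      split_ifs
      · exact hs
      · exact Matrix.transpose_zero
  have e5 := congrArg (toLaurentMatrix N) (C_mul_expH (lam / 2) hsx)
  rw [map_mul, map_mul] at e5
  simp only [braidSeries, map_mul, Matrix.transpose_mul, e1, e2, e3, e4]
  simp only [mul_assoc]
  rw [← mul_assoc (toLaurentMatrix N (expH (lam / 2) x)), ← e5, mul_assoc]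

end

/-! ### Young's orthonormal model -/

section
variable {k : Type*} [Field k]

/-- The diagonal coefficients of Young's orthonormal model. -/
def youngDiag (k : Type*) [Field k] (d : ℤ) : k := -(d : k)⁻¹

/-- The off-diagonal coefficients of Young's orthonormal model. -/
def youngOff (s : ℕ → k) (d : ℤ) : k := if 2 ≤ d.natAbs then s d.natAbs / d.natAbs else 0

theorem youngOrthonormal_eq (s : ℕ → k) (d : ℕ) (hd : 2 ≤ d) :
    youngOrthonormal s d =
      !![youngDiag k d, youngOff s d; youngOff s d, youngDiag k (-(d : ℤ))] := by
  ext i j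
  fin_cases i <;> fin_cases j <;>
  simp [youngOrthonormal, youngDiag, youngOff, hd, div_eq_inv_mul]

theorem natAbs_cast_sq (d : ℤ) : ((d.natAbs : ℕ) : k) ^ 2 = (d : k) ^ 2 := by
  have := congrArg (Int.cast : ℤ → k) (Int.natAbs_sq d)
  rwa [Int.cast_pow, Int.cast_pow, Int.cast_natCast] at this

variable [CharZero k]

theorem natAbs_eq_one_of_lt {d : ℤ} (hd : d ≠ 0) (h : ¬ 2 ≤ d.natAbs) : d = 1 ∨ d = -1 := by
  omega

theorem sq_sub_one_ne_zero {d : ℕ} (hd : 2 ≤ d) : (d : k) ^ 2 - 1 ≠ 0 := by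
  obtain ⟨e, rfl⟩ := Nat.exists_eq_add_of_le hd
  have : ((2 + e : ℕ) : k) ^ 2 - 1 = (((e + 1) * (e + 3) : ℕ) : k) := by push_cast; ring
  rw [this]
  exact_mod_cast (by positivity : (e + 1) * (e + 3) ≠ 0)

theorem root_ne_zero {s : ℕ → k} (hs : ∀ d : ℕ, 2 ≤ d → s d ^ 2 = (d : k) ^ 2 - 1) {d : ℕ}
    (hd : 2 ≤ d) : s d ≠ 0 := by
  intro h
  have := hs d hd
  rw [h] at this
  exact sq_sub_one_ne_zero (k := k) hd (by rw [← this]; ring)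

theorem isSeminormal_young {s : ℕ → k} (hs : ∀ d : ℕ, 2 ≤ d → s d ^ 2 = (d : k) ^ 2 - 1) :
    IsSeminormal (1 : k) (fun c => (c : k)) (youngDiag k) (youngOff s) where
  q_ne := one_ne_zero
  inj := Int.cast_injective
  zero := Int.cast_zero
  diag x y hxy := by
    have : ((x - y : ℤ) : k) ≠ 0 := by exact_mod_cast sub_ne_zero.2 hxy
    rw [youngDiag]
    push_cast at this ⊢
    field_simp
    ring
  symm d := by simp [youngOff]
  sq d hd := by
    have h0 : (d : k) ≠ 0 := by exact_mod_cast hd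
    rw [youngOff, youngDiag, youngDiag]
    split_ifs with h
    · rw [div_pow, hs _ h, natAbs_cast_sq]
      push_cast
      field_simp
      ring
    · rcases natAbs_eq_one_of_lt hd h with rfl | rfl <;> simp
  diag_one := by simp [youngDiag]
  diag_neg_one := by simp [youngDiag]
  off_one := by simp [youngOff]
  off_ne d hd := by
    have h2 : 2 ≤ d.natAbs := by omega
    rw [youngOff, if_pos h2]
    exact div_ne_zero (root_ne_zero hs h2) (by exact_mod_cast (by omega : d.natAbs ≠ 0))

end

/-! ### The Hecke model -/

section
variable {F : Type*} [Field F] {q : F}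

/-- The eigenvalues of the Jucys-Murphy elements. -/
def heckeContent (q : F) (c : ℤ) : F := (q ^ (2 * c) - 1) / (q - q⁻¹)

/-- The diagonal coefficients of the Hecke model. -/
def heckeDiag (q : F) (d : ℤ) : F := -(q - q⁻¹) / (q ^ (2 * d) - 1)

/-- The off-diagonal coefficients of the Hecke model. -/
def heckeOff (q : F) (b : ℕ → F) (d : ℤ) : F :=
  if 2 ≤ d.natAbs then (qInt q d.natAbs)⁻¹ * b d.natAbs else 0

theorem sub_inv_ne_zero (h0 : q ≠ 0) (hq : ∀ n : ℤ, n ≠ 0 → q ^ n ≠ 1) : q - q⁻¹ ≠ 0 := by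
  intro h
  apply hq 2 two_ne_zero
  have h1 : q = q⁻¹ := sub_eq_zero.1 h
  rw [zpow_two]
  nth_rewrite 2 [h1]
  exact mul_inv_cancel₀ h0

theorem zpow_sub_one_ne_zero (hq : ∀ n : ℤ, n ≠ 0 → q ^ n ≠ 1) {d : ℤ} (hd : d ≠ 0) :
    q ^ (2 * d) - 1 ≠ 0 := sub_ne_zero.2 (hq _ (by omega))

theorem qInt_eq (h0 : q ≠ 0) (n : ℕ) :
    qInt q n = (q ^ (2 * (n : ℤ)) - 1) / (q ^ n * (q - q⁻¹)) := by
  have h1 : q ^ n ≠ 0 := pow_ne_zero _ h0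
  rw [qInt, zpow_mul, zpow_natCast, zpow_ofNat, ← pow_mul, mul_comm 2 n, pow_mul,
    ← div_div]
  congr 1
  field_simp

theorem qInt_ne_zero (h0 : q ≠ 0) (hq : ∀ n : ℤ, n ≠ 0 → q ^ n ≠ 1) {n : ℕ} (hn : n ≠ 0) :
    qInt q n ≠ 0 := by
  rw [qInt_eq h0]
  exact div_ne_zero (zpow_sub_one_ne_zero hq (by exact_mod_cast hn))
    (mul_ne_zero (pow_ne_zero _ h0) (sub_inv_ne_zero h0 hq))

/-- The quantum analogue of `(d + 1)(d - 1) = d² - 1`; it turns the square of the prescribed root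
into `1 + A d * A (-d)`. -/
theorem qInt_mul (h0 : q ≠ 0) (hq : ∀ n : ℤ, n ≠ 0 → q ^ n ≠ 1) {d : ℕ} (hd : 1 ≤ d) :
    qInt q (d + 1) * qInt q (d - 1) = qInt q d ^ 2 - 1 := by
  obtain ⟨e, rfl⟩ := Nat.exists_eq_add_of_le' hd
  have h1 := sub_inv_ne_zero h0 hq
  have h2 : q ^ e ≠ 0 := pow_ne_zero _ h0
  simp only [qInt, Nat.add_sub_cancel]
  rw [div_mul_div_comm, div_pow, div_sub_one (pow_ne_zero 2 h1), sq (q - q⁻¹)]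
  congr 1
  rw [pow_succ, pow_succ]
  field_simp
  ring

theorem heckeDiag_natCast (h0 : q ≠ 0) (hq : ∀ n : ℤ, n ≠ 0 → q ^ n ≠ 1) {d : ℕ} (hd : d ≠ 0) :
    heckeDiag q d = (qInt q d)⁻¹ * -(q ^ d)⁻¹ := by
  have h1 := sub_inv_ne_zero h0 hq
  have h2 : q ^ d ≠ 0 := pow_ne_zero _ h0
  have h3 := zpow_sub_one_ne_zero hq (d := d) (by exact_mod_cast hd)
  rw [qInt_eq h0, heckeDiag, inv_div]
  generalize q - q⁻¹ = κ at *
  field_simp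

theorem heckeDiag_neg_natCast (h0 : q ≠ 0) (hq : ∀ n : ℤ, n ≠ 0 → q ^ n ≠ 1) {d : ℕ}
    (hd : d ≠ 0) : heckeDiag q (-(d : ℤ)) = (qInt q d)⁻¹ * q ^ d := by
  have h1 := sub_inv_ne_zero h0 hq
  have h2 : q ^ d ≠ 0 := pow_ne_zero _ h0
  have h3 := zpow_sub_one_ne_zero hq (d := d) (by exact_mod_cast hd)
  have h5 := zpow_sub_one_ne_zero hq (d := -(d : ℤ)) (by simpa using hd)
  have h4 : q ^ (2 * -(d : ℤ)) = (q ^ d * q ^ d)⁻¹ := by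
    rw [mul_neg, zpow_neg, two_mul, zpow_add₀ h0, zpow_natCast]
  have h4' : q ^ (2 * (d : ℤ)) = q ^ d * q ^ d := by
    rw [two_mul, zpow_add₀ h0, zpow_natCast]
  rw [qInt_eq h0, heckeDiag, inv_div, div_mul_eq_mul_div, div_eq_div_iff h5 h3]
  rw [h4, h4']
  generalize q - q⁻¹ = κ at *
  field_simp
  ring

theorem isSeminormal_hecke (h0 : q ≠ 0) (hq : ∀ n : ℤ, n ≠ 0 → q ^ n ≠ 1) {b : ℕ → F}
    (hb : ∀ d : ℕ, 2 ≤ d → b d ^ 2 = qInt q (d + 1) * qInt q (d - 1)) :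
    IsSeminormal q (heckeContent q) (heckeDiag q) (heckeOff q b) := by
  have hκ := sub_inv_ne_zero h0 hq
  have hdd : ∀ d : ℕ, d ≠ 0 → heckeDiag q d * heckeDiag q (-(d : ℤ)) = -(qInt q d ^ 2)⁻¹ := by
    intro d hd
    have h1 := qInt_ne_zero h0 hq hd
    have h2 : q ^ d ≠ 0 := pow_ne_zero _ h0
    rw [heckeDiag_natCast h0 hq hd, heckeDiag_neg_natCast h0 hq hd]
    field_simp
  refine ⟨h0, fun x y hxy => ?_, ?_, fun x y hxy => ?_, fun d => ?_, fun d hd => ?_, ?_, ?_, ?_,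
    fun d hd => ?_⟩
  · have h1 : q ^ (2 * x) = q ^ (2 * y) := by
      have := (div_left_inj' hκ).1 hxy
      linear_combination this
    by_contra hne
    apply hq (2 * x - 2 * y) (by omega)
    rw [zpow_sub₀ h0, h1, div_self (zpow_ne_zero _ h0)]
  · simp [heckeContent]
  · have h1 := zpow_sub_one_ne_zero hq (d := x - y) (sub_ne_zero.2 hxy)
    have h2 : q ^ (2 * y) ≠ 0 := zpow_ne_zero _ h0
    rw [heckeDiag, heckeContent, heckeContent]
    have e : q ^ (2 * (x - y)) = q ^ (2 * x) / q ^ (2 * y) := by rw [mul_sub, zpow_sub₀ h0]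
    rw [e] at h1 ⊢
    generalize q - q⁻¹ = κ at *
    generalize q ^ (2 * x) = u at *
    generalize q ^ (2 * y) = v at *
    have h3 : u - v ≠ 0 := fun h => h1 (by rw [sub_eq_zero.1 h, div_self h2, sub_self])
    field_simp
    ring
  · simp [heckeOff]
  · have key : ∀ d : ℕ, d ≠ 0 → heckeOff q b d ^ 2 = 1 + heckeDiag q d * heckeDiag q (-(d : ℤ)) := by
      intro d hd
      have h1 := qInt_ne_zero h0 hq hd
      rw [hdd d hd, heckeOff, Int.natAbs_natCast]
      split_ifs with h
      · rw [mul_pow, hb d h, qInt_mul h0 hq (by omega)]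
        field_simp
        ring
      · obtain rfl : d = 1 := by omega
        have : qInt q 1 = 1 := by rw [qInt, pow_one, div_self hκ]
        rw [this]; ring
    rcases Int.natAbs_eq d with h | h
    · rw [h]; exact key _ (by omega)
    · have h1 := key d.natAbs (by omega)
      have h2 : heckeOff q b d = heckeOff q b (d.natAbs : ℤ) := by
        simp only [heckeOff, Int.natAbs_natCast]
      rw [h2, h1]
      have h3 : -d = (d.natAbs : ℤ) := by omega
      have h4 : -(d.natAbs : ℤ) = d := by omega
      rw [h3, h4, mul_comm]
  · have := heckeDiag_natCast h0 hq one_ne_zero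
    have h1 : qInt q 1 = 1 := by rw [qInt, pow_one, div_self hκ]
    rw [h1] at this
    simpa using this
  · have := heckeDiag_neg_natCast h0 hq one_ne_zero
    have h1 : qInt q 1 = 1 := by rw [qInt, pow_one, div_self hκ]
    rw [h1] at this
    simpa using this
  · simp [heckeOff]
  · have h2 : 2 ≤ d.natAbs := by omega
    rw [heckeOff, if_pos h2]
    refine mul_ne_zero (inv_ne_zero (qInt_ne_zero h0 hq (by omega))) fun h => ?_
    have := hb _ h2
    rw [h, zero_pow two_ne_zero] at this
    exact mul_ne_zero (qInt_ne_zero h0 hq (by omega)) (qInt_ne_zero h0 hq (by omega)) this.symm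

theorem heckeModel_eq (h0 : q ≠ 0) (hq : ∀ n : ℤ, n ≠ 0 → q ^ n ≠ 1) (b : ℕ → F) (d : ℕ)
    (hd : 2 ≤ d) : heckeModel q b d =
      !![heckeDiag q d, heckeOff q b d; heckeOff q b d, heckeDiag q (-(d : ℤ))] := by
  rw [heckeDiag_natCast h0 hq (by omega), heckeDiag_neg_natCast h0 hq (by omega), heckeOff,
    Int.natAbs_natCast, if_pos hd, heckeModel, Matrix.smul_of]
  ext i j
  fin_cases i <;> fin_cases j <;> simp

end

/-! ### Power series in `h` -/

section
variable {k : Type*} [Field k] (lam : k)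

theorem qExp_eq_expH : qExp lam = ((expH lam (1 : k) : k⟦X⟧) : LaurentSeries k) := by
  simp [qExp, expH]

variable [CharZero k]

theorem qExp_ne_zero : qExp lam ≠ 0 := by
  rw [qExp_eq_expH]
  intro h
  have h1 := congrArg (fun x => x * ((expH lam (-1 : k) : k⟦X⟧) : LaurentSeries k)) h
  simp only [zero_mul, ← PowerSeries.coe_mul, expH_mul_neg, PowerSeries.coe_one] at h1
  exact one_ne_zero h1

theorem qExp_pow (n : ℕ) :
    qExp lam ^ n = ((expH lam (n : k) : k⟦X⟧) : LaurentSeries k) := by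
  induction n with
  | zero => rw [pow_zero, Nat.cast_zero, expH_zero, PowerSeries.coe_one]
  | succ n ih =>
    rw [pow_succ, ih, qExp_eq_expH, ← PowerSeries.coe_mul, ← expH_add _ (Commute.all _ _),
      Nat.cast_succ]

theorem qExp_zpow (n : ℤ) :
    qExp lam ^ n = ((expH lam (n : k) : k⟦X⟧) : LaurentSeries k) := by
  rcases n.eq_nat_or_neg with ⟨n, rfl | rfl⟩
  · rw [zpow_natCast, qExp_pow, Int.cast_natCast]
  · rw [zpow_neg, zpow_natCast, qExp_pow]
    refine inv_eq_of_mul_eq_one_right ?_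
    rw [← PowerSeries.coe_mul, Int.cast_neg, Int.cast_natCast, expH_mul_neg, PowerSeries.coe_one]

variable {lam}

/-- The coefficient of `h` in `q ^ n` is `n λ`. -/
theorem qExp_zpow_ne_one (hlam : lam ≠ 0) (n : ℤ) (hn : n ≠ 0) : qExp lam ^ n ≠ 1 := by
  rw [qExp_zpow, ← PowerSeries.coe_one]
  intro h
  have h1 := congrArg (PowerSeries.coeff 1) (HahnSeries.ofPowerSeries_injective h)
  rw [PowerSeries.coeff_one, if_neg one_ne_zero] at h1
  simp only [expH, PowerSeries.coeff_mk, pow_one, Nat.factorial_one, Nat.cast_one, div_one,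
    smul_eq_mul] at h1
  exact mul_ne_zero hlam (by exact_mod_cast hn) h1

/-- The `q`-integers as power series in `h`. -/
def qIntSeries (lam : k) : ℕ → k⟦X⟧
  | 0 => 0
  | n + 1 => expH lam (1 : k) * qIntSeries lam n + expH lam (-(n : k))

theorem constantCoeff_expH (c a : k) : PowerSeries.constantCoeff (expH c a) = 1 := by
  rw [← PowerSeries.coeff_zero_eq_constantCoeff_apply]
  simp [expH]

theorem constantCoeff_qIntSeries (n : ℕ) :
    PowerSeries.constantCoeff (qIntSeries lam n) = n := by
  induction n with
  | zero => simp [qIntSeries]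
  | succ n ih => simp [qIntSeries, ih, constantCoeff_expH]

/-- The recursion `[n+1]_q = q [n]_q + q^{-n}` avoids division by `q - q⁻¹`, which is not a unit of
`k⟦h⟧`. -/
theorem coe_qIntSeries (hlam : lam ≠ 0) (n : ℕ) :
    (qIntSeries lam n : LaurentSeries k) = qInt (qExp lam) n := by
  have hκ := sub_inv_ne_zero (qExp_ne_zero lam) (qExp_zpow_ne_one hlam)
  have h0 := qExp_ne_zero lam
  induction n with
  | zero => simp [qIntSeries, qInt]
  | succ n ih =>
    have h1 : ((expH lam (-(n : k)) : k⟦X⟧) : LaurentSeries k) = (qExp lam ^ n)⁻¹ := by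
      rw [← zpow_natCast, ← zpow_neg, qExp_zpow]; simp
    rw [qIntSeries, PowerSeries.coe_add, PowerSeries.coe_mul, ih, h1, ← qExp_eq_expH, qInt, qInt,
      eq_div_iff hκ, add_mul, mul_assoc, div_mul_cancel₀ _ hκ, pow_succ]
    generalize qExp lam = q at *
    have h2 : q ^ n ≠ 0 := pow_ne_zero _ h0
    field_simp
    ring

/-- Hensel's lemma for `X² - f` at `c`, where the derivative `2c` is a unit. The only other root is
the opposite one, with constant term `-c ≠ c`. -/
theorem existsUnique_sqrt {f : k⟦X⟧} {c : k} (hc : c ≠ 0)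
    (hf : PowerSeries.constantCoeff f = c ^ 2) :
    ∃! b : k⟦X⟧, PowerSeries.constantCoeff b = c ∧ b ^ 2 = f := by
  obtain ⟨b, hb, hbc⟩ : ∃ b : k⟦X⟧, b ^ 2 = f ∧ PowerSeries.constantCoeff b = c := by
    let I : Ideal k⟦X⟧ := Ideal.span {PowerSeries.X}
    have hI : ∀ g : k⟦X⟧, g ∈ I ↔ PowerSeries.constantCoeff g = 0 := fun g => by
      rw [Ideal.mem_span_singleton, PowerSeries.X_dvd_iff]
    obtain ⟨a, ha, haI⟩ := HenselianRing.is_henselian (I := I)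
      (Polynomial.X ^ 2 - Polynomial.C f) (Polynomial.monic_X_pow_sub_C f two_ne_zero)
      (PowerSeries.C c) (by simp [hI, hf]) (by
        refine IsUnit.map _ ?_
        rw [PowerSeries.isUnit_iff_constantCoeff]
        simp [hc])
    refine ⟨a, ?_, ?_⟩
    · simpa [Polynomial.IsRoot, sub_eq_zero] using ha
    · simpa [hI, sub_eq_zero] using haI
  refine ⟨b, ⟨hbc, hb⟩, fun b' ⟨hbc', hb'⟩ => ?_⟩
  rcases sq_eq_sq_iff_eq_or_eq_neg.1 (hb'.trans hb.symm) with h | h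
  · exact h
  · have := congrArg PowerSeries.constantCoeff h
    rw [map_neg, hbc, hbc', eq_neg_iff_add_eq_zero, ← two_mul] at this
    exact absurd this (mul_ne_zero two_ne_zero hc)

theorem existsUnique_isQRoot (hlam : lam ≠ 0) {c : k} {d : ℕ} (hd : 2 ≤ d)
    (hc : c ^ 2 = (d : k) ^ 2 - 1) : ∃! b : k⟦X⟧, IsQRoot lam c d b := by
  have hc0 : c ≠ 0 := fun h => sq_sub_one_ne_zero (k := k) hd (by rw [← hc, h]; ring)
  have h1 : PowerSeries.constantCoeff (qIntSeries lam (d + 1) * qIntSeries lam (d - 1)) = c ^ 2 := by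
    rw [map_mul, constantCoeff_qIntSeries, constantCoeff_qIntSeries, hc]
    obtain ⟨e, rfl⟩ := Nat.exists_eq_add_of_le' (show 1 ≤ d by omega)
    simp only [Nat.add_sub_cancel]
    push_cast
    ring
  have h2 : ∀ b : k⟦X⟧, IsQRoot lam c d b ↔ PowerSeries.constantCoeff b = c ∧
      b ^ 2 = qIntSeries lam (d + 1) * qIntSeries lam (d - 1) := by
    intro b
    rw [IsQRoot, ← coe_qIntSeries hlam, ← coe_qIntSeries hlam, ← PowerSeries.coe_mul,
      ← PowerSeries.coe_pow]
    exact and_congr_right fun _ => HahnSeries.ofPowerSeries_injective.eq_iff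
  simp only [h2]
  exact existsUnique_sqrt hc0 h1

end

/-! ### The involution and unitarity -/

section
variable {k : Type*} [Field k]

theorem epsilon_mul (f g : LaurentSeries k) : epsilon (f * g) = epsilon f * epsilon g := by
  -- Equal supports make both Cauchy products run over the same pairs of exponents.
  have hsupp : ∀ f : LaurentSeries k, (epsilon f).support = f.support := by
    intro f
    ext n
    simp only [HahnSeries.mem_support, epsilon]
    constructor
    · exact right_ne_zero_of_mul
    · exact mul_ne_zero (zpow_ne_zero _ (neg_ne_zero.2 one_ne_zero))
  ext n
  rw [HahnSeries.coeff_mul]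
  change (-1 : k) ^ n * (f * g).coeff n = _
  rw [HahnSeries.coeff_mul, Finset.mul_sum]
  refine Finset.sum_congr ?_ fun p hp => ?_
  · ext p
    rw [Finset.mem_antidiagonal, Finset.mem_antidiagonal, hsupp, hsupp]
  · rw [Finset.mem_antidiagonal] at hp
    change _ = (-1 : k) ^ p.1 * f.coeff p.1 * ((-1 : k) ^ p.2 * g.coeff p.2)
    rw [← hp.2.2, zpow_add₀ (neg_ne_zero.2 one_ne_zero)]
    ring

theorem epsilon_coe (f : k⟦X⟧) :
    epsilon (f : LaurentSeries k) = ((PowerSeries.rescale (-1 : k) f : k⟦X⟧) : LaurentSeries k) := by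
  ext n
  change (-1 : k) ^ n * (f : LaurentSeries k).coeff n = _
  rw [PowerSeries.coeff_coe, PowerSeries.coeff_coe]
  split_ifs with h
  · rw [mul_zero]
  · obtain ⟨m, rfl⟩ := Int.eq_ofNat_of_zero_le (not_lt.1 h)
    rw [PowerSeries.coeff_rescale, Int.natAbs_natCast, zpow_natCast]

/-- The involution `f(h) ↦ f(-h)` as a ring homomorphism. -/
def epsilonHom (k : Type*) [Field k] : LaurentSeries k →+* LaurentSeries k where
  toFun := epsilon
  map_one' := by rw [← PowerSeries.coe_one, epsilon_coe, map_one]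
  map_zero' := by rw [← PowerSeries.coe_zero, epsilon_coe, map_zero]
  map_mul' := epsilon_mul
  map_add' f g := by
    ext n
    exact mul_add _ _ _

theorem map_epsilon_mul {N : Type*} [Fintype N] (x y : Matrix N N (LaurentSeries k)) :
    ((x * y).map epsilon).transpose = (y.map epsilon).transpose * (x.map epsilon).transpose := by
  rw [← Matrix.transpose_mul]
  congr 1
  exact Matrix.map_mul (f := epsilonHom k)

theorem map_epsilon_one {N : Type*} [DecidableEq N] :
    ((1 : Matrix N N (LaurentSeries k)).map epsilon).transpose = 1 := by
  have : (1 : Matrix N N (LaurentSeries k)).map epsilon = 1 :=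
    Matrix.map_one (epsilonHom k) (map_zero _) (map_one _)
  rw [this, Matrix.transpose_one]

variable {N : Type*} [Fintype N] [DecidableEq N]

theorem isEpsUnitary_of_mul {x : Matrix N N (LaurentSeries k)}
    (h : x * (x.map epsilon).transpose = 1) : IsEpsUnitary x :=
  ⟨⟨⟨x, _, h, mul_eq_one_comm.1 h⟩, rfl⟩, Matrix.inv_eq_right_inv h⟩

theorem isEpsUnitary_of_generators {m : ℕ} (R : BraidGroup m →* GL N (LaurentSeries k))
    (h : ∀ r : Fin m, (R (BraidGroup.σ r) : Matrix N N (LaurentSeries k)) *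
      ((R (BraidGroup.σ r) : Matrix N N (LaurentSeries k)).map epsilon).transpose = 1)
    (g : BraidGroup m) : IsEpsUnitary (R g : Matrix N N (LaurentSeries k)) := by
  apply isEpsUnitary_of_mul
  have hg : g ∈ Subgroup.closure (Set.range (PresentedGroup.of (rels := braidRels m))) := by
    rw [PresentedGroup.closure_range_of]; trivial
  induction hg using Subgroup.closure_induction with
  | mem x hx =>
    obtain ⟨r, rfl⟩ := hx
    exact h r
  | one => rw [map_one, Units.val_one, map_epsilon_one, mul_one]
  | mul x y _ _ hx hy =>
    rw [map_mul, Units.val_mul, map_epsilon_mul, mul_assoc, ← mul_assoc _ _ (Matrix.transpose _),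
      hy, one_mul, hx]
  | inv x _ hx =>
    have h1 : (R x⁻¹ : Matrix N N (LaurentSeries k)) * R x = 1 := by
      rw [← Units.val_mul, ← map_mul, inv_mul_cancel, map_one, Units.val_one]
    have h2 := left_inv_eq_right_inv h1 hx
    have h3 := congrArg (fun y => (Matrix.map y epsilon).transpose) h1
    simp only [map_epsilon_mul, map_epsilon_one] at h3
    rwa [← h2] at h3

end

/-! ### Symmetry of the seminormal matrices. -/

section
variable {F : Type*} [Field F] {q : F} {φ A B : ℤ → F} {α : YoungDiagram} {m : ℕ} {r : Fin m}

theorem filling_swap_symm {S T : StdTableau α (m + 1)} :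
    S.filling = (adjSwap r).trans T.filling ↔ T.filling = (adjSwap r).trans S.filling := by
  have key : ∀ S T : StdTableau α (m + 1), S.filling = (adjSwap r).trans T.filling →
      T.filling = (adjSwap r).trans S.filling := by
    intro S T h
    refine Equiv.ext fun a => ?_
    rw [h, Equiv.trans_apply, Equiv.trans_apply,
      show adjSwap r (adjSwap r a) = a from Equiv.swap_apply_self _ _ _]
  exact ⟨key S T, key T S⟩

theorem IsSeminormal.transpose (h : IsSeminormal q φ A B) :
    (seminormalMatrix A B α r).transpose = seminormalMatrix A B α r := by
  ext1 S T
  rw [Matrix.transpose_apply, seminormalMatrix, Matrix.of_apply, Matrix.of_apply]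
  by_cases hST : S = T
  · subst hST; rfl
  · rw [if_neg hST, if_neg (Ne.symm hST)]
    by_cases hs : S.filling = (adjSwap r).trans T.filling
    · rw [if_pos hs, if_pos (filling_swap_symm.1 hs), hs, content_swap, content_swap,
        adjSwap_castSucc, adjSwap_succ, ← h.symm, neg_sub]
    · rw [if_neg hs, if_neg fun h' => hs (filling_swap_symm.1 h')]

end

/-! ### Action of the involution on the coefficients of the Hecke model. -/

section
variable {k : Type*} [Field k] [CharZero k] {lam : k}

theorem epsilon_qExp : epsilon (qExp lam) = (qExp lam)⁻¹ := by
  have h := qExp_zpow lam (-1)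
  rw [zpow_neg_one] at h
  rw [h, qExp_eq_expH, epsilon_coe]
  congr 1
  ext n
  simp only [PowerSeries.coeff_rescale, expH, PowerSeries.coeff_mk, smul_eq_mul, one_pow, mul_one]
  push_cast
  ring

theorem epsilon_qInt (n : ℕ) : epsilon (qInt (qExp lam) n) = qInt (qExp lam) n := by
  have h : epsilonHom k (qExp lam) = (qExp lam)⁻¹ := epsilon_qExp
  change epsilonHom k _ = _
  rw [qInt, map_div₀, map_sub, map_sub, map_inv₀, map_inv₀, map_pow, h, inv_inv, inv_pow, inv_inv,
    ← neg_sub (qExp lam ^ n), ← neg_sub (qExp lam), neg_div_neg_eq]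

theorem epsilon_heckeDiag (hlam : lam ≠ 0) {d : ℤ} (hd : d ≠ 0) :
    epsilon (heckeDiag (qExp lam) d) = heckeDiag (qExp lam) d - (qExp lam - (qExp lam)⁻¹) := by
  have h : epsilonHom k (qExp lam) = (qExp lam)⁻¹ := epsilon_qExp
  have h1 := zpow_sub_one_ne_zero (qExp_zpow_ne_one hlam) hd
  have h2 : qExp lam ^ (2 * d) ≠ 0 := zpow_ne_zero _ (qExp_ne_zero lam)
  change epsilonHom k _ = _
  rw [heckeDiag, map_div₀, map_neg, map_sub, map_sub, map_inv₀, map_zpow₀, map_one, h, inv_inv,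
    inv_zpow, neg_sub]
  generalize qExp lam ^ (2 * d) = u at *
  have h3 : u⁻¹ - 1 ≠ 0 := by
    intro h0
    apply h1
    rw [inv_eq_one.1 (sub_eq_zero.1 h0), sub_self]
  have h4 : 1 - u ≠ 0 := by rw [← neg_sub]; exact neg_ne_zero.2 h1
  generalize (qExp lam)⁻¹ = v
  generalize qExp lam = w
  have h5 : u⁻¹ - 1 = -(u - 1) / u := by field_simp; ring
  rw [h5]
  field_simp
  ring

/-- `b(-h)` is again a square root of the invariant product `[d+1]_q [d-1]_q`, with the same
constant term, so uniqueness applies. -/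
theorem epsilon_root (hlam : lam ≠ 0) {c : k} {d : ℕ} (hd : 2 ≤ d) (hc : c ^ 2 = (d : k) ^ 2 - 1)
    {b : k⟦X⟧} (hb : IsQRoot lam c d b) : epsilon (b : LaurentSeries k) = b := by
  rw [epsilon_coe]
  congr 1
  refine (existsUnique_isQRoot hlam hd hc).unique ⟨?_, ?_⟩ hb
  · rw [← hb.1, ← PowerSeries.coeff_zero_eq_constantCoeff_apply, PowerSeries.coeff_rescale]
    simp
  · have h := congrArg (epsilonHom k) hb.2
    rw [map_pow, map_mul] at h
    have h1 : ∀ n, epsilonHom k (qInt (qExp lam) n) = qInt (qExp lam) n := epsilon_qInt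
    rw [h1, h1] at h
    rw [← epsilon_coe]
    exact h

variable {s : ℕ → k} {b : ℕ → k⟦X⟧}

theorem isSeminormal_heckeSeries (hlam : lam ≠ 0)
    (hb : ∀ d : ℕ, 2 ≤ d → IsQRoot lam (s d) d (b d)) :
    IsSeminormal (qExp lam) (heckeContent (qExp lam)) (heckeDiag (qExp lam))
      (heckeOff (qExp lam) fun d => (b d : LaurentSeries k)) :=
  isSeminormal_hecke (qExp_ne_zero lam) (qExp_zpow_ne_one hlam) fun d hd => (hb d hd).2

theorem epsilon_heckeOff (hlam : lam ≠ 0) (hs : ∀ d : ℕ, 2 ≤ d → s d ^ 2 = (d : k) ^ 2 - 1)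
    (hb : ∀ d : ℕ, 2 ≤ d → IsQRoot lam (s d) d (b d)) (d : ℤ) :
    epsilon (heckeOff (qExp lam) (fun d => (b d : LaurentSeries k)) d) =
      heckeOff (qExp lam) (fun d => (b d : LaurentSeries k)) d := by
  change epsilonHom k _ = _
  rw [heckeOff]
  split_ifs with h
  · have h1 : epsilonHom k (qInt (qExp lam) d.natAbs) = qInt (qExp lam) d.natAbs := epsilon_qInt _
    have h2 : epsilonHom k (b d.natAbs : LaurentSeries k) = b d.natAbs :=
      epsilon_root hlam h (hs _ h) (hb _ h)
    rw [map_mul, map_inv₀, h1, h2]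
  · exact map_zero _

theorem isEpsUnitary_heckeModel (hlam : lam ≠ 0)
    (hs : ∀ d : ℕ, 2 ≤ d → s d ^ 2 = (d : k) ^ 2 - 1)
    (hb : ∀ d : ℕ, 2 ≤ d → IsQRoot lam (s d) d (b d)) {d : ℕ} (hd : 2 ≤ d) :
    IsEpsUnitary (heckeModel (qExp lam) (fun d => (b d : LaurentSeries k)) d) := by
  have h := isSeminormal_heckeSeries hlam hb
  have hd0 : (d : ℤ) ≠ 0 := by omega
  have h1 := h.sq d hd0
  have h2 := h.diag_add hd0
  have e1 := epsilon_heckeDiag hlam hd0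
  have e2 := epsilon_heckeDiag hlam (neg_ne_zero.2 hd0)
  have e3 := epsilon_heckeOff hlam hs hb d
  apply isEpsUnitary_of_mul
  rw [heckeModel_eq (qExp_ne_zero lam) (qExp_zpow_ne_one hlam) _ d hd]
  rw [← h2] at e1 e2
  generalize heckeDiag (qExp lam) d = x at *
  generalize heckeDiag (qExp lam) (-(d : ℤ)) = y at *
  generalize heckeOff (qExp lam) (fun d => (b d : LaurentSeries k)) d = z at *
  ext1 i j
  fin_cases i <;> fin_cases j <;>
    simp [Matrix.mul_apply, Fin.sum_univ_two, e1, e2, e3] <;>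
    first
    | ring1
    | linear_combination h1

/-- Entrywise, `ε` subtracts `q - q⁻¹` from the diagonal and fixes the rest. The result is symmetric
and, by the quadratic relation, is the inverse. -/
theorem seminormalMatrix_mul_epsilon (hlam : lam ≠ 0)
    (hs : ∀ d : ℕ, 2 ≤ d → s d ^ 2 = (d : k) ^ 2 - 1)
    (hb : ∀ d : ℕ, 2 ≤ d → IsQRoot lam (s d) d (b d)) (α : YoungDiagram) {m : ℕ} (r : Fin m) :
    let X := seminormalMatrix (heckeDiag (qExp lam))
      (heckeOff (qExp lam) fun d => (b d : LaurentSeries k)) α r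
    X * (X.map epsilon).transpose = 1 := by
  intro X
  have h := isSeminormal_heckeSeries hlam hb
  have e : X.map epsilon = X - (qExp lam - (qExp lam)⁻¹) • 1 := by
    ext1 S T
    rw [Matrix.map_apply, Matrix.sub_apply, Matrix.smul_apply, Matrix.one_apply]
    simp only [X, seminormalMatrix, Matrix.of_apply]
    by_cases hST : S = T
    · rw [if_pos hST, if_pos hST, smul_eq_mul, mul_one, epsilon_heckeDiag hlam
        (sub_ne_zero.2 (T.isStd.content_ne r.castSucc_lt_succ (by simp)))]
    · rw [if_neg hST, if_neg hST, smul_zero, sub_zero]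
      split_ifs
      · exact epsilon_heckeOff hlam hs hb _
      · exact (epsilonHom k).map_zero
  rw [e, Matrix.transpose_sub, Matrix.transpose_smul, Matrix.transpose_one, h.transpose]
  exact h.mul_inverse

end

/-! ### Infinitesimal Iwahori-Hecke representations -/

section
variable {k : Type*} [Field k] {m : ℕ} {N : Type*} [Fintype N] [DecidableEq N]

theorem swap_mul_swap_mul_swap_comm {n : ℕ} {i j p : Fin n} (hij : i ≠ j) (hip : i ≠ p)
    (hjp : j ≠ p) :
    Equiv.swap i j * Equiv.swap i p = Equiv.swap j p * Equiv.swap i j ∧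
      Equiv.swap i j * Equiv.swap p j = Equiv.swap i p * Equiv.swap i j := by
  constructor <;>
  · ext x
    simp only [Equiv.Perm.mul_apply, Equiv.swap_apply_def]
    split_ifs <;> simp_all

theorem exists_infinitesimalHecke (ρ₀ : Equiv.Perm (Fin (m + 1)) →* GL N k) :
    ∃ ρ : InfBraid k (m + 1) →ₐ[k] Matrix N N k, IsInfinitesimalHecke ρ₀ ρ := by
  let t : Fin (m + 1) → Fin (m + 1) → Matrix N N k := fun i j =>
    -- The relation `t_{ii} = 0` forces the separate diagonal value, since `swap i i` is the
    -- identity permutation.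
    if i = j then 0 else (2 : k) • (ρ₀ (Equiv.swap i j) : Matrix N N k)
  have ht : ∀ i j, i ≠ j → t i j = (2 : k) • (ρ₀ (Equiv.swap i j) : Matrix N N k) :=
    fun i j h => if_neg h
  have ht0 : ∀ i, t i i = 0 := fun i => if_pos rfl
  have hmul : ∀ g g' : Equiv.Perm (Fin (m + 1)),
      (ρ₀ g : Matrix N N k) * (ρ₀ g' : Matrix N N k) = (ρ₀ (g * g') : Matrix N N k) := by
    intro g g'
    rw [map_mul, Units.val_mul]
  have hsymm : ∀ i j, t i j = t j i := by
    intro i j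
    by_cases h : i = j
    · rw [h]
    · rw [ht i j h, ht j i (Ne.symm h), Equiv.swap_comm]
  let f : Equiv.Perm (Fin (m + 1)) ⊕ Fin (m + 1) × Fin (m + 1) → Matrix N N k :=
    Sum.elim (fun g => (ρ₀ g : Matrix N N k)) fun p => t p.1 p.2
  have hlift : ∀ a, FreeAlgebra.lift k f
      (FreeAlgebra.lift k (fun p => FreeAlgebra.ι k (Sum.inr p)) a) =
      FreeAlgebra.lift k (fun p : Fin (m + 1) × Fin (m + 1) => t p.1 p.2) a := by
    intro a
    rw [← AlgHom.comp_apply]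
    congr 1
    ext p
    simp [f]
  have hrel : ∀ ⦃a b⦄, InfBraidRel k (m + 1) a b →
      FreeAlgebra.lift k f a = FreeAlgebra.lift k f b := by
    intro a b hab
    cases hab with
    | one => simp [f]
    | mul g g' =>
      rw [map_mul]
      simp only [FreeAlgebra.lift_ι_apply, f, Sum.elim_inl]
      exact (hmul g g').symm
    | act g i j =>
      simp only [map_mul, FreeAlgebra.lift_ι_apply, f, Sum.elim_inl, Sum.elim_inr]
      by_cases h : i = j
      · rw [h, ht0, ht0, mul_zero, zero_mul]
      · rw [ht i j h, ht _ _ (g.injective.ne h), mul_smul_comm, smul_mul_assoc, hmul, hmul]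
        congr 3
        exact Equiv.mul_swap_eq_swap_mul g i j
    | hol a b hab =>
      rw [hlift, hlift]
      cases hab with
      | diag i => simp [ht0]
      | symm i j => simpa using hsymm i j
      | far i j p l hcard =>
        have hij : i ≠ j := by
          rintro rfl
          have := Finset.card_le_three (a := i) (b := p) (c := l)
          simp at hcard; omega
        have hip : i ≠ p := by
          rintro rfl
          have := Finset.card_le_three (a := i) (b := j) (c := l)
          have e : ({i, j, i, l} : Finset (Fin (m + 1))) = {i, j, l} := by
            ext x; simp; tauto
          rw [e] at hcard; omega
        have hil : i ≠ l := by
          rintro rfl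
          have := Finset.card_le_three (a := i) (b := j) (c := p)
          have e : ({i, j, p, i} : Finset (Fin (m + 1))) = {i, j, p} := by
            ext x; simp; tauto
          rw [e] at hcard; omega
        have hjp : j ≠ p := by
          rintro rfl
          have := Finset.card_le_three (a := i) (b := j) (c := l)
          have e : ({i, j, j, l} : Finset (Fin (m + 1))) = {i, j, l} := by
            ext x; simp
          rw [e] at hcard; omega
        have hjl : j ≠ l := by
          rintro rfl
          have := Finset.card_le_three (a := i) (b := j) (c := p)
          have e : ({i, j, p, j} : Finset (Fin (m + 1))) = {i, j, p} := by
            ext x; simp; tauto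
          rw [e] at hcard; omega
        have hpl : p ≠ l := by
          rintro rfl
          have := Finset.card_le_three (a := i) (b := j) (c := p)
          have e : ({i, j, p, p} : Finset (Fin (m + 1))) = {i, j, p} := by
            ext x; simp
          rw [e] at hcard; omega
        have hc : Equiv.swap i j * Equiv.swap p l = Equiv.swap p l * Equiv.swap i j := by
          ext x
          simp only [Equiv.Perm.mul_apply, Equiv.swap_apply_def]
          split_ifs <;> simp_all
        simp only [map_mul, FreeAlgebra.lift_ι_apply, ht i j hij, ht p l hpl]
        rw [smul_mul_smul_comm, smul_mul_smul_comm, hmul, hmul, hc]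
      | triple i j p =>
        simp only [map_mul, map_add, FreeAlgebra.lift_ι_apply]
        by_cases hij : i = j
        · rw [hij, ht0, zero_mul, mul_zero]
        by_cases hip : i = p
        · subst hip; rw [ht0, zero_add]
        by_cases hjp : j = p
        · subst hjp; rw [ht0, add_zero]
        obtain ⟨h1, h2⟩ := swap_mul_swap_mul_swap_comm hij hip hjp
        rw [ht i j hij, ht i p hip, ht p j (Ne.symm hjp), mul_add, add_mul]
        simp only [smul_mul_smul_comm, hmul]
        rw [h1, h2, Equiv.swap_comm p j, add_comm]
  refine ⟨RingQuot.liftAlgHom k ⟨FreeAlgebra.lift k f, hrel⟩, fun g => ?_, fun i j hij => ?_⟩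
  · rw [InfBraid.s, RingQuot.liftAlgHom_mkAlgHom_apply]
    simp [f]
  · rw [InfBraid.t, RingQuot.liftAlgHom_mkAlgHom_apply]
    simp [f, ht i j hij]

theorem phiHat_eq (lam : k) (Φ : NCSeries k) (ρ : InfBraid k (m + 1) →ₐ[k] Matrix N N k)
    (r : Fin m) :
    phiHat lam Φ ρ r = toLaurentMatrix N (braidSeries lam Φ (ρ (InfBraid.s k (adjSwap r)))
      (ρ (InfBraid.t k r.castSucc r.succ)) (ρ (InfBraid.Y k r.castSucc))) := by
  have h : braidSeries lam Φ (ρ (InfBraid.s k (adjSwap r)))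
      (ρ (InfBraid.t k r.castSucc r.succ)) (ρ (InfBraid.Y k r.castSucc)) =
      PowerSeries.map (ρ : InfBraid k (m + 1) →+* Matrix N N k) (phiTilde lam Φ r) := by
    simp only [phiTilde, braidSeries, map_mul, NCSeries.map_subst, map_expH, PowerSeries.map_C]
    rfl
  rw [h]
  rfl

end

section
variable {k : Type*} [Field k] {m : ℕ} {α : YoungDiagram} {q : k} {φ A B : ℤ → k}

/-- Sums of transpositions `(i a)`, `i < a`, satisfy the recursion of `jucysMurphy` at `q = 1`:
conjugation by `s_r` carries those for `r` to those for `r + 1`, except for `s_r` itself. -/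
theorem map_Y_eq_diagonal (h : IsSeminormal (1 : k) φ A B)
    {ρ₀ : Equiv.Perm (Fin (m + 1)) →* GL (StdTableau α (m + 1)) k}
    {ρ : InfBraid k (m + 1) →ₐ[k] Matrix (StdTableau α (m + 1)) (StdTableau α (m + 1)) k}
    (hρ₀ : ∀ r : Fin m, (ρ₀ (adjSwap r) : Matrix _ _ k) = seminormalMatrix A B α r)
    (hρ : IsInfinitesimalHecke ρ₀ ρ) (a : Fin (m + 1)) :
    ρ (InfBraid.Y k a) = (2 : k) • Matrix.diagonal fun T : StdTableau α (m + 1) =>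
      φ (content T.filling a) := by
  have h1 : ρ (InfBraid.Y k a) = (2 : k) • ∑ i ∈ Finset.univ.filter (fun i => i < a),
      (ρ₀ (Equiv.swap i a) : Matrix (StdTableau α (m + 1)) (StdTableau α (m + 1)) k) := by
    rw [InfBraid.Y, map_sum, Finset.smul_sum]
    exact Finset.sum_congr rfl fun i hi => hρ.2 i a (Finset.mem_filter.1 hi).2.ne
  rw [h1]
  congr 1
  clear h1
  induction a using Fin.induction with
  | zero =>
    rw [Finset.sum_eq_zero fun i hi => absurd (Finset.mem_filter.1 hi).2 (not_lt.2 (Fin.zero_le i))]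
    symm
    rw [Matrix.diagonal_eq_zero]
    funext T
    rw [IsStd.content_zero T.isStd, h.zero]; rfl
  | succ r ih =>
    rw [← h.jucysMurphy, ← ih, ← hρ₀]
    have hset : (Finset.univ.filter fun i => i < r.succ) =
        insert r.castSucc (Finset.univ.filter fun i => i < r.castSucc) := by
      ext i
      simp only [Finset.mem_filter, Finset.mem_univ, true_and, Finset.mem_insert, Fin.lt_def,
        Fin.ext_iff, Fin.val_castSucc, Fin.val_succ]
      omega
    rw [hset, Finset.sum_insert (by simp), Finset.mul_sum, Finset.sum_mul]
    refine (add_comm _ _).trans (congrArg₂ (· + ·) ?_ rfl)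
    refine Finset.sum_congr rfl fun i hi => ?_
    have hi' : i < r.castSucc := (Finset.mem_filter.1 hi).2
    rw [← Units.val_mul, ← Units.val_mul, ← map_mul, ← map_mul]
    congr 2
    have h1 : i ≠ r.succ := (hi'.trans r.castSucc_lt_succ).ne
    rw [adjSwap, Equiv.swap_mul_swap_mul_swap hi'.ne h1, Equiv.swap_comm]

end

/-! ### The image of the braid generators -/

section
variable {k : Type*} [Field k] {lam : k} {Φ : NCSeries k}

theorem toLaurentMatrix_scalar {N : Type*} [Fintype N] [DecidableEq N] {f : (Matrix N N k)⟦X⟧}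
    {g : k⟦X⟧} (h : ∀ n, PowerSeries.coeff n f = PowerSeries.coeff n g • 1) :
    toLaurentMatrix N f = (g : LaurentSeries k) • 1 := by
  ext1 i j
  rw [toLaurentMatrix_apply, Matrix.smul_apply, Matrix.one_apply]
  by_cases hij : i = j
  · subst hij
    rw [if_pos rfl, smul_eq_mul, mul_one]
    congr 1
    ext n
    rw [PowerSeries.coeff_mk, h, Matrix.smul_apply, Matrix.one_apply_eq, smul_eq_mul, mul_one]
  · rw [if_neg hij, smul_zero, ← PowerSeries.coe_zero]
    congr 1
    ext n
    rw [PowerSeries.coeff_mk, h, Matrix.smul_apply, Matrix.one_apply_ne hij, smul_zero, map_zero]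

/-- The matrices whose entry at `(S, T)` vanishes unless `S` is `T` or is obtained from `T` by the
exchange of two given consecutive entries. -/
def swapSubalgebra (k : Type*) [Field k] (α : YoungDiagram) {m : ℕ} (r : Fin m) :
    Subalgebra k (Matrix (StdTableau α (m + 1)) (StdTableau α (m + 1)) k) where
  carrier := {X | ∀ S T, X S T ≠ 0 → S = T ∨ S.filling = (adjSwap r).trans T.filling}
  mul_mem' {X Y} hX hY S T h := by
    rw [Matrix.mul_apply] at h
    obtain ⟨U, _, hU⟩ := Finset.exists_ne_zero_of_sum_ne_zero h
    have h1 := hX S U (left_ne_zero_of_mul hU)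
    have h2 := hY U T (right_ne_zero_of_mul hU)
    rcases h1 with rfl | h1
    · exact h2
    · rcases h2 with rfl | h2
      · exact Or.inr h1
      · exact Or.inl (StdTableau.filling_injective
          (h1.trans (filling_swap_symm.1 h2).symm))
  add_mem' {X Y} hX hY S T h := by
    by_cases h1 : X S T = 0
    · refine hY S T fun h2 => h ?_
      rw [Matrix.add_apply, h1, h2, add_zero]
    · exact hX S T h1
  algebraMap_mem' c S T h := by
    by_contra hne
    apply h
    rw [Matrix.algebraMap_matrix_apply, if_neg fun h' => hne (Or.inl h')]

/-- Substitution is natural in the algebra, so every coefficient of the series can be computed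
inside the subalgebra. -/
theorem braidSeries_entry_eq_zero {α : YoungDiagram} {m : ℕ} {r : Fin m}
    {s x y : Matrix (StdTableau α (m + 1)) (StdTableau α (m + 1)) k}
    (hs : s ∈ swapSubalgebra k α r) (hx : x ∈ swapSubalgebra k α r)
    (hy : y ∈ swapSubalgebra k α r) {S T : StdTableau α (m + 1)}
    (h : ¬ (S = T ∨ S.filling = (adjSwap r).trans T.filling)) :
    toLaurentMatrix _ (braidSeries lam Φ s x y) S T = 0 := by
  have e : braidSeries lam Φ s x y = PowerSeries.map ((swapSubalgebra k α r).val :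
      swapSubalgebra k α r →+* Matrix (StdTableau α (m + 1)) (StdTableau α (m + 1)) k)
      (braidSeries lam Φ (⟨s, hs⟩ : swapSubalgebra k α r) ⟨x, hx⟩ ⟨y, hy⟩) := by
    simp only [braidSeries, map_mul, NCSeries.map_subst, map_expH, PowerSeries.map_C]
    rfl
  rw [toLaurentMatrix_apply, ← PowerSeries.coe_zero]
  congr 1
  ext n
  rw [PowerSeries.coeff_mk, e, PowerSeries.coeff_map, map_zero]
  by_contra hne
  exact h ((PowerSeries.coeff n _ : swapSubalgebra k α r).2 S T hne)

end

section
variable {k : Type*} [Field k] [CharZero k] {lam : k} {Φ : NCSeries k}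

theorem toLaurentMatrix_expH_diagonal {N : Type*} [Fintype N] [DecidableEq N] (c : N → ℤ) :
    toLaurentMatrix N (expH lam (Matrix.diagonal fun i => (c i : k))) =
      Matrix.diagonal fun i => qExp lam ^ c i := by
  ext1 i j
  rw [toLaurentMatrix_apply, Matrix.diagonal_apply]
  by_cases hij : i = j
  · subst hij
    rw [if_pos rfl, qExp_zpow]
    congr 1
    ext n
    simp only [expH, PowerSeries.coeff_mk, Matrix.diagonal_pow, Matrix.smul_apply,
      Matrix.diagonal_apply_eq, Pi.pow_apply]
  · rw [if_neg hij, ← PowerSeries.coe_zero]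
    congr 1
    ext n
    simp only [expH, PowerSeries.coeff_mk, Matrix.diagonal_pow, Matrix.smul_apply,
      Matrix.diagonal_apply_ne _ hij, smul_zero, map_zero]

/-- With `s² = 1` and `x = 2s`, the element `s e^{λhs}` minus its inverse is the scalar `q - q⁻¹`.
Conjugation by `Φ(x, y)` does not change a scalar. -/
theorem IsAssociator.braidSeries_quadratic (h : IsAssociator lam Φ) {N : Type*} [Fintype N]
    [DecidableEq N] {s y : Matrix N N k} (hs : s * s = 1) :
    let X := toLaurentMatrix N (braidSeries lam Φ s ((2 : k) • s) y)
    X * (X - (qExp lam - (qExp lam)⁻¹) • 1) = 1 := by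
  intro X
  set x := (2 : k) • s with hx
  have hsx : s * x = x * s := by rw [hx, mul_smul_comm, smul_mul_assoc]
  have a1 := h.subst_mul_subst x y
  have a2 := h.subst_mul_subst y x
  have S2 : (PowerSeries.C s : (Matrix N N k)⟦X⟧) * PowerSeries.C s = 1 := by
    rw [← map_mul, hs, map_one]
  let X' : (Matrix N N k)⟦X⟧ :=
    Φ.subst x y * (expH (lam / 2) (-x) * PowerSeries.C s) * Φ.subst y x
  have hinv : braidSeries lam Φ s x y * X' = 1 := by
    calc braidSeries lam Φ s x y * X' = Φ.subst x y * (PowerSeries.C s * (expH (lam / 2) x *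
          (Φ.subst y x * Φ.subst x y) * expH (lam / 2) (-x)) * PowerSeries.C s) *
          Φ.subst y x := by simp only [braidSeries, X', mul_assoc]
      _ = 1 := by rw [a2, mul_one, expH_mul_neg, mul_one, S2, mul_one, a1]
  -- In even degree both sides vanish; in odd degree `s ^ n = s`, so the two terms add up to a
  -- scalar.
  have hdiff : ∀ n, PowerSeries.coeff n (PowerSeries.C s * expH (lam / 2) x -
      expH (lam / 2) (-x) * PowerSeries.C s) =
      PowerSeries.coeff n (expH lam (1 : k) - expH lam (-1 : k)) • (1 : Matrix N N k) := by
    intro n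
    rw [map_sub, map_sub, PowerSeries.coeff_C_mul, PowerSeries.coeff_mul_C]
    simp only [expH, PowerSeries.coeff_mk, hx, one_pow, smul_eq_mul, mul_one]
    rw [← smul_neg, smul_pow, smul_pow, div_pow, neg_pow s]
    have hc : lam ^ n / 2 ^ n / (n.factorial : k) * 2 ^ n = lam ^ n / (n.factorial : k) := by
      field_simp
    rw [smul_smul, smul_smul, hc, mul_smul_comm, smul_mul_assoc]
    rcases Nat.even_or_odd' n with ⟨e, rfl | rfl⟩
    · have e1 : s ^ (2 * e) = 1 := by rw [pow_mul, sq, hs, one_pow]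
      have e2 : (-1 : Matrix N N k) ^ (2 * e) = 1 := by rw [pow_mul, neg_one_sq, one_pow]
      have e3 : (-1 : k) ^ (2 * e) = 1 := by rw [pow_mul, neg_one_sq, one_pow]
      rw [e1, e2, e3, one_mul, one_mul, mul_one, mul_one, sub_self, sub_self, zero_smul]
    · have e1 : s ^ (2 * e + 1) = s := by rw [pow_succ, pow_mul, sq, hs, one_pow, one_mul]
      have e2 : (-1 : Matrix N N k) ^ (2 * e + 1) = -1 := by
        rw [pow_succ, pow_mul, neg_one_sq, one_pow, one_mul]
      have e3 : (-1 : k) ^ (2 * e + 1) = -1 := by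
        rw [pow_succ, pow_mul, neg_one_sq, one_pow, one_mul]
      rw [e1, e2, e3, neg_one_mul, neg_mul, hs, sub_smul, smul_neg, mul_neg_one, neg_smul]
  have hκ : toLaurentMatrix N (PowerSeries.C s * expH (lam / 2) x -
      expH (lam / 2) (-x) * PowerSeries.C s) = (qExp lam - (qExp lam)⁻¹) • 1 := by
    rw [toLaurentMatrix_scalar hdiff, PowerSeries.coe_sub, ← qExp_eq_expH, ← zpow_neg_one,
      qExp_zpow]
    congr 4
    push_cast
    rfl
  have hX' : X - (qExp lam - (qExp lam)⁻¹) • 1 = toLaurentMatrix N X' := by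
    rw [sub_eq_iff_eq_add, ← sub_eq_iff_eq_add']
    have e : braidSeries lam Φ s x y - X' = Φ.subst x y * (PowerSeries.C s * expH (lam / 2) x -
      expH (lam / 2) (-x) * PowerSeries.C s) * Φ.subst y x := by
      simp only [braidSeries, X', mul_sub, sub_mul, mul_assoc]
    change toLaurentMatrix N _ - _ = _
    rw [← map_sub, e, map_mul, map_mul, hκ, Matrix.mul_smul, mul_one, Matrix.smul_mul, ← map_mul,
      a1, map_one]
  rw [hX']
  change toLaurentMatrix N _ * _ = _
  rw [← map_mul, hinv, map_one]

theorem IsAssociator.constantCoeff_braidSeries (h : IsAssociator lam Φ) {R : Type*} [Ring R]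
    [Algebra k R] (s x y : R) : PowerSeries.constantCoeff (braidSeries lam Φ s x y) = s := by
  have : PowerSeries.constantCoeff (expH (lam / 2) x) = 1 := by
    rw [← PowerSeries.coeff_zero_eq_constantCoeff_apply]
    simp [expH]
  simp only [braidSeries, map_mul, NCSeries.constantCoeff_subst, h.nil, one_smul,
    PowerSeries.constantCoeff_C, this, one_mul, mul_one]

variable {s : ℕ → k} {b : ℕ → k⟦X⟧}

/-- The Hecke off-diagonal coefficient has no pole and specialises at `h = 0` to Young's; this is
what fixes the sign in the comparison below. -/
theorem heckeOff_eq_coe (hlam : lam ≠ 0) {d : ℤ} (hd : 2 ≤ d.natAbs)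
    (hb : ∀ d : ℕ, 2 ≤ d → IsQRoot lam (s d) d (b d)) :
    ∃ g : k⟦X⟧, heckeOff (qExp lam) (fun d => (b d : LaurentSeries k)) d = g ∧
      PowerSeries.constantCoeff g = youngOff s d := by
  have h0 : PowerSeries.constantCoeff (qIntSeries lam d.natAbs) ≠ 0 := by
    rw [constantCoeff_qIntSeries]
    exact_mod_cast (by omega : d.natAbs ≠ 0)
  refine ⟨(qIntSeries lam d.natAbs)⁻¹ * b d.natAbs, ?_, ?_⟩
  · rw [heckeOff, if_pos hd, PowerSeries.coe_mul, ← coe_qIntSeries hlam]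
    congr 1
    refine inv_eq_of_mul_eq_one_right ?_
    rw [← PowerSeries.coe_mul, PowerSeries.mul_inv_cancel _ h0, PowerSeries.coe_one]
  · rw [map_mul, PowerSeries.constantCoeff_inv, constantCoeff_qIntSeries, (hb _ hd).1, youngOff,
      if_pos hd, div_eq_inv_mul]

/-- A braid generator acts by the Hecke model in the representation of the braid group attached
to an infinitesimal Iwahori-Hecke representation. -/
theorem toLaurentMatrix_braidSeries_eq (hlam : lam ≠ 0) (hΦ : IsAssociator lam Φ)
    (heven : Φ.bar = Φ) (hs : ∀ d : ℕ, 2 ≤ d → s d ^ 2 = (d : k) ^ 2 - 1)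
    (hb : ∀ d : ℕ, 2 ≤ d → IsQRoot lam (s d) d (b d)) (α : YoungDiagram) {m : ℕ} (r : Fin m) :
    toLaurentMatrix (StdTableau α (m + 1)) (braidSeries lam Φ
      (seminormalMatrix (youngDiag k) (youngOff s) α r)
      ((2 : k) • seminormalMatrix (youngDiag k) (youngOff s) α r)
      ((2 : k) • Matrix.diagonal fun T : StdTableau α (m + 1) =>
        ((content T.filling r.castSucc : ℤ) : k))) =
    seminormalMatrix (heckeDiag (qExp lam))
      (heckeOff (qExp lam) fun d => (b d : LaurentSeries k)) α r := by
  have hy := isSeminormal_young hs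
  have hh := isSeminormal_heckeSeries hlam hb
  set σ := seminormalMatrix (youngDiag k) (youngOff s) α r with hσ
  set D := Matrix.diagonal fun T : StdTableau α (m + 1) =>
    ((content T.filling r.castSucc : ℤ) : k) with hD
  set D' := Matrix.diagonal fun T : StdTableau α (m + 1) =>
    ((content T.filling r.succ : ℤ) : k) with hD'
  have hσσ : σ * σ = 1 := by
    have := hy.quadratic (α := α) (r := r)
    rwa [inv_one, sub_self, zero_smul, add_zero] at this
  have hσt : σ.transpose = σ := hy.transpose
  have hJM : σ * D * σ + σ = D' := hy.jucysMurphy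
  have r1 : σ * D = D' * σ - 1 := by
    rw [← hJM, add_mul, mul_assoc _ σ σ, hσσ, mul_one, add_sub_cancel_right]
  have r2 : σ * D' = D * σ + 1 := by
    rw [← hJM, mul_add, ← mul_assoc, ← mul_assoc, hσσ, one_mul]
  have hDD : D * D' = D' * D := by
    rw [hD, hD', Matrix.diagonal_mul_diagonal, Matrix.diagonal_mul_diagonal]
    congr 1; funext T; ring
  set x := (2 : k) • σ with hx
  set y := (2 : k) • D with hyd
  -- This is `σ y σ`, by the Jucys-Murphy recursion; thus `x + z` is the diagonal matrix `2 D'`.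
  set z := (2 : k) • D' - (2 : k) • σ with hz
  have hsx : σ * x = x * σ := by rw [hx, mul_smul_comm, smul_mul_assoc]
  have hsy : σ * y = z * σ := by
    rw [hyd, hz, mul_smul_comm, r1, sub_mul, smul_mul_assoc, smul_mul_assoc, hσσ, smul_sub]
  have hsum : x + y + z = (2 : k) • (D + D') := by rw [hx, hyd, hz, smul_add]; abel
  have hcx : Commute x (x + y + z) := by
    rw [hsum, hx]
    refine (Commute.smul_right ?_ _).smul_left _
    change σ * (D + D') = (D + D') * σ
    rw [mul_add, add_mul, r1, r2]; abel
  have hcy : Commute y (x + y + z) := by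
    rw [hsum, hyd]
    refine (Commute.smul_right ?_ _).smul_left _
    exact (Commute.refl D).add_right hDD
  set P := toLaurentMatrix (StdTableau α (m + 1)) (braidSeries lam Φ σ x y) with hP
  set q := qExp lam with hq
  have hexp : ∀ a : Fin (m + 1), toLaurentMatrix (StdTableau α (m + 1)) (expH lam ((2 : k) •
      Matrix.diagonal fun T : StdTableau α (m + 1) => ((content T.filling a : ℤ) : k))) =
      Matrix.diagonal fun T => q ^ (2 * content T.filling a) := by
    intro a
    rw [← toLaurentMatrix_expH_diagonal, ← Matrix.diagonal_smul]
    congr 3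
    funext T
    simp
  have main := congrArg (toLaurentMatrix (StdTableau α (m + 1)))
    (hΦ.braidSeries_mul heven hσσ hsx hsy hcx hcy)
  have hxz : x + z = (2 : k) • D' := by rw [hx, hz]; abel
  rw [map_mul, map_mul, hxz, hyd, hexp, hexp, ← hP] at main
  have quad : P * (P - (q - q⁻¹) • 1) = 1 := hΦ.braidSeries_quadratic hσσ
  have symm : P.transpose = P := by
    refine hΦ.transpose_braidSeries heven hσt ?_ ?_ hsx
    · rw [hx, Matrix.transpose_smul, hσt]
    · rw [hyd, Matrix.transpose_smul, hD, Matrix.diagonal_transpose]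
  -- Multiply `P q^{2D} P = q^{2D'}` on the right by `P⁻¹ = P - (q - q⁻¹)`. The relation is now
  -- linear in `P`, and its diagonal entries determine those of `P`, the two contents being
  -- distinct.
  have comm : P * (Matrix.diagonal fun T : StdTableau α (m + 1) =>
      q ^ (2 * content T.filling r.castSucc)) =
      (Matrix.diagonal fun T : StdTableau α (m + 1) => q ^ (2 * content T.filling r.succ)) *
        (P - (q - q⁻¹) • 1) := by
    rw [← main, mul_assoc _ P, quad, mul_one]
  have memσ : σ ∈ swapSubalgebra k α r := by
    intro S T hne
    by_contra! hcon
    apply hne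
    rw [hσ, seminormalMatrix, Matrix.of_apply, if_neg hcon.1, if_neg hcon.2]
  have memx : x ∈ swapSubalgebra k α r := Subalgebra.smul_mem _ memσ _
  have memy : y ∈ swapSubalgebra k α r := by
    refine Subalgebra.smul_mem _ (fun S T hne => ?_) _
    by_contra! hcon
    exact hne (Matrix.diagonal_apply_ne _ hcon.1)
  have hdiag : ∀ T : StdTableau α (m + 1), P T T =
      heckeDiag q (content T.filling r.castSucc - content T.filling r.succ) := by
    intro T
    have hne := T.isStd.content_ne r.castSucc_lt_succ (by simp)
    have h1 := congrFun (congrFun comm T) T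
    rw [Matrix.mul_diagonal, Matrix.diagonal_mul, Matrix.sub_apply, Matrix.smul_apply,
      Matrix.one_apply_eq, smul_eq_mul, mul_one] at h1
    have hκ := sub_inv_ne_zero (qExp_ne_zero lam) (qExp_zpow_ne_one hlam)
    have h2 := hh.diag_eq hne
    have h3 := hh.phi_ne hne
    rw [h2, eq_div_iff h3, heckeContent, heckeContent]
    generalize q - q⁻¹ = κ at *
    field_simp
    linear_combination -h1
  ext1 S T
  by_cases hST : S = T
  · subst hST
    rw [hdiag, seminormalMatrix, Matrix.of_apply, if_pos rfl]
  by_cases hsw : S.filling = (adjSwap r).trans T.filling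
  swap
  · rw [seminormalMatrix, Matrix.of_apply, if_neg hST, if_neg hsw]
    exact braidSeries_entry_eq_zero memσ memx memy (not_or.2 ⟨hST, hsw⟩)
  have hne := T.isStd.content_ne r.castSucc_lt_succ (by simp)
  have hd : 2 ≤ (content T.filling r.castSucc - content T.filling r.succ).natAbs := by
    have := T.isStd.natAbs_of_swap (r := r) (hsw ▸ S.isStd)
    omega
  set d := content T.filling r.castSucc - content T.filling r.succ with hdef
  -- Read the `(T, T)` entry of `P (P - (q - q⁻¹)) = 1`: only `T` and `S` contribute, and `P T S = P
  -- S T` by symmetry.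
  have hsq : P S T ^ 2 = heckeOff q (fun d => (b d : LaurentSeries k)) d ^ 2 := by
    have h1 := congrFun (congrFun quad T) T
    rw [Matrix.mul_apply, Matrix.one_apply_eq] at h1
    have h2 : ∑ U, P T U * (P - (q - q⁻¹) •
        (1 : Matrix (StdTableau α (m + 1)) (StdTableau α (m + 1)) (LaurentSeries k))) U T =
        P T T * (P T T - (q - q⁻¹)) + P T S * P S T := by
      rw [← Finset.sum_subset (Finset.subset_univ {T, S}), Finset.sum_pair (Ne.symm hST)]
      · simp [hST]
      · intro U _ hU
        rw [Finset.mem_insert, Finset.mem_singleton, not_or] at hU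
        have : P T U = 0 := braidSeries_entry_eq_zero memσ memx memy (not_or.2 ⟨Ne.symm hU.1,
          fun h => hU.2 (StdTableau.filling_injective
            ((filling_swap_symm.1 h).trans hsw.symm))⟩)
        rw [this, zero_mul]
    have h3 : P T S = P S T := congrFun (congrFun symm S) T
    have h4 := hh.sq d (by omega)
    have h5 := hh.diag_add (d := d) (by omega)
    rw [h2, h3, hdiag] at h1
    rw [h4]
    linear_combination h1 - heckeDiag q d * h5
  obtain ⟨g, hg, hg0⟩ := heckeOff_eq_coe hlam hd hb
  rw [seminormalMatrix, Matrix.of_apply, if_neg hST, if_pos hsw]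
  rcases sq_eq_sq_iff_eq_or_eq_neg.1 hsq with h | h
  · exact h
  -- The wrong sign would equate Young's coefficient with its opposite at `h = 0`, but that
  -- coefficient is nonzero.
  · exfalso
    rw [hg, hP, toLaurentMatrix_apply, ← PowerSeries.coe_neg] at h
    have h1 := congrArg PowerSeries.constantCoeff (HahnSeries.ofPowerSeries_injective h)
    rw [map_neg, hg0, ← PowerSeries.coeff_zero_eq_constantCoeff_apply, PowerSeries.coeff_mk,
      PowerSeries.coeff_zero_eq_constantCoeff_apply, hΦ.constantCoeff_braidSeries, hσ,
      seminormalMatrix, Matrix.of_apply, if_neg hST, if_pos hsw, eq_neg_iff_add_eq_zero,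
      ← two_mul] at h1
    have h2 : youngOff s d ≠ 0 := by
      rw [youngOff, if_pos hd]
      exact div_ne_zero (root_ne_zero hs hd) (by exact_mod_cast (by omega : d.natAbs ≠ 0))
    exact mul_ne_zero two_ne_zero h2 h1

end

/-- The seminormal representation for `q = 1` factors through the symmetric group. -/
theorem IsSeminormal.exists_permRep {F : Type*} [Field F] {φ A B : ℤ → F}
    (h : IsSeminormal (1 : F) φ A B) (α : YoungDiagram) (m : ℕ) :
    ∃ ρ₀ : Equiv.Perm (Fin (m + 1)) →* GL (StdTableau α (m + 1)) F,
      ∀ r : Fin m, (ρ₀ (adjSwap r) : Matrix _ _ F) = seminormalMatrix A B α r := by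
  obtain ⟨R, hR⟩ := h.exists_rep α m
  obtain ⟨f, hf⟩ := exists_permHom (fun r => R (BraidGroup.σ r))
    (fun i => Units.ext (by
      rw [Units.val_mul, hR, h.quadratic, inv_one, sub_self, zero_smul, add_zero, Units.val_one]))
    (fun i j hij => Units.ext (by
      rw [Units.val_mul, Units.val_mul, hR, hR, h.far hij]))
    (fun i j hij => Units.ext (by
      simp only [Units.val_mul, hR]
      exact h.braid hij))
  exact ⟨f, fun r => by rw [hf, hR]⟩

end EvenAssoc

end

/-! ### Assembly of the theorem. -/

theorem mainTheorem2 {k : Type*} [Field k] [CharZero k] (lam : k) (hlam : lam ≠ 0)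
    (Φ : EvenAssoc.NCSeries k) (hΦ : EvenAssoc.IsAssociator lam Φ) (heven : Φ.bar = Φ)
    (s : ℕ → k) (hs : ∀ d : ℕ, 2 ≤ d → s d ^ 2 = (d : k) ^ 2 - 1) :
    -- Young's orthonormal model is a matrix model of the symmetric groups
    EvenAssoc.IsMatrixModel (1 : k) (EvenAssoc.youngOrthonormal s) ∧
    -- the square roots of `[d+1]_q [d-1]_q` which occur in the model are well defined
    (∀ d : ℕ, 2 ≤ d → ∃! b : PowerSeries k, EvenAssoc.IsQRoot lam (s d) d b) ∧
    ∀ b : ℕ → PowerSeries k, (∀ d : ℕ, 2 ≤ d → EvenAssoc.IsQRoot lam (s d) d (b d)) →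
      let q : LaurentSeries k := EvenAssoc.qExp lam
      let M : ℕ → Matrix (Fin 2) (Fin 2) (LaurentSeries k) :=
        EvenAssoc.heckeModel q fun d => (b d : LaurentSeries k)
      -- the matrices `M d` form a matrix model of `H_n(q)`
      EvenAssoc.IsMatrixModel q M ∧
      -- this model is unitary
      (∀ d : ℕ, 2 ≤ d → EvenAssoc.IsEpsUnitary (M d)) ∧
      -- it is obtained by applying `Φ̂` to the infinitesimal representations
      ∀ (m : ℕ) (α : YoungDiagram), α.card = m + 1 →
        ∃ (ρ₀ : Equiv.Perm (Fin (m + 1)) →* GL (EvenAssoc.StdTableau α (m + 1)) k)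
          (ρ : EvenAssoc.InfBraid k (m + 1) →ₐ[k]
            Matrix (EvenAssoc.StdTableau α (m + 1)) (EvenAssoc.StdTableau α (m + 1)) k)
          (R : EvenAssoc.BraidGroup m →*
            GL (EvenAssoc.StdTableau α (m + 1)) (LaurentSeries k)),
          (∀ r : Fin m, (ρ₀ (EvenAssoc.adjSwap r) : Matrix _ _ k) =
            EvenAssoc.tableauMatrix 1 (EvenAssoc.youngOrthonormal s) α r) ∧
          EvenAssoc.IsInfinitesimalHecke ρ₀ ρ ∧
          (∀ r : Fin m, (R (EvenAssoc.BraidGroup.σ r) : Matrix _ _ (LaurentSeries k)) =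
            EvenAssoc.phiHat lam Φ ρ r) ∧
          (∀ r : Fin m, EvenAssoc.phiHat lam Φ ρ r = EvenAssoc.tableauMatrix q M α r) ∧
          (∀ g : EvenAssoc.BraidGroup m,
            EvenAssoc.IsEpsUnitary (R g : Matrix (EvenAssoc.StdTableau α (m + 1))
              (EvenAssoc.StdTableau α (m + 1)) (LaurentSeries k))) := by
  have hy := EvenAssoc.isSeminormal_young hs
  refine ⟨hy.isMatrixModel (EvenAssoc.youngOrthonormal_eq s),
    fun d hd => EvenAssoc.existsUnique_isQRoot hlam hd (hs d hd), ?_⟩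
  intro b hb q M
  have hh := EvenAssoc.isSeminormal_heckeSeries hlam hb
  have hM := EvenAssoc.heckeModel_eq (EvenAssoc.qExp_ne_zero lam)
    (EvenAssoc.qExp_zpow_ne_one hlam) fun d => (b d : LaurentSeries k)
  refine ⟨hh.isMatrixModel hM, fun d hd => EvenAssoc.isEpsUnitary_heckeModel hlam hs hb hd,
    fun m α _ => ?_⟩
  obtain ⟨ρ₀, hρ₀⟩ := hy.exists_permRep α m
  obtain ⟨ρ, hρ⟩ := EvenAssoc.exists_infinitesimalHecke ρ₀
  -- The braid group representation is taken from the Hecke seminormal form; `hφ` then identifies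
  -- its generators with the images under the associator.
  obtain ⟨R, hR⟩ := hh.exists_rep α m
  have hφ : ∀ r : Fin m, EvenAssoc.phiHat lam Φ ρ r = EvenAssoc.seminormalMatrix
      (EvenAssoc.heckeDiag (EvenAssoc.qExp lam))
      (EvenAssoc.heckeOff (EvenAssoc.qExp lam) fun d => (b d : LaurentSeries k)) α r := by
    intro r
    rw [EvenAssoc.phiHat_eq, hρ.1, hρ.2 _ _ r.castSucc_lt_succ.ne,
      EvenAssoc.map_Y_eq_diagonal hy hρ₀ hρ, ← EvenAssoc.adjSwap, hρ₀]
    exact EvenAssoc.toLaurentMatrix_braidSeries_eq hlam hΦ heven hs hb α r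
  refine ⟨ρ₀, ρ, R, fun r => ?_, hρ, fun r => (hR r).trans (hφ r).symm, fun r => ?_, ?_⟩
  · rw [hρ₀, hy.tableauMatrix_eq (EvenAssoc.youngOrthonormal_eq s)]
  · rw [hφ, hh.tableauMatrix_eq hM]
  · refine EvenAssoc.isEpsUnitary_of_generators R fun r => ?_
    rw [hR]
    exact EvenAssoc.seminormalMatrix_mul_epsilon hlam hs hb α r
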